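/- \textbf{Setting.} Let $\Omega\subset\mathbb R^n$ be a bounded Lipschitz domain (open, bounded, locally the region above the graph of a Lipschitz function in suitable orthonormal coordinates; connectedness is not required), and let $\mathcal T_h$ be a finite family of pairwise disjoint bounded Lipschitz domains $K\subset\Omega$ with $\Omega\subset\bigcup_K\overline K$. For an open set $D$, let $L^2\Lambda^k(D)$ be the space of square-integrable $k$-forms on $D$ with inner product $(\cdot,\cdot)_D$ (it is $0$ unless $0\le k\le n$), let $\mathrm d$, $\delta$ be the weak exterior derivative and codifferential, $H\Lambda^k(D)=\{v\in L^2\Lambda^k(D):\mathrm dv\in L^2\Lambda^{k+1}(D)\}$ and $H^*\Lambda^k(D)=\{v\in L^2\Lambda^k(D):\delta v\in L^2\Lambda^{k-1}(D)\}$ with their graph norms, and $\mathring H\Lambda^k(D)$, $\mathring H^*\Lambda^k(D)$ the closures of $C_0^\infty\Lambda^k(D)$ in these norms. The tangential trace $v\mapsto v^{\mathrm{tan}}$ on $H\Lambda^k(D)$ has kernel $\mathring H\Lambda^k(D)$ and the normal trace $v\mapsto v^{\mathrm{nor}}$ on $H^*\Lambda^k(D)$ has kernel $\mathring H^*\Lambda^k(D)$;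 the spaces of traces are identified with the quotients by these kernels and carry the quotient norms, and tangential and normal traces are paired by $\langle\tau^{\mathrm{tan}},v^{\mathrm{nor}}\rangle_{\partial D}=(\mathrm d\tau,v)_D-(\tau,\delta v)_D$ for $\tau\in H\Lambda^{k-1}(D)$, $v\in H^*\Lambda^{k}(D)$. Let $$\mathfrak H^k=\{p\in H\Lambda^k(\Omega):\mathrm dp=0,\ (p,\mathrm d\tau)_\Omega=0\ \forall\tau\in H\Lambda^{k-1}(\Omega)\},$$ $$\mathring{\mathfrak H}^k(K)=\{p\in\mathring H\Lambda^k(K):\mathrm dp=0,\ (p,\mathrm d\tau)_K=0\ \forall\tau\in\mathring H\Lambda^{k-1}(K)\}.$$ Write $(\cdot,\cdot)_{\mathcal T_h}=\sum_K(\cdot,\cdot)_K$, $\langle\cdot,\cdot\rangle_{\partial\mathcal T_h}=\sum_K\langle\cdot,\cdot\rangle_{\partial K}$; on families indexed by $\mathcal T_h$ the operators $\mathrm d$, $\delta$ and the traces act on each $K$, and forms on $\Omega$ are restricted to each $K$. Set $W^k=\prod_KH\Lambda^k(K)$, $\overline{\mathfrak H}^k=\prod_K\mathring{\mathfrak H}^k(K)$,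 $\widehat W^{k,\mathrm{nor}}=\{\eta^{\mathrm{nor}}:\eta\in\prod_KH^*\Lambda^{k+1}(K)\}$, $\widehat V^{k,\mathrm{tan}}=\{v^{\mathrm{tan}}:v\in H\Lambda^k(\Omega)\}$ (traces on $\partial\mathcal T_h=\bigsqcup_K\partial K$). Let $k$ be an integer and $f\in L^2\Lambda^k(\Omega)$. \emph{Mixed Hodge--Laplace problem} (HL): find $\sigma\in H\Lambda^{k-1}(\Omega)$, $u\in H\Lambda^k(\Omega)$, $p\in\mathfrak H^k$ such that $$(\sigma,\tau)_\Omega-(u,\mathrm d\tau)_\Omega=0\ \ \forall\tau\in H\Lambda^{k-1}(\Omega),$$ $$(\mathrm d\sigma,v)_\Omega+(\mathrm du,\mathrm dv)_\Omega+(p,v)_\Omega=(f,v)_\Omega\ \ \forall v\in H\Lambda^k(\Omega),\qquad (u,q)_\Omega=0\ \ \forall q\in\mathfrak H^k.$$ \emph{Decomposed problem} (DD): find $\sigma\in W^{k-1}$, $u\in W^k$, $\overline p\in\overline{\mathfrak H}^k$, $\widehat u^{\mathrm{nor}}\in\widehat W^{k-1,\mathrm{nor}}$, $\widehat\rho^{\mathrm{nor}}\in\widehat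 W^{k,\mathrm{nor}}$, $p\in\mathfrak H^k$, $\overline u\in\overline{\mathfrak H}^k$, $\widehat\sigma^{\mathrm{tan}}\in\widehat V^{k-1,\mathrm{tan}}$, $\widehat u^{\mathrm{tan}}\in\widehat V^{k,\mathrm{tan}}$ such that $$\begin{aligned} (\sigma,\tau)_{\mathcal T_h}-(u,\mathrm d\tau)_{\mathcal T_h}+\langle\widehat u^{\mathrm{nor}},\tau^{\mathrm{tan}}\rangle_{\partial\mathcal T_h}&=0&&\forall\tau\in W^{k-1},\\ (\mathrm d\sigma,v)_{\mathcal T_h}+(\mathrm du,\mathrm dv)_{\mathcal T_h}+(\overline p+p,v)_{\mathcal T_h}-\langle\widehat\rho^{\mathrm{nor}},v^{\mathrm{tan}}\rangle_{\partial\mathcal T_h}&=(f,v)_{\mathcal T_h}&&\forall v\in W^k,\\ (\overline u-u,\overline q)_{\mathcal T_h}&=0&&\forall\overline q\in\overline{\mathfrak H}^k,\\ \langle\widehat\sigma^{\mathrm{tan}}-\sigma^{\mathrm{tan}},\widehat v^{\mathrm{nor}}\rangle_{\partial\mathcal T_h}&=0&&\forall\widehat v^{\mathrm{nor}}\in\widehat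 W^{k-1,\mathrm{nor}},\\ \langle\widehat u^{\mathrm{tan}}-u^{\mathrm{tan}},\widehat\eta^{\mathrm{nor}}\rangle_{\partial\mathcal T_h}&=0&&\forall\widehat\eta^{\mathrm{nor}}\in\widehat W^{k,\mathrm{nor}},\\ (u,q)_{\mathcal T_h}&=0&&\forall q\in\mathfrak H^k,\\ (\overline p,\overline v)_{\mathcal T_h}&=0&&\forall\overline v\in\overline{\mathfrak H}^k,\\ \langle\widehat u^{\mathrm{nor}},\widehat\tau^{\mathrm{tan}}\rangle_{\partial\mathcal T_h}&=0&&\forall\widehat\tau^{\mathrm{tan}}\in\widehat V^{k-1,\mathrm{tan}},\\ \langle\widehat\rho^{\mathrm{nor}},\widehat v^{\mathrm{tan}}\rangle_{\partial\mathcal T_h}&=0&&\forall\widehat v^{\mathrm{tan}}\in\widehat V^{k,\mathrm{tan}}. \end{aligned}$$ \textbf{Theorem.} (1) For every $f\in L^2\Lambda^k(\Omega)$ and every $(\sigma,u,\overline p,\widehat u^{\mathrm{nor}},\widehat\rho^{\mathrm{nor}},p,\overline u,\widehat\sigma^{\mathrm{tan}},\widehat u^{\mathrm{tan}})$ in the above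 spaces, the following are equivalent: (i) the tuple solves (DD); (ii) $\sigma$ and $u$ are the restrictions to the subdomains of forms in $H\Lambda^{k-1}(\Omega)$ and $H\Lambda^k(\Omega)$ which together with $p$ solve (HL), and moreover $\overline p=0$; $u|_K\in H^*\Lambda^k(K)$ and $(\mathrm du)|_K\in H^*\Lambda^{k+1}(K)$ for every $K$, with $\widehat u^{\mathrm{nor}}=u^{\mathrm{nor}}$ and $\widehat\rho^{\mathrm{nor}}=(\mathrm du)^{\mathrm{nor}}$; $\overline u$ is the $L^2$-orthogonal projection of $u$ onto $\overline{\mathfrak H}^k$; $\widehat\sigma^{\mathrm{tan}}=\sigma^{\mathrm{tan}}$; and $\widehat u^{\mathrm{tan}}=u^{\mathrm{tan}}$. (2) In particular, (DD) is well-posed: for every $f\in L^2\Lambda^k(\Omega)$ it has exactly one solution, and there is a constant $C$, independent of $f$, such that the norm of this solution in the product of the nine spaces (graph norms for $\sigma,u$; $L^2$ norms for $\overline p,p,\overline u$; quotient norms for the traces) is at most $C\|f\|_{L^2\Lambda^k(\Omega)}$. -/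

import Mathlib

open MeasureTheory Set Filter Topology
open scoped InnerProductSpace NNReal ContDiff

namespace HodgeDD

noncomputable section

/-! ## Alternating forms on Euclidean space and differential operators in coordinates -/

/-- The strictly increasing multi-indices of length `k` with entries in `{0, …, n-1}`, encoded as
subsets with `k` elements. The degree `k` is an integer, so that degrees `k < 0` and `k > n` give
the zero space of forms. -/
abbrev MultiIndex (n : ℕ) (k : ℤ) : Type := {I : Finset (Fin n) // (I.card : ℤ) = k}

/-- The space `Alt^k ℝⁿ`: the form `∑_I α_I dx^I` is given by its coefficients `α_I` in the basis
`dx^I = dx^{i₁} ∧ ⋯ ∧ dx^{i_k}`, `i₁ < ⋯ < i_k`. The inner product is the one for which this basis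
is orthonormal. -/
abbrev Alt (n : ℕ) (k : ℤ) : Type := EuclideanSpace ℝ (MultiIndex n k)

/-- The sign in `dx^i ∧ dx^I = ± dx^{I ∪ {i}}` for `i ∉ I`, namely `(-1)^{#{l ∈ I : l < i}}`. -/
def wedgeSign {n : ℕ} (i : Fin n) (I : Finset (Fin n)) : ℝ :=
  (-1) ^ (I.filter (· < i)).card

/-- The multi-index `J \ {i}`, for `i ∈ J`. -/
def MultiIndex.erase {n : ℕ} {k : ℤ} (J : MultiIndex n (k + 1)) (i : Fin n) (hi : i ∈ J.1) :
    MultiIndex n k :=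
  ⟨J.1.erase i, by
    have h1 := Finset.card_erase_add_one hi
    have h2 := J.2
    omega⟩

/-- The multi-index `I ∪ {i}`, for `i ∉ I`. -/
def MultiIndex.insert {n : ℕ} {k : ℤ} (I : MultiIndex n k) (i : Fin n) (hi : i ∉ I.1) :
    MultiIndex n (k + 1) :=
  ⟨Insert.insert i I.1, by
    have h1 := Finset.card_insert_of_notMem hi
    have h2 := I.2
    omega⟩

/-- The partial derivative `∂ᵢ α`, coefficient by coefficient. -/
def partialDeriv {n : ℕ} {k : ℤ} (i : Fin n) (α : EuclideanSpace ℝ (Fin n) → Alt n k)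
    (x : EuclideanSpace ℝ (Fin n)) : Alt n k :=
  fderiv ℝ α x (EuclideanSpace.single i 1)

/-- The exterior derivative `d(α_I dx^I) = ∂ᵢ α_I dx^i ∧ dx^I` of a differentiable `k`-form: its
`J`-th coefficient is `∑_{i ∈ J} ± ∂ᵢ α_{J \ {i}}`. -/
def extD {n : ℕ} {k : ℤ} (α : EuclideanSpace ℝ (Fin n) → Alt n k)
    (x : EuclideanSpace ℝ (Fin n)) : Alt n (k + 1) :=
  WithLp.toLp 2 fun J =>
    ∑ i : {i // i ∈ J.1}, wedgeSign i.1 J.1 * partialDeriv i.1 α x (J.erase i.1 i.2)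

/-- The codifferential `δ = (-1)^{k+1} ⋆⁻¹ d ⋆` of a differentiable `(k+1)`-form: its `I`-th
coefficient is `-∑_{i ∉ I} ± ∂ᵢ β_{I ∪ {i}}`. -/
def coD {n : ℕ} {k : ℤ} (β : EuclideanSpace ℝ (Fin n) → Alt n (k + 1))
    (x : EuclideanSpace ℝ (Fin n)) : Alt n k :=
  WithLp.toLp 2 fun I =>
    -∑ i : {i // i ∉ I.1}, wedgeSign i.1 I.1 * partialDeriv i.1 β x (I.insert i.1 i.2)

/-- The coefficients `α_I = α(e_{i₁}, …, e_{i_m})`, `i₁ < ⋯ < i_m`, of an alternating form. -/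
def altCoeff {n m : ℕ} (α : EuclideanSpace ℝ (Fin n) [⋀^Fin m]→L[ℝ] ℝ) : Alt n (m : ℤ) :=
  WithLp.toLp 2 fun I =>
    α fun r => EuclideanSpace.single (I.1.orderEmbOfFin (by exact_mod_cast I.2) r) 1

theorem card_filter_lt_orderEmbOfFin {n m : ℕ} (J : Finset (Fin n)) (h : J.card = m)
    (r : Fin m) : (J.filter (· < J.orderEmbOfFin h r)).card = r := by
  have : J.filter (· < J.orderEmbOfFin h r) =
      (Finset.Iio r).map (J.orderEmbOfFin h).toEmbedding := by
    ext i
    simp only [Finset.mem_filter, Finset.mem_map, Finset.mem_Iio]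
    constructor
    · rintro ⟨hi, hlt⟩
      obtain ⟨s, hs⟩ : i ∈ Set.range (J.orderEmbOfFin h) := by
        rw [Finset.range_orderEmbOfFin]; exact hi
      subst hs
      exact ⟨s, by simpa using hlt, rfl⟩
    · rintro ⟨s, hs, rfl⟩
      exact ⟨Finset.orderEmbOfFin_mem J h s, by simpa using hs⟩
  rw [this, Finset.card_map, Fin.card_Iio]

/-- In coordinates, the exterior derivative `extDeriv` is `extD`. -/
theorem extD_altCoeff {n m : ℕ}
    {θ : EuclideanSpace ℝ (Fin n) → EuclideanSpace ℝ (Fin n) [⋀^Fin m]→L[ℝ] ℝ}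
    {x : EuclideanSpace ℝ (Fin n)} (hθ : DifferentiableAt ℝ θ x) :
    extD (fun y => altCoeff (θ y)) x = altCoeff (m := m + 1) (extDeriv θ x) := by
  have hpd : ∀ (i : Fin n) (I : MultiIndex n (m : ℤ)),
      partialDeriv i (fun y => altCoeff (θ y)) x I =
        fderiv ℝ θ x (EuclideanSpace.single i 1)
          fun r => EuclideanSpace.single (I.1.orderEmbOfFin (by exact_mod_cast I.2) r) 1 := by
    intro i I
    have hd : ∀ w : Fin m → EuclideanSpace ℝ (Fin n), HasFDerivAt (fun y => θ y w)
        ((ContinuousAlternatingMap.apply ℝ _ ℝ w).comp (fderiv ℝ θ x)) x := fun w =>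
      (ContinuousAlternatingMap.apply ℝ _ ℝ w).hasFDerivAt.comp x hθ.hasFDerivAt
    have hdiff : DifferentiableAt ℝ (fun y => altCoeff (θ y)) x :=
      (differentiableAt_euclidean).2 fun I' => (hd _).differentiableAt
    have h1 := (EuclideanSpace.proj (𝕜 := ℝ) I).hasFDerivAt.comp x hdiff.hasFDerivAt
    have h2 := h1.unique (hd _)
    exact DFunLike.congr_fun h2 (EuclideanSpace.single i 1)
  ext J
  have hJ : J.1.card = m + 1 := by exact_mod_cast J.2
  change ∑ i : {i // i ∈ J.1}, _ = extDeriv θ x _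
  rw [extDeriv, ContinuousAlternatingMap.alternatizeUncurryFin_apply,
    ← Equiv.sum_comp (J.1.orderIsoOfFin hJ).toEquiv]
  refine Finset.sum_congr rfl fun r _ => ?_
  rw [hpd]
  have hs : wedgeSign ((J.1.orderIsoOfFin hJ r : {i // i ∈ J.1}) : Fin n) J.1 = (-1) ^ (r : ℕ) := by
    rw [wedgeSign, Finset.coe_orderIsoOfFin_apply, card_filter_lt_orderEmbOfFin]
  have hv : ∀ h', (fun s : Fin m => J.1.orderEmbOfFin hJ (r.succAbove s)) =
      ((J.erase ((J.1.orderIsoOfFin hJ r : {i // i ∈ J.1}) : Fin n)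
        (J.1.orderIsoOfFin hJ r).2).1.orderEmbOfFin h') := by
    intro h'
    refine Finset.orderEmbOfFin_unique h' (fun s => ?_) ?_
    · refine Finset.mem_erase.2 ⟨fun hc => ?_, Finset.orderEmbOfFin_mem _ _ _⟩
      exact Fin.succAbove_ne r s ((J.1.orderEmbOfFin hJ).injective hc)
    · exact (J.1.orderEmbOfFin hJ).strictMono.comp (Fin.strictMono_succAbove r)
  change wedgeSign ((J.1.orderIsoOfFin hJ r : {i // i ∈ J.1}) : Fin n) J.1 * _ = _
  rw [hs, zsmul_eq_mul]
  push_cast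
  congr 2
  funext s
  have h' : (J.erase ((J.1.orderIsoOfFin hJ r : {i // i ∈ J.1}) : Fin n)
        (J.1.orderIsoOfFin hJ r).2).1.card = m := by
    exact_mod_cast (J.erase _ (J.1.orderIsoOfFin hJ r).2).2
  have := congrFun (hv h') s
  exact congrArg (fun i => EuclideanSpace.single i (1 : ℝ)) this.symm

/-! ## Square-integrable forms and test forms -/

/-- `L²Λ^k(Ω)`, a Hilbert space with inner product `(α, β)_Ω = ∫_Ω ∑_I α_I β_I`. -/
abbrev L2Form {n : ℕ} (Ω : Set (EuclideanSpace ℝ (Fin n))) (k : ℤ) : Type :=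
  Lp (Alt n k) 2 (volume.restrict Ω)

/-- `C₀^∞Λ^k(Ω)`: smooth `k`-forms with compact support contained in `Ω`. -/
structure TestForm {n : ℕ} (Ω : Set (EuclideanSpace ℝ (Fin n))) (k : ℤ) where
  toFun : EuclideanSpace ℝ (Fin n) → Alt n k
  smooth : ContDiff ℝ ∞ toFun
  compact : HasCompactSupport toFun
  support_subset : tsupport toFun ⊆ Ω

section TestForms

variable {n : ℕ} {Ω : Set (EuclideanSpace ℝ (Fin n))} {k : ℤ}

theorem continuous_partialDeriv {α : EuclideanSpace ℝ (Fin n) → Alt n k} (h : ContDiff ℝ ∞ α)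
    (i : Fin n) : Continuous (partialDeriv i α) :=
  (h.continuous_fderiv (by simp)).clm_apply continuous_const

theorem partialDeriv_eq_zero {α : EuclideanSpace ℝ (Fin n) → Alt n k} (i : Fin n)
    {x : EuclideanSpace ℝ (Fin n)} (hx : x ∉ tsupport α) : partialDeriv i α x = 0 := by
  have h : fderiv ℝ α x = 0 := by
    by_contra hne
    exact hx (support_fderiv_subset ℝ hne)
  simp [partialDeriv, h]

theorem continuous_extD {α : EuclideanSpace ℝ (Fin n) → Alt n k} (h : ContDiff ℝ ∞ α) :
    Continuous (extD α) := by
  refine (PiLp.continuous_toLp 2 _).comp (continuous_pi fun J => continuous_finsetSum _ fun i _ =>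
    continuous_const.mul ?_)
  exact (continuous_apply _).comp
    ((PiLp.continuous_ofLp 2 _).comp (continuous_partialDeriv h i.1))

theorem continuous_coD {α : EuclideanSpace ℝ (Fin n) → Alt n (k + 1)} (h : ContDiff ℝ ∞ α) :
    Continuous (coD α) := by
  refine (PiLp.continuous_toLp 2 _).comp (continuous_pi fun J =>
    (continuous_finsetSum _ fun i _ => continuous_const.mul ?_).neg)
  exact (continuous_apply _).comp
    ((PiLp.continuous_ofLp 2 _).comp (continuous_partialDeriv h i.1))

theorem extD_eq_zero {α : EuclideanSpace ℝ (Fin n) → Alt n k}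
    {x : EuclideanSpace ℝ (Fin n)} (hx : x ∉ tsupport α) : extD α x = 0 := by
  ext J
  simp [extD, partialDeriv_eq_zero _ hx]

theorem coD_eq_zero {α : EuclideanSpace ℝ (Fin n) → Alt n (k + 1)}
    {x : EuclideanSpace ℝ (Fin n)} (hx : x ∉ tsupport α) : coD α x = 0 := by
  ext J
  simp [coD, partialDeriv_eq_zero _ hx]

theorem TestForm.memLp (η : TestForm Ω k) : MemLp η.toFun 2 (volume.restrict Ω) :=
  (η.smooth.continuous.memLp_of_hasCompactSupport (μ := volume) η.compact).restrict Ω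

theorem TestForm.memLp_extD (η : TestForm Ω k) : MemLp (extD η.toFun) 2 (volume.restrict Ω) :=
  ((continuous_extD η.smooth).memLp_of_hasCompactSupport (μ := volume)
    (HasCompactSupport.intro η.compact fun _ hx => extD_eq_zero hx)).restrict Ω

theorem TestForm.memLp_coD (η : TestForm Ω (k + 1)) :
    MemLp (coD η.toFun) 2 (volume.restrict Ω) :=
  ((continuous_coD η.smooth).memLp_of_hasCompactSupport (μ := volume)
    (HasCompactSupport.intro η.compact fun _ hx => coD_eq_zero hx)).restrict Ω

/-- A test form as an element of `L²Λ^k(Ω)`. -/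
def TestForm.toL2 (η : TestForm Ω k) : L2Form Ω k := η.memLp.toLp η.toFun

/-- The exterior derivative of a test form as an element of `L²Λ^{k+1}(Ω)`. -/
def TestForm.d (η : TestForm Ω k) : L2Form Ω (k + 1) := η.memLp_extD.toLp (extD η.toFun)

/-- The codifferential of a test form as an element of `L²Λ^k(Ω)`. -/
def TestForm.delta (η : TestForm Ω (k + 1)) : L2Form Ω k := η.memLp_coD.toLp (coD η.toFun)

end TestForms

/-! ## Weak derivatives and the Hilbert complexes -/

section Spaces

variable {n : ℕ} (Ω : Set (EuclideanSpace ℝ (Fin n))) (k : ℤ)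

/-- `w ∈ L²Λ^{k+1}(Ω)` is the weak exterior derivative of `v ∈ L²Λ^k(Ω)`:
`(w, η)_Ω = (v, δη)_Ω` for all test forms `η`. -/
def IsWeakD {n : ℕ} {Ω : Set (EuclideanSpace ℝ (Fin n))} {k : ℤ}
    (v : L2Form Ω k) (w : L2Form Ω (k + 1)) : Prop :=
  ∀ η : TestForm Ω (k + 1), ⟪w, η.toL2⟫_ℝ = ⟪v, η.delta⟫_ℝ

/-- `w ∈ L²Λ^k(Ω)` is the weak codifferential of `v ∈ L²Λ^{k+1}(Ω)`:
`(w, τ)_Ω = (v, dτ)_Ω` for all test forms `τ`. -/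
def IsWeakDelta {n : ℕ} {Ω : Set (EuclideanSpace ℝ (Fin n))} {k : ℤ}
    (v : L2Form Ω (k + 1)) (w : L2Form Ω k) : Prop :=
  ∀ τ : TestForm Ω k, ⟪w, τ.toL2⟫_ℝ = ⟪v, τ.d⟫_ℝ

/-- The graph of the weak exterior derivative in `L²Λ^k(Ω) × L²Λ^{k+1}(Ω)` (Hilbert sum). -/
def graphD : Submodule ℝ (WithLp 2 (L2Form Ω k × L2Form Ω (k + 1))) where
  carrier := {x | IsWeakD x.fst x.snd}
  add_mem' := by
    intro x y hx hy η
    simp only [WithLp.add_fst, WithLp.add_snd, inner_add_left]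
    rw [hx η, hy η]
  zero_mem' := by
    intro η
    simp
  smul_mem' := by
    intro c x hx η
    simp only [WithLp.smul_fst, WithLp.smul_snd, real_inner_smul_left]
    rw [hx η]

/-- The graph of the weak codifferential in `L²Λ^{k+1}(Ω) × L²Λ^k(Ω)` (Hilbert sum). -/
def graphDelta : Submodule ℝ (WithLp 2 (L2Form Ω (k + 1) × L2Form Ω k)) where
  carrier := {x | IsWeakDelta x.fst x.snd}
  add_mem' := by
    intro x y hx hy η
    simp only [WithLp.add_fst, WithLp.add_snd, inner_add_left]
    rw [hx η, hy η]
  zero_mem' := by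
    intro η
    simp
  smul_mem' := by
    intro c x hx η
    simp only [WithLp.smul_fst, WithLp.smul_snd, real_inner_smul_left]
    rw [hx η]

/-- `HΛ^k(Ω)`: an element is a form `v ∈ L²Λ^k(Ω)` together with its (unique) weak exterior
derivative `dv ∈ L²Λ^{k+1}(Ω)`; the inherited norm is the graph norm
`(‖v‖² + ‖dv‖²)^{1/2}`. -/
abbrev HForm : Type := graphD Ω k

/-- `H*Λ^{k+1}(Ω)`: an element is a form `v ∈ L²Λ^{k+1}(Ω)` together with its (unique) weak
codifferential `δv ∈ L²Λ^k(Ω)`, with the graph norm. Note the shift: the index `k` is the degree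
of `δv` and of the normal trace of `v`. -/
abbrev HStarForm : Type := graphDelta Ω k

variable {Ω k}

/-- The `L²` form underlying an element of `HΛ^k(Ω)`. -/
def HForm.form (v : HForm Ω k) : L2Form Ω k := v.1.fst

/-- The exterior derivative `dv` of `v ∈ HΛ^k(Ω)`. -/
def HForm.d (v : HForm Ω k) : L2Form Ω (k + 1) := v.1.snd

/-- The `L²` form underlying an element of `H*Λ^{k+1}(Ω)`. -/
def HStarForm.form (v : HStarForm Ω k) : L2Form Ω (k + 1) := v.1.fst

/-- The codifferential `δv` of `v ∈ H*Λ^{k+1}(Ω)`. -/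
def HStarForm.delta (v : HStarForm Ω k) : L2Form Ω k := v.1.snd

variable (Ω k)

/-- The span of the pairs `(η, dη)` with `η ∈ C₀^∞Λ^k(Ω)`. -/
def testGraphD : Submodule ℝ (WithLp 2 (L2Form Ω k × L2Form Ω (k + 1))) :=
  Submodule.span ℝ (range fun η : TestForm Ω k => WithLp.toLp 2 (η.toL2, η.d))

/-- The span of the pairs `(η, δη)` with `η ∈ C₀^∞Λ^{k+1}(Ω)`. -/
def testGraphDelta : Submodule ℝ (WithLp 2 (L2Form Ω (k + 1) × L2Form Ω k)) :=
  Submodule.span ℝ (range fun η : TestForm Ω (k + 1) => WithLp.toLp 2 (η.toL2, η.delta))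

/-- `H̊Λ^k(Ω) ⊆ HΛ^k(Ω)`: the closure of `C₀^∞Λ^k(Ω)` in the graph norm. -/
def HForm₀ : Submodule ℝ (HForm Ω k) :=
  (testGraphD Ω k).topologicalClosure.comap (graphD Ω k).subtype

/-- `H̊*Λ^{k+1}(Ω) ⊆ H*Λ^{k+1}(Ω)`: the closure of `C₀^∞Λ^{k+1}(Ω)` in the graph norm. -/
def HStarForm₀ : Submodule ℝ (HStarForm Ω k) :=
  (testGraphDelta Ω k).topologicalClosure.comap (graphDelta Ω k).subtype

/-! ## Traces -/

/-- The space of tangential traces of `HΛ^k(Ω)` on `∂Ω`. The tangential trace operator on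
`HΛ^k(Ω)` has kernel `H̊Λ^k(Ω)`; its range is identified with the quotient, which carries the
quotient (minimal extension) norm. -/
abbrev TanTrace : Type := HForm Ω k ⧸ HForm₀ Ω k

/-- The space of normal traces (of degree `k`) of `H*Λ^{k+1}(Ω)` on `∂Ω`, the quotient by the
kernel `H̊*Λ^{k+1}(Ω)` of the normal trace operator, with the quotient norm. -/
abbrev NorTrace : Type := HStarForm Ω k ⧸ HStarForm₀ Ω k

variable {Ω k}

/-- The tangential trace `v^tan` of `v ∈ HΛ^k(Ω)`. -/
def HForm.tan (v : HForm Ω k) : TanTrace Ω k := (HForm₀ Ω k).mkQ v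

/-- The normal trace `v^nor` of `v ∈ H*Λ^{k+1}(Ω)`. -/
def HStarForm.nor (v : HStarForm Ω k) : NorTrace Ω k := (HStarForm₀ Ω k).mkQ v

variable (Ω k)

/-- The bilinear form `(dτ, v)_Ω - (τ, δv)_Ω` on `HΛ^k(Ω) × H*Λ^{k+1}(Ω)`. -/
def ibpForm : HForm Ω k →ₗ[ℝ] HStarForm Ω k →ₗ[ℝ] ℝ :=
  LinearMap.mk₂ ℝ (fun τ v => ⟪τ.d, v.form⟫_ℝ - ⟪τ.form, v.delta⟫_ℝ)
    (by
      intro a b v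
      simp only [HForm.d, HForm.form, Submodule.coe_add, WithLp.add_fst, WithLp.add_snd,
        inner_add_left]
      ring)
    (by
      intro c a v
      simp only [HForm.d, HForm.form, Submodule.coe_smul, WithLp.smul_fst, WithLp.smul_snd,
        real_inner_smul_left, smul_eq_mul]
      ring)
    (by
      intro a v w
      simp only [HStarForm.delta, HStarForm.form, Submodule.coe_add, WithLp.add_fst,
        WithLp.add_snd, inner_add_right]
      ring)
    (by
      intro c a v
      simp only [HStarForm.delta, HStarForm.form, Submodule.coe_smul, WithLp.smul_fst,
        WithLp.smul_snd, real_inner_smul_right, smul_eq_mul]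
      ring)

variable {Ω k}

theorem ibpForm_eq_zero_left {τ : HForm Ω k} (hτ : τ ∈ HForm₀ Ω k) (v : HStarForm Ω k) :
    ibpForm Ω k τ v = 0 := by
  have hcl : IsClosed {x : WithLp 2 (L2Form Ω k × L2Form Ω (k + 1)) |
      ⟪x.snd, v.form⟫_ℝ - ⟪x.fst, v.delta⟫_ℝ = 0} :=
    isClosed_eq (((WithLp.continuous_snd 2 _ _).inner continuous_const).sub
      ((WithLp.continuous_fst 2 _ _).inner continuous_const)) continuous_const
  have hsub : ((testGraphD Ω k : Submodule ℝ _) : Set _) ⊆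
      {x : WithLp 2 (L2Form Ω k × L2Form Ω (k + 1)) |
        ⟪x.snd, v.form⟫_ℝ - ⟪x.fst, v.delta⟫_ℝ = 0} := by
    intro x hx
    refine Submodule.span_induction ?_ ?_ ?_ ?_ hx
    · rintro _ ⟨η, rfl⟩
      have := v.2 η
      change ⟪η.d, v.form⟫_ℝ - ⟪η.toL2, v.delta⟫_ℝ = 0
      rw [real_inner_comm, real_inner_comm v.delta]
      exact sub_eq_zero.mpr this.symm
    · simp
    · intro a b _ _ ha hb
      simp only [mem_ofPred_eq, WithLp.add_fst, WithLp.add_snd, inner_add_left] at *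
      linarith
    · intro c a _ ha
      simp only [mem_ofPred_eq, WithLp.smul_fst, WithLp.smul_snd, real_inner_smul_left] at *
      rw [← mul_sub, ha, mul_zero]
  exact closure_minimal hsub hcl hτ

theorem ibpForm_eq_zero_right (τ : HForm Ω k) {v : HStarForm Ω k} (hv : v ∈ HStarForm₀ Ω k) :
    ibpForm Ω k τ v = 0 := by
  have hcl : IsClosed {x : WithLp 2 (L2Form Ω (k + 1) × L2Form Ω k) |
      ⟪τ.d, x.fst⟫_ℝ - ⟪τ.form, x.snd⟫_ℝ = 0} :=
    isClosed_eq ((continuous_const.inner (WithLp.continuous_fst 2 _ _)).sub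
      (continuous_const.inner (WithLp.continuous_snd 2 _ _))) continuous_const
  have hsub : ((testGraphDelta Ω k : Submodule ℝ _) : Set _) ⊆
      {x : WithLp 2 (L2Form Ω (k + 1) × L2Form Ω k) |
        ⟪τ.d, x.fst⟫_ℝ - ⟪τ.form, x.snd⟫_ℝ = 0} := by
    intro x hx
    refine Submodule.span_induction ?_ ?_ ?_ ?_ hx
    · rintro _ ⟨η, rfl⟩
      exact sub_eq_zero.mpr (τ.2 η)
    · simp
    · intro a b _ _ ha hb
      simp only [mem_ofPred_eq, WithLp.add_fst, WithLp.add_snd, inner_add_right] at *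
      linarith
    · intro c a _ ha
      simp only [mem_ofPred_eq, WithLp.smul_fst, WithLp.smul_snd, real_inner_smul_right] at *
      rw [← mul_sub, ha, mul_zero]
  exact closure_minimal hsub hcl hv

variable (Ω k)

/-- The duality pairing `⟨τ^tan, v^nor⟩_{∂Ω}` of tangential and normal traces, given by the
integration by parts formula `⟨τ^tan, v^nor⟩_{∂Ω} = (dτ, v)_Ω - (τ, δv)_Ω`. -/
def tracePairing : TanTrace Ω k →ₗ[ℝ] NorTrace Ω k →ₗ[ℝ] ℝ :=
  (HForm₀ Ω k).liftQ
    (LinearMap.flip ((HStarForm₀ Ω k).liftQ (ibpForm Ω k).flip (by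
      intro v hv
      rw [LinearMap.mem_ker]
      ext τ
      exact ibpForm_eq_zero_right τ hv)))
    (by
      intro τ hτ
      rw [LinearMap.mem_ker]
      ext v
      exact ibpForm_eq_zero_left hτ v)

variable {Ω k}

theorem tracePairing_tan_nor (τ : HForm Ω k) (v : HStarForm Ω k) :
    tracePairing Ω k τ.tan v.nor = ⟪τ.d, v.form⟫_ℝ - ⟪τ.form, v.delta⟫_ℝ := rfl

/-- The form `v ∈ L²Λ^{k+1}(Ω)` belongs to `H*Λ^{k+1}(Ω)` and its normal trace is `t`. -/
def HasNorTrace (v : L2Form Ω (k + 1)) (t : NorTrace Ω k) : Prop :=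
  ∃ w : HStarForm Ω k, w.form = v ∧ w.nor = t

end Spaces

/-! ## Harmonic forms. Here `j` is one less than the degree of the harmonic forms. -/

section Harmonic

variable {n : ℕ} (Ω : Set (EuclideanSpace ℝ (Fin n))) (j : ℤ)

/-- The harmonic forms `𝔥^{j+1} = ℨ^{j+1} ∩ (𝔅^{j+1})^⊥ ⊆ L²Λ^{j+1}(Ω)` of the complex `HΛ(Ω)`:
closed forms orthogonal to all `dτ`, `τ ∈ HΛ^j(Ω)`. -/
def harmonic : Submodule ℝ (L2Form Ω (j + 1)) where
  carrier := {p | (∃ v : HForm Ω (j + 1), v.form = p ∧ v.d = 0) ∧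
    ∀ τ : HForm Ω j, ⟪p, τ.d⟫_ℝ = 0}
  add_mem' := by
    rintro _ _ ⟨⟨v, rfl, hv⟩, h⟩ ⟨⟨w, rfl, hw⟩, h'⟩
    refine ⟨⟨v + w, rfl, ?_⟩, fun τ => by rw [inner_add_left, h, h', add_zero]⟩
    change v.d + w.d = 0
    rw [hv, hw, add_zero]
  zero_mem' := ⟨⟨0, rfl, rfl⟩, fun τ => inner_zero_left _⟩
  smul_mem' := by
    rintro c _ ⟨⟨v, rfl, hv⟩, h⟩
    refine ⟨⟨c • v, rfl, ?_⟩, fun τ => by rw [real_inner_smul_left, h, mul_zero]⟩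
    change c • v.d = 0
    rw [hv, smul_zero]

/-- The harmonic forms `𝔥̊^{j+1}(Ω) ⊆ L²Λ^{j+1}(Ω)` of the complex `H̊Λ(Ω)`: closed forms in
`H̊Λ^{j+1}(Ω)` orthogonal to all `dτ`, `τ ∈ H̊Λ^j(Ω)`. -/
def harmonic₀ : Submodule ℝ (L2Form Ω (j + 1)) where
  carrier := {p | (∃ v ∈ HForm₀ Ω (j + 1), HForm.form v = p ∧ HForm.d v = 0) ∧
    ∀ τ ∈ HForm₀ Ω j, ⟪p, HForm.d τ⟫_ℝ = 0}
  add_mem' := by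
    rintro _ _ ⟨⟨v, hv₀, rfl, hv⟩, h⟩ ⟨⟨w, hw₀, rfl, hw⟩, h'⟩
    refine ⟨⟨v + w, add_mem hv₀ hw₀, rfl, ?_⟩,
      fun τ hτ => by rw [inner_add_left, h τ hτ, h' τ hτ, add_zero]⟩
    change v.d + w.d = 0
    rw [hv, hw, add_zero]
  zero_mem' := ⟨⟨0, zero_mem _, rfl, rfl⟩, fun τ _ => inner_zero_left _⟩
  smul_mem' := by
    rintro c _ ⟨⟨v, hv₀, rfl, hv⟩, h⟩
    refine ⟨⟨c • v, Submodule.smul_mem _ c hv₀, rfl, ?_⟩,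
      fun τ hτ => by rw [real_inner_smul_left, h τ hτ, mul_zero]⟩
    change c • v.d = 0
    rw [hv, smul_zero]

theorem isClosed_harmonic₀ : IsClosed (harmonic₀ Ω j : Set (L2Form Ω (j + 1))) := by
  have hcont : Continuous fun p : L2Form Ω (j + 1) =>
      (WithLp.toLp 2 (p, 0) : WithLp 2 (L2Form Ω (j + 1) × L2Form Ω (j + 1 + 1))) :=
    (WithLp.prod_continuous_toLp 2 _ _).comp (continuous_id.prodMk continuous_const)
  have heq : (harmonic₀ Ω j : Set (L2Form Ω (j + 1))) =
      ({p | ∀ η : TestForm Ω (j + 1 + 1), ⟪p, η.delta⟫_ℝ = 0} ∩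
        (fun p : L2Form Ω (j + 1) => (WithLp.toLp 2 (p, 0) :
          WithLp 2 (L2Form Ω (j + 1) × L2Form Ω (j + 1 + 1)))) ⁻¹'
          ((testGraphD Ω (j + 1)).topologicalClosure : Set _)) ∩
      {p | ∀ τ ∈ HForm₀ Ω j, ⟪p, HForm.d τ⟫_ℝ = 0} := by
    ext p
    constructor
    · rintro ⟨⟨⟨⟨⟨a, b⟩⟩, hv⟩, hv₀, hp, hd⟩, h⟩
      change a = p at hp
      change b = 0 at hd
      subst hp hd
      refine ⟨⟨fun η => ?_, hv₀⟩, h⟩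
      have := hv η
      simpa using this.symm
    · rintro ⟨⟨h1, h2⟩, h⟩
      refine ⟨⟨⟨WithLp.toLp 2 (p, 0), fun η => ?_⟩, h2, rfl, rfl⟩, h⟩
      simpa using (h1 η).symm
  rw [heq]
  refine (IsClosed.inter ?_
    ((Submodule.isClosed_topologicalClosure _).preimage hcont)).inter ?_
  · simp only [ofPred_forall]
    exact isClosed_iInter fun η =>
      isClosed_eq (continuous_id.inner continuous_const) continuous_const
  · simp only [ofPred_forall]
    exact isClosed_iInter fun τ => isClosed_iInter fun _ =>
      isClosed_eq (continuous_id.inner continuous_const) continuous_const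

instance : CompleteSpace (harmonic₀ Ω j) := (isClosed_harmonic₀ Ω j).completeSpace_coe

end Harmonic

/-! ## Restriction to subdomains -/

section Restriction

variable {n : ℕ} {Ω K : Set (EuclideanSpace ℝ (Fin n))} {k : ℤ}

/-- Restriction `L²Λ^k(Ω) → L²Λ^k(K)` for `K ⊆ Ω`. -/
def restrictL2 (h : K ⊆ Ω) (v : L2Form Ω k) : L2Form K k :=
  ((Lp.memLp v).mono_measure (Measure.restrict_mono h le_rfl)).toLp v

theorem restrictL2_add (h : K ⊆ Ω) (v w : L2Form Ω k) :
    restrictL2 h (v + w) = restrictL2 h v + restrictL2 h w := by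
  unfold restrictL2
  rw [← MemLp.toLp_add]
  exact MemLp.toLp_congr _ _ (ae_mono (Measure.restrict_mono h le_rfl) (Lp.coeFn_add v w))

theorem restrictL2_smul (h : K ⊆ Ω) (c : ℝ) (v : L2Form Ω k) :
    restrictL2 h (c • v) = c • restrictL2 h v := by
  unfold restrictL2
  rw [← MemLp.toLp_const_smul]
  exact MemLp.toLp_congr _ _ (ae_mono (Measure.restrict_mono h le_rfl) (Lp.coeFn_smul c v))

theorem inner_restrictL2 (h : K ⊆ Ω) (v : L2Form Ω k)
    {g : EuclideanSpace ℝ (Fin n) → Alt n k} (hg : ∀ x ∉ K, g x = 0)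
    (hK : MemLp g 2 (volume.restrict K)) (hΩ : MemLp g 2 (volume.restrict Ω)) :
    ⟪restrictL2 h v, hK.toLp g⟫_ℝ = ⟪v, hΩ.toLp g⟫_ℝ := by
  rw [L2.inner_def, L2.inner_def]
  have h1 : ∫ x in K, ⟪restrictL2 h v x, hK.toLp g x⟫_ℝ = ∫ x in K, ⟪v x, g x⟫_ℝ := by
    refine integral_congr_ae ?_
    filter_upwards [hK.coeFn_toLp, MemLp.coeFn_toLp
      ((Lp.memLp v).mono_measure (Measure.restrict_mono h le_rfl))] with x hx hx'
    rw [hx, restrictL2, hx']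
  have h2 : ∫ x in Ω, ⟪v x, hΩ.toLp g x⟫_ℝ = ∫ x in Ω, ⟪v x, g x⟫_ℝ := by
    refine integral_congr_ae ?_
    filter_upwards [hΩ.coeFn_toLp] with x hx
    rw [hx]
  rw [h1, h2, setIntegral_eq_integral_of_forall_compl_eq_zero,
    setIntegral_eq_integral_of_forall_compl_eq_zero]
  · intro x hx
    rw [hg x fun hxK => hx (h hxK), inner_zero_right]
  · intro x hx
    rw [hg x hx, inner_zero_right]

theorem IsWeakD.restrict (h : K ⊆ Ω) {v : L2Form Ω k} {w : L2Form Ω (k + 1)}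
    (hv : IsWeakD v w) : IsWeakD (restrictL2 h v) (restrictL2 h w) := by
  intro η
  have key := hv ⟨η.toFun, η.smooth, η.compact, η.support_subset.trans h⟩
  have hout : ∀ x ∉ K, x ∉ tsupport η.toFun := fun x hx hx' => hx (η.support_subset hx')
  unfold TestForm.toL2 TestForm.delta at key ⊢
  rw [inner_restrictL2 h w (fun x hx => image_eq_zero_of_notMem_tsupport (hout x hx)) _
      (TestForm.memLp ⟨η.toFun, η.smooth, η.compact, η.support_subset.trans h⟩),
    inner_restrictL2 h v (fun x hx => coD_eq_zero (hout x hx)) _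
      (TestForm.memLp_coD ⟨η.toFun, η.smooth, η.compact, η.support_subset.trans h⟩)]
  exact key

/-- Restriction `HΛ^k(Ω) → HΛ^k(K)` for `K ⊆ Ω`. -/
def restrictH (h : K ⊆ Ω) : HForm Ω k →ₗ[ℝ] HForm K k where
  toFun v := ⟨WithLp.toLp 2 (restrictL2 h v.form, restrictL2 h v.d), IsWeakD.restrict h v.2⟩
  map_add' v w := by
    apply Subtype.ext
    change WithLp.toLp 2 (restrictL2 h (v.form + w.form), restrictL2 h (v.d + w.d)) = _
    rw [restrictL2_add, restrictL2_add]
    rfl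
  map_smul' c v := by
    apply Subtype.ext
    change WithLp.toLp 2 (restrictL2 h (c • v.form), restrictL2 h (c • v.d)) = _
    rw [restrictL2_smul, restrictL2_smul]
    rfl

end Restriction

/-! ## Lipschitz domains and their decompositions -/

/-- A bounded Lipschitz domain: a bounded open set that, near each boundary point and in suitable
orthonormal coordinates, is the region above the graph of a Lipschitz function. The last coordinate
is `⟪ν, y⟫` and the remaining ones are those of the component `y - ⟪ν, y⟫ ν` orthogonal to `ν`. -/
def IsBoundedLipschitzDomain {n : ℕ} (Ω : Set (EuclideanSpace ℝ (Fin n))) : Prop :=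
  IsOpen Ω ∧ Bornology.IsBounded Ω ∧
    ∀ x ∈ frontier Ω, ∃ ν : EuclideanSpace ℝ (Fin n), ‖ν‖ = 1 ∧
      ∃ (L : ℝ≥0) (φ : EuclideanSpace ℝ (Fin n) → ℝ), LipschitzWith L φ ∧
        ∀ᶠ y in 𝓝 x, y ∈ Ω ↔ φ (y - ⟪ν, y⟫_ℝ • ν) < ⟪ν, y⟫_ℝ

/-- A (finite) decomposition of `Ω` into Lipschitz subdomains with non-overlapping interiors. -/
structure IsDecomposition {n : ℕ} {ι : Type*} (Ω : Set (EuclideanSpace ℝ (Fin n)))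
    (K : ι → Set (EuclideanSpace ℝ (Fin n))) : Prop where
  lipschitz : ∀ i, IsBoundedLipschitzDomain (K i)
  subset : ∀ i, K i ⊆ Ω
  disjoint : Pairwise fun i i' => Disjoint (K i) (K i')
  cover : Ω ⊆ ⋃ i, closure (K i)

/-! ## The mixed Hodge–Laplace problem and its domain decomposition

The unknown `u` has degree `k = j + 1`. -/

/-- `(σ, u, p)` solves the mixed Hodge–Laplace problem on `Ω` for `k = j + 1`. -/
structure IsMixedSolution {n : ℕ} {Ω : Set (EuclideanSpace ℝ (Fin n))} {j : ℤ}
    (f : L2Form Ω (j + 1)) (σ : HForm Ω j) (u : HForm Ω (j + 1)) (p : harmonic Ω j) : Prop where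
  eq_τ : ∀ τ : HForm Ω j, ⟪σ.form, τ.form⟫_ℝ - ⟪u.form, τ.d⟫_ℝ = 0
  eq_v : ∀ v : HForm Ω (j + 1),
    ⟪σ.d, v.form⟫_ℝ + ⟪u.d, v.d⟫_ℝ + ⟪(p : L2Form Ω (j + 1)), v.form⟫_ℝ = ⟪f, v.form⟫_ℝ
  eq_q : ∀ q : harmonic Ω j, ⟪u.form, (q : L2Form Ω (j + 1))⟫_ℝ = 0

section Decomposed

variable {n : ℕ} {ι : Type*} {Ω : Set (EuclideanSpace ℝ (Fin n))}
  {K : ι → Set (EuclideanSpace ℝ (Fin n))}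

/-- The tangential trace on `∂𝒯_h = ⨆ᵢ ∂Kᵢ` of an unbroken form `v ∈ HΛ^k(Ω)`. -/
def unbrokenTan (hK : ∀ i, K i ⊆ Ω) (k : ℤ) : HForm Ω k →ₗ[ℝ] (∀ i, TanTrace (K i) k) :=
  LinearMap.pi fun i => (HForm₀ (K i) k).mkQ ∘ₗ restrictH (hK i)

/-- `V̂^{k,tan} = {v^tan : v ∈ HΛ^k(Ω)}`, the single-valued tangential traces on `∂𝒯_h`. -/
def singleValuedTan (hK : ∀ i, K i ⊆ Ω) (k : ℤ) : Submodule ℝ (∀ i, TanTrace (K i) k) :=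
  LinearMap.range (unbrokenTan hK k)

/-- The nine unknowns of the domain-decomposed Hodge–Laplace problem for `k = j + 1`. Broken forms,
and traces on `∂𝒯_h`, are families indexed by the subdomains. -/
@[ext]
structure DDTuple (hK : ∀ i, K i ⊆ Ω) (j : ℤ) where
  /-- `σ ∈ W^{k-1} = HΛ^{k-1}(𝒯_h)` -/
  σ : ∀ i, HForm (K i) j
  /-- `u ∈ W^k = HΛ^k(𝒯_h)` -/
  u : ∀ i, HForm (K i) (j + 1)
  /-- `p̄ ∈ ∏ᵢ 𝔥̊^k(Kᵢ)` -/
  pBar : ∀ i, harmonic₀ (K i) j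
  /-- `û^nor ∈ Ŵ^{k-1,nor} = {η^nor : η ∈ H*Λ^k(𝒯_h)}` -/
  uNor : ∀ i, NorTrace (K i) j
  /-- `ρ̂^nor ∈ Ŵ^{k,nor} = {η^nor : η ∈ H*Λ^{k+1}(𝒯_h)}` -/
  ρNor : ∀ i, NorTrace (K i) (j + 1)
  /-- `p ∈ 𝔥^k` -/
  p : harmonic Ω j
  /-- `ū ∈ ∏ᵢ 𝔥̊^k(Kᵢ)` -/
  uBar : ∀ i, harmonic₀ (K i) j
  /-- `σ̂^tan ∈ V̂^{k-1,tan}` -/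
  σTan : singleValuedTan hK j
  /-- `û^tan ∈ V̂^{k,tan}` -/
  uTan : singleValuedTan hK (j + 1)

variable [Fintype ι]

/-- The norm of a nine-tuple in the product of the nine Hilbert spaces: `HΛ` graph norms for `σ`
and `u`, `L²` norms for `p̄`, `p`, `ū`, and trace norms on `∂𝒯_h` for the four traces. -/
def DDTuple.size {hK : ∀ i, K i ⊆ Ω} {j : ℤ} (x : DDTuple hK j) : ℝ :=
  √(∑ i, (‖x.σ i‖ ^ 2 + ‖x.u i‖ ^ 2 + ‖x.pBar i‖ ^ 2 + ‖x.uNor i‖ ^ 2 + ‖x.ρNor i‖ ^ 2 +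
    ‖x.uBar i‖ ^ 2 + ‖x.σTan.1 i‖ ^ 2 + ‖x.uTan.1 i‖ ^ 2) + ‖x.p‖ ^ 2)

/-- The inner product `(a, b)_{𝒯_h} = ∑_K (a, b)_K` of broken `k`-forms. -/
def brokenInner {k : ℤ} (a b : ∀ i, L2Form (K i) k) : ℝ := ∑ i, ⟪a i, b i⟫_ℝ

/-- The pairing `⟨τ^tan, v^nor⟩_{∂𝒯_h} = ∑_K ⟨τ^tan, v^nor⟩_{∂K}` of traces of degree `k`. -/
def brokenPairing {k : ℤ} (τ : ∀ i, TanTrace (K i) k) (v : ∀ i, NorTrace (K i) k) : ℝ :=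
  ∑ i, tracePairing (K i) k (τ i) (v i)

/-- The nine-tuple `x` solves the domain-decomposed Hodge–Laplace problem with right-hand side
`f ∈ L²Λ^k(Ω)`, `k = j + 1`. -/
structure IsDDSolution {hK : ∀ i, K i ⊆ Ω} {j : ℤ} (f : L2Form Ω (j + 1))
    (x : DDTuple hK j) : Prop where
  eq_τ : ∀ τ : ∀ i, HForm (K i) j,
    brokenInner (fun i => (x.σ i).form) (fun i => (τ i).form) -
      brokenInner (fun i => (x.u i).form) (fun i => (τ i).d) +
      brokenPairing (fun i => (τ i).tan) x.uNor = 0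
  eq_v : ∀ v : ∀ i, HForm (K i) (j + 1),
    brokenInner (fun i => (x.σ i).d) (fun i => (v i).form) +
      brokenInner (fun i => (x.u i).d) (fun i => (v i).d) +
      brokenInner (fun i => (x.pBar i).1 + restrictL2 (hK i) x.p.1) (fun i => (v i).form) -
      brokenPairing (fun i => (v i).tan) x.ρNor =
    brokenInner (fun i => restrictL2 (hK i) f) (fun i => (v i).form)
  eq_qBar : ∀ q : ∀ i, harmonic₀ (K i) j,
    brokenInner (fun i => (x.uBar i).1 - (x.u i).form) (fun i => (q i).1) = 0
  eq_vNor : ∀ v : ∀ i, NorTrace (K i) j,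
    brokenPairing (x.σTan.1 - fun i => (x.σ i).tan) v = 0
  eq_ηNor : ∀ η : ∀ i, NorTrace (K i) (j + 1),
    brokenPairing (x.uTan.1 - fun i => (x.u i).tan) η = 0
  eq_q : ∀ q : harmonic Ω j,
    brokenInner (fun i => (x.u i).form) (fun i => restrictL2 (hK i) q.1) = 0
  eq_vBar : ∀ v : ∀ i, harmonic₀ (K i) j,
    brokenInner (fun i => (x.pBar i).1) (fun i => (v i).1) = 0
  eq_τTan : ∀ τ : singleValuedTan hK j, brokenPairing τ.1 x.uNor = 0
  eq_vTan : ∀ v : singleValuedTan hK (j + 1), brokenPairing v.1 x.ρNor = 0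

/-- The first three unknowns `(σ, u, p)` are (the restrictions to the subdomains of) a solution of
the mixed Hodge–Laplace problem on `Ω`, and the other six are `p̄ = 0`, `û^nor = u^nor`,
`ρ̂^nor = (du)^nor`, `ū` the `L²`-orthogonal projection of `u`, `σ̂^tan = σ^tan` and
`û^tan = u^tan`. -/
structure IsDecomposedMixedSolution {hK : ∀ i, K i ⊆ Ω} {j : ℤ} (f : L2Form Ω (j + 1))
    (x : DDTuple hK j) : Prop where
  mixed : ∃ (σ : HForm Ω j) (u : HForm Ω (j + 1)),
    (∀ i, restrictH (hK i) σ = x.σ i) ∧ (∀ i, restrictH (hK i) u = x.u i) ∧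
      IsMixedSolution f σ u x.p
  pBar : ∀ i, x.pBar i = 0
  uNor : ∀ i, HasNorTrace (x.u i).form (x.uNor i)
  ρNor : ∀ i, HasNorTrace (x.u i).d (x.ρNor i)
  uBar : ∀ i, x.uBar i = (harmonic₀ (K i) j).orthogonalProjectionOnto (x.u i).form
  σTan : ∀ i, x.σTan.1 i = (x.σ i).tan
  uTan : ∀ i, x.uTan.1 i = (x.u i).tan

end Decomposed

end

end HodgeDD

open HodgeDD

/-!
The equivalence rests on integration by parts. Tested on one subdomain `K` at a time, first with
smooth compactly supported forms and then with arbitrary ones, the first two equations of the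
decomposed problem say that `δ(u|_K) = σ|_K` and `δ(du|_K) = f - p̄ - p - dσ`, and that the two
normal unknowns are the normal traces of `u` and `du` (`hasNorTrace_of_pairing`). The pairing of
tangential and normal traces is nondegenerate on both sides, because `H̊Λ` and `H̊*Λ` are recovered
from the integration-by-parts identity that their elements satisfy (`mem_HForm₀_of_ibpForm`,
`mem_HStarForm₀_of_ibpForm`). Hence the tangential unknowns are the traces of `σ` and `u`. Since
these come from global forms, `σ` and `u` themselves are global: a broken form with the tangential
trace of a global form `w` differs from `w` by elements of `H̊Λ(K)`, which extend by zero
(`IsDecomposition.exists_glue`). On global test forms the boundary terms drop out, and the mixed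
Hodge–Laplace problem remains; that the sums over the subdomains are integrals over `Ω` uses that
the boundary of a Lipschitz domain is a null set (`IsBoundedLipschitzDomain.volume_frontier`).

Well-posedness thus reduces to that of the mixed Hodge–Laplace problem, which follows from the
Poincaré inequality `‖v‖ ≤ C ‖dv‖` for `v ∈ HΛ^k(Ω)` orthogonal to the closed forms
(`IsBoundedLipschitzDomain.poincare`): by Lax–Milgram on that space, `f` splits into a harmonic
part `p`, an exact part `dσ`, and a part `δdu` (`IsBoundedLipschitzDomain.exists_isMixedSolution`).

The Poincaré inequality is obtained without a compact embedding theorem. A form `v` orthogonal to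
the closed forms is a limit of co-exact test forms `ξ = δη`, so that it suffices to bound `(v, ξ)`.
A partition of unity `χᵢ` splits `ξ` into pieces `χᵢ ξ` whose supports stay in `Ω` when translated
along a small ball of directions (`IsBoundedLipschitzDomain.exists_cone`). Along a translation in
the direction `a`, the formula `δ(a ∧ ζ) + a ∧ δζ = -∂_a ζ` shows that `(v, χᵢ ξ)` changes by at
most `C |a| (‖dv‖ + ‖v‖) ‖ξ‖` (`abs_inner_translate_sub_le`), in which the term with `‖v‖` is
absorbed for small `|a|`. The average of the translated pairings over the ball of directions, on the
other hand, only involves local averages of `v`, and these are small as soon as `v` is orthogonal to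
a suitable finite-dimensional space (`exists_finiteDimensional_average_le`). This proves the
inequality up to finitely many dimensions
(`IsBoundedLipschitzDomain.exists_finiteDimensional_poincare`), and a bounded operator that is
bounded below up to a finite-rank operator on the orthogonal complement of its kernel is bounded
below there (`exists_bound_on_orthogonal_ker`).
-/

namespace HodgeDD

noncomputable section

/-! ### Exterior and interior multiplication in coordinates -/

section Algebra

variable {n : ℕ} {k : ℤ}

/-- Interior multiplication `β ↦ eᵢ ⌟ β` by a basis vector, on alternating forms. -/
def interiorMul (i : Fin n) : Alt n (k + 1) →L[ℝ] Alt n k :=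
  LinearMap.toContinuousLinearMap
    { toFun := fun β => WithLp.toLp 2 fun I =>
        if h : i ∉ I.1 then wedgeSign i I.1 * β (I.insert i h) else 0
      map_add' := by
        intro a b; ext I
        by_cases h : i ∈ I.1 <;> simp [h, mul_add]
      map_smul' := by
        intro c a; ext I
        by_cases h : i ∈ I.1 <;> simp [h]; ring }

/-- Exterior multiplication `α ↦ dxⁱ ∧ α` by a basis covector, on alternating forms. -/
def exteriorMul (i : Fin n) : Alt n k →L[ℝ] Alt n (k + 1) :=
  LinearMap.toContinuousLinearMap
    { toFun := fun α => WithLp.toLp 2 fun J =>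
        if h : i ∈ J.1 then wedgeSign i J.1 * α (J.erase i h) else 0
      map_add' := by
        intro a b; ext I
        by_cases h : i ∈ I.1 <;> simp [h, mul_add]
      map_smul' := by
        intro c a; ext I
        by_cases h : i ∈ I.1 <;> simp [h]; ring }

theorem interiorMul_apply (i : Fin n) (β : Alt n (k + 1)) (I : MultiIndex n k) :
    interiorMul i β I = if h : i ∉ I.1 then wedgeSign i I.1 * β (I.insert i h) else 0 := rfl

theorem exteriorMul_apply (i : Fin n) (α : Alt n k) (J : MultiIndex n (k + 1)) :
    exteriorMul i α J = if h : i ∈ J.1 then wedgeSign i J.1 * α (J.erase i h) else 0 := rfl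

theorem wedgeSign_mul_self (i : Fin n) (I : Finset (Fin n)) :
    wedgeSign i I * wedgeSign i I = 1 := by
  rw [wedgeSign, ← mul_pow]; simp

theorem wedgeSign_erase_self (i : Fin n) (I : Finset (Fin n)) :
    wedgeSign i (I.erase i) = wedgeSign i I := by
  unfold wedgeSign
  congr 2
  ext l
  simp only [Finset.mem_filter, Finset.mem_erase]
  constructor
  · rintro ⟨⟨_, h⟩, h'⟩; exact ⟨h, h'⟩
  · rintro ⟨h, h'⟩; exact ⟨⟨h'.ne, h⟩, h'⟩

theorem wedgeSign_insert_self (i : Fin n) (I : Finset (Fin n)) :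
    wedgeSign i (insert i I) = wedgeSign i I := by
  rw [wedgeSign, wedgeSign, Finset.filter_insert, if_neg (lt_irrefl i)]

theorem wedgeSign_insert {i l : Fin n} {I : Finset (Fin n)} (hl : l ∉ I) :
    wedgeSign i (insert l I) = (if l < i then -1 else 1) * wedgeSign i I := by
  unfold wedgeSign
  rw [Finset.filter_insert]
  split_ifs with h
  · rw [Finset.card_insert_of_notMem (by simp [hl]), pow_succ]; ring
  · rw [one_mul]

theorem wedgeSign_erase {i l : Fin n} {I : Finset (Fin n)} (hl : l ∈ I) :
    wedgeSign i (I.erase l) = (if l < i then -1 else 1) * wedgeSign i I := by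
  have h := wedgeSign_insert (i := i) (Finset.notMem_erase l I)
  rw [Finset.insert_erase hl] at h
  rw [h]; split_ifs <;> ring

/-- The anticommutation relation `eᵢ ⌟ (dxⁱ ∧ α) + dxⁱ ∧ (eᵢ ⌟ α) = α`. -/
theorem interiorMul_exteriorMul_self (i : Fin n) (α : Alt n (k + 1)) :
    interiorMul i (exteriorMul i α) + exteriorMul i (interiorMul i α) = α := by
  ext I
  rw [PiLp.add_apply, interiorMul_apply, exteriorMul_apply]
  by_cases h : i ∈ I.1
  · have h2 : i ∉ (I.erase i h).1 := Finset.notMem_erase i I.1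
    have h3 : (I.erase i h).insert i h2 = I := Subtype.ext (Finset.insert_erase h)
    rw [dif_neg (by simpa using h), dif_pos h, interiorMul_apply, dif_pos h2, h3, zero_add,
      ← mul_assoc]
    change wedgeSign i I.1 * wedgeSign i (I.1.erase i) * _ = _
    rw [wedgeSign_erase_self, wedgeSign_mul_self, one_mul]
  · have h2 : i ∈ (I.insert i h).1 := Finset.mem_insert_self i I.1
    have h3 : (I.insert i h).erase i h2 = I := Subtype.ext (Finset.erase_insert h)
    rw [dif_pos h, dif_neg h, exteriorMul_apply, dif_pos h2, h3, add_zero, ← mul_assoc]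
    change wedgeSign i I.1 * wedgeSign i (Insert.insert i I.1) * _ = _
    rw [wedgeSign_insert_self, wedgeSign_mul_self, one_mul]

/-- The anticommutation relation of `eᵢ ⌟ ·` and `dxˡ ∧ ·` for `i ≠ l`. -/
theorem interiorMul_exteriorMul_of_ne {i l : Fin n} (hil : i ≠ l) (α : Alt n (k + 1)) :
    interiorMul i (exteriorMul l α) = -exteriorMul l (interiorMul i α) := by
  ext I
  rw [PiLp.neg_apply, interiorMul_apply, exteriorMul_apply]
  by_cases hi : i ∈ I.1
  · rw [dif_neg (by simpa using hi)]
    by_cases hl : l ∈ I.1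
    · have : ¬ i ∉ (I.erase l hl).1 := not_not.2 (Finset.mem_erase.2 ⟨hil, hi⟩)
      rw [dif_pos hl, interiorMul_apply, dif_neg this]; ring
    · rw [dif_neg hl]; ring
  · rw [dif_pos hi, exteriorMul_apply]
    by_cases hl : l ∈ I.1
    · have h1 : l ∈ (I.insert i hi).1 := Finset.mem_insert_of_mem hl
      have h2 : i ∉ (I.erase l hl).1 := fun h => hi (Finset.mem_of_mem_erase h)
      have h3 : (I.insert i hi).erase l h1 = (I.erase l hl).insert i h2 :=
        Subtype.ext (Finset.erase_insert_of_ne hil)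
      rw [dif_pos h1, dif_pos hl, interiorMul_apply, dif_pos h2, h3, ← mul_assoc, ← mul_assoc,
        ← neg_mul]
      congr 1
      change wedgeSign i I.1 * wedgeSign l (Insert.insert i I.1) =
        -(wedgeSign l I.1 * wedgeSign i (I.1.erase l))
      rw [wedgeSign_insert hi, wedgeSign_erase hl]
      rcases lt_or_gt_of_ne hil with h | h
      · simp [h, not_lt_of_gt h]; ring
      · simp [h, not_lt_of_gt h]; ring
    · have h1 : l ∉ (I.insert i hi).1 := fun h =>
        (Finset.mem_insert.1 h).elim (fun h => hil h.symm) hl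
      rw [dif_neg h1, dif_neg hl]; ring

/-- Interior multiplications anticommute; this is the algebraic reason for `δ ∘ δ = 0`. -/
theorem interiorMul_comm (i l : Fin n) (α : Alt n (k + 1 + 1)) :
    interiorMul i (interiorMul l α) = -interiorMul l (interiorMul i α) := by
  ext I
  rw [PiLp.neg_apply, interiorMul_apply, interiorMul_apply]
  by_cases hi : i ∈ I.1
  · rw [dif_neg (by simpa using hi)]
    by_cases hl : l ∈ I.1
    · rw [dif_neg (by simpa using hl)]; ring
    · have : ¬ i ∉ (I.insert l hl).1 := not_not.2 (Finset.mem_insert_of_mem hi)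
      rw [dif_pos hl, interiorMul_apply, dif_neg this]; ring
  · rw [dif_pos hi, interiorMul_apply]
    by_cases hl : l ∈ I.1
    · have : ¬ l ∉ (I.insert i hi).1 := not_not.2 (Finset.mem_insert_of_mem hl)
      rw [dif_neg this, dif_neg (by simpa using hl)]; ring
    · rw [dif_pos hl, interiorMul_apply]
      by_cases hil : i = l
      · subst hil
        have : ¬ i ∉ (I.insert i hi).1 := not_not.2 (Finset.mem_insert_self i I.1)
        rw [dif_neg this]; ring
      · have h1 : l ∉ (I.insert i hi).1 := fun h =>
          (Finset.mem_insert.1 h).elim (fun h => hil h.symm) hl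
        have h2 : i ∉ (I.insert l hl).1 := fun h =>
          (Finset.mem_insert.1 h).elim (fun h => hil h) hi
        have h3 : (I.insert i hi).insert l h1 = (I.insert l hl).insert i h2 :=
          Subtype.ext (Finset.insert_comm l i I.1)
        rw [dif_pos h1, dif_pos h2, h3, ← mul_assoc, ← mul_assoc, ← neg_mul]
        congr 1
        change wedgeSign i I.1 * wedgeSign l (Insert.insert i I.1) =
          -(wedgeSign l I.1 * wedgeSign i (Insert.insert l I.1))
        rw [wedgeSign_insert hi, wedgeSign_insert hl]
        rcases lt_or_gt_of_ne hil with h | h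
        · simp [h, not_lt_of_gt h]; ring
        · simp [h, not_lt_of_gt h]; ring

/-! ### The codifferential of smooth forms -/

local notation "E" => EuclideanSpace ℝ (Fin n)

theorem coD_eq_sum (β : E → Alt n (k + 1)) (x : E) :
    coD β x = -∑ i, interiorMul i (partialDeriv i β x) := by
  ext I
  have h : ∀ I : MultiIndex n k, ((-∑ i, interiorMul i (partialDeriv i β x) : Alt n k)) I
      = -∑ i, interiorMul i (partialDeriv i β x) I := by
    intro I
    simp
  rw [h]
  change -∑ i : {i // i ∉ I.1}, wedgeSign i.1 I.1 * partialDeriv i.1 β x (I.insert i.1 i.2) = _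
  congr 1
  have h2 : ∀ i, interiorMul i (partialDeriv i β x) I = if i ∈ Finset.univ.filter (· ∉ I.1) then
      interiorMul i (partialDeriv i β x) I else 0 := by
    intro i
    by_cases hi : i ∈ I.1
    · simp [hi, interiorMul_apply]
    · simp [hi]
  rw [Finset.sum_congr rfl fun i _ => h2 i, Finset.sum_ite_mem, Finset.univ_inter,
    Finset.sum_subtype (Finset.univ.filter (· ∉ I.1)) (p := (· ∉ I.1)) (by simp)]
  refine Finset.sum_congr rfl fun i _ => ?_
  rw [interiorMul_apply, dif_pos i.2]

/-- The exterior product `a ∧ α` with a (co)vector `a`. -/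
def wedge (a : E) : Alt n k →L[ℝ] Alt n (k + 1) := ∑ l, a l • exteriorMul l

theorem wedge_apply (a : E) (α : Alt n k) : wedge a α = ∑ l, a l • exteriorMul l α := by
  simp [wedge]

/-- `i_i (a ∧ α) + a ∧ (i_i α) = a_i α`. -/
theorem interiorMul_wedge (i : Fin n) (a : E) (α : Alt n (k + 1)) :
    interiorMul i (wedge a α) = a i • α - wedge a (interiorMul i α) := by
  rw [wedge_apply, wedge_apply, map_sum, eq_sub_iff_add_eq, ← Finset.sum_add_distrib,
    Finset.sum_eq_single i]
  · rw [map_smul, ← smul_add, interiorMul_exteriorMul_self]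
  · intro l _ hl
    rw [map_smul, ← smul_add, interiorMul_exteriorMul_of_ne (Ne.symm hl), neg_add_cancel, smul_zero]
  · simp

theorem smooth_partialDeriv {α : E → Alt n k} (h : ContDiff ℝ ∞ α) (i : Fin n) :
    ContDiff ℝ ∞ (partialDeriv i α) :=
  (h.fderiv_right (m := ∞) (by norm_cast)).clm_apply contDiff_const

theorem smooth_coD {β : E → Alt n (k + 1)} (h : ContDiff ℝ ∞ β) : ContDiff ℝ ∞ (coD β) := by
  have : coD β = fun x => -∑ i, interiorMul i (partialDeriv i β x) := funext (coD_eq_sum β)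
  rw [this]
  exact (ContDiff.sum fun i _ => (interiorMul i).contDiff.comp (smooth_partialDeriv h i)).neg

theorem partialDeriv_clm {k' : ℤ} (A : Alt n k →L[ℝ] Alt n k') {α : E → Alt n k}
    {x : E} (h : DifferentiableAt ℝ α x) (i : Fin n) :
    partialDeriv i (fun y => A (α y)) x = A (partialDeriv i α x) := by
  have h2 : HasFDerivAt (fun y => A (α y)) (A.comp (fderiv ℝ α x)) x :=
    A.hasFDerivAt.comp x h.hasFDerivAt
  rw [partialDeriv, h2.fderiv]
  rfl

theorem partialDeriv_comm {α : E → Alt n k} (h : ContDiff ℝ ∞ α) (i l : Fin n) (x : E) :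
    partialDeriv i (partialDeriv l α) x = partialDeriv l (partialDeriv i α) x := by
  have hd : Differentiable ℝ (fderiv ℝ α) :=
    (h.fderiv_right (m := ∞) (by norm_cast)).differentiable (by simp)
  have key : ∀ i l : Fin n, partialDeriv i (partialDeriv l α) x =
      fderiv ℝ (fderiv ℝ α) x (EuclideanSpace.single i 1) (EuclideanSpace.single l 1) := by
    intro i l
    unfold partialDeriv
    rw [((hd x).hasFDerivAt.clm_apply (hasFDerivAt_const _ x)).fderiv]
    simp
  rw [key, key]
  exact (h.contDiffAt.isSymmSndFDerivAt (by simp; norm_cast)).eq _ _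

/-- `δ ∘ δ = 0` on smooth forms. -/
theorem coD_coD {β : E → Alt n (k + 1 + 1)} (h : ContDiff ℝ ∞ β) (x : E) :
    coD (coD β) x = 0 := by
  have h0 : coD β = fun x => -∑ l, interiorMul l (partialDeriv l β x) := funext (coD_eq_sum β)
  have hp : ∀ i, partialDeriv i (coD β) x =
      -∑ l, interiorMul l (partialDeriv i (partialDeriv l β) x) := by
    intro i
    have hl : ∀ l, HasFDerivAt (fun x => interiorMul l (partialDeriv l β x))
        ((interiorMul l).comp (fderiv ℝ (partialDeriv l β) x)) x := fun l =>
      (interiorMul l).hasFDerivAt.comp x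
        ((smooth_partialDeriv h l).differentiable (by simp) x).hasFDerivAt
    have := (HasFDerivAt.fun_sum fun l (_ : l ∈ Finset.univ) => hl l).neg
    rw [partialDeriv, h0]
    have h2 := this.fderiv
    change fderiv ℝ (fun x => -∑ l, interiorMul l (partialDeriv l β x)) x = _ at h2
    rw [h2]
    simp [partialDeriv]
  rw [coD_eq_sum]
  simp only [hp, map_neg, map_sum, Finset.sum_neg_distrib, neg_neg]
  have hanti : ∑ i, ∑ l, interiorMul i (interiorMul l (partialDeriv i (partialDeriv l β) x)) =
      -∑ i, ∑ l, interiorMul i (interiorMul l (partialDeriv i (partialDeriv l β) x)) := by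
    conv_lhs => rw [Finset.sum_comm]
    rw [← Finset.sum_neg_distrib]
    refine Finset.sum_congr rfl fun i _ => ?_
    rw [← Finset.sum_neg_distrib]
    refine Finset.sum_congr rfl fun l _ => ?_
    rw [interiorMul_comm, partialDeriv_comm h]
  -- the double sum of an antisymmetric and a symmetric expression vanishes
  rwa [eq_neg_iff_add_eq_zero, ← two_smul ℝ, smul_eq_zero_iff_right two_ne_zero] at hanti

/-- The formula dual to Cartan's: `δ(a ∧ ζ) + a ∧ δζ = -∂_a ζ` for a constant vector `a`. -/
theorem coD_wedge {ζ : E → Alt n (k + 1)} {x : E} (h : DifferentiableAt ℝ ζ x) (a : E) :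
    coD (fun y => wedge a (ζ y)) x = -fderiv ℝ ζ x a - wedge a (coD ζ x) := by
  rw [coD_eq_sum, coD_eq_sum]
  simp only [partialDeriv_clm (wedge a) h, interiorMul_wedge, Finset.sum_sub_distrib, map_neg,
    map_sum]
  have : fderiv ℝ ζ x a = ∑ i, a i • partialDeriv i ζ x := by
    conv_lhs => rw [← (EuclideanSpace.basisFun (Fin n) ℝ).sum_repr a]
    simp [partialDeriv]
  rw [this]
  abel

/-- The Leibniz rule `δ(χ ξ) = χ δξ - ∇χ ⌟ ξ`. -/
theorem coD_smul {χ : E → ℝ} {ξ : E → Alt n (k + 1)} {x : E} (hχ : DifferentiableAt ℝ χ x)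
    (h : DifferentiableAt ℝ ξ x) :
    coD (fun y => χ y • ξ y) x = χ x • coD ξ x -
      ∑ i, fderiv ℝ χ x (EuclideanSpace.single i 1) • interiorMul i (ξ x) := by
  rw [coD_eq_sum, coD_eq_sum]
  have : ∀ i, partialDeriv i (fun y => χ y • ξ y) x = χ x • partialDeriv i ξ x +
      fderiv ℝ χ x (EuclideanSpace.single i 1) • ξ x := by
    intro i
    rw [partialDeriv, (hχ.hasFDerivAt.fun_smul h.hasFDerivAt).fderiv]
    simp [partialDeriv]
  simp only [this, map_add, map_smul, Finset.sum_add_distrib, neg_add, smul_neg, Finset.smul_sum]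
  abel

theorem extD_eq_sum (α : E → Alt n k) (x : E) :
    extD α x = ∑ i, exteriorMul i (partialDeriv i α x) := by
  ext J
  have h : (∑ i, exteriorMul i (partialDeriv i α x) : Alt n (k + 1)) J
      = ∑ i, exteriorMul i (partialDeriv i α x) J := by
    simp
  rw [h]
  change ∑ i : {i // i ∈ J.1}, wedgeSign i.1 J.1 * partialDeriv i.1 α x (J.erase i.1 i.2) = _
  have h2 : ∀ i, exteriorMul i (partialDeriv i α x) J = if i ∈ J.1 then
      exteriorMul i (partialDeriv i α x) J else 0 := by
    intro i
    by_cases hi : i ∈ J.1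
    · simp [hi]
    · simp [hi, exteriorMul_apply]
  rw [Finset.sum_congr rfl fun i _ => h2 i, Finset.sum_ite_mem, Finset.univ_inter,
    Finset.sum_subtype J.1 (p := (· ∈ J.1)) (by simp)]
  refine Finset.sum_congr rfl fun i _ => ?_
  rw [exteriorMul_apply, dif_pos i.2]

/-- Interior and exterior multiplication are adjoint to each other. -/
theorem inner_exteriorMul (i : Fin n) (α : Alt n k) (β : Alt n (k + 1)) :
    ⟪exteriorMul i α, β⟫_ℝ = ⟪α, interiorMul i β⟫_ℝ := by
  simp only [PiLp.inner_apply, RCLike.inner_apply, conj_trivial]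
  have h1 : ∀ J : MultiIndex n (k + 1), J ∈ Finset.univ → J ∉ Finset.univ.filter (i ∈ ·.1) →
      β J * exteriorMul i α J = 0 := by
    intro J _ hJ
    rw [exteriorMul_apply, dif_neg (by simpa using hJ), mul_zero]
  have h2 : ∀ I : MultiIndex n k, I ∈ Finset.univ → I ∉ Finset.univ.filter (i ∉ ·.1) →
      interiorMul i β I * α I = 0 := by
    intro I _ hI
    rw [interiorMul_apply, dif_neg (by simpa using hI), zero_mul]
  rw [← Finset.sum_subset (Finset.filter_subset _ _) h1,
    ← Finset.sum_subset (Finset.filter_subset _ _) h2]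
  refine Finset.sum_bij' (fun J hJ => J.erase i (Finset.mem_filter.1 hJ).2)
    (fun I hI => I.insert i (Finset.mem_filter.1 hI).2) ?_ ?_ ?_ ?_ ?_
  · intro J _
    exact Finset.mem_filter.2 ⟨Finset.mem_univ _, Finset.notMem_erase i J.1⟩
  · intro I _
    exact Finset.mem_filter.2 ⟨Finset.mem_univ _, Finset.mem_insert_self i I.1⟩
  · intro J hJ
    exact Subtype.ext (Finset.insert_erase (Finset.mem_filter.1 hJ).2)
  · intro I hI
    exact Subtype.ext (Finset.erase_insert (Finset.mem_filter.1 hI).2)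
  · intro J hJ
    have hJ' := (Finset.mem_filter.1 hJ).2
    have h3 : i ∉ (J.erase i hJ').1 := Finset.notMem_erase i J.1
    have h4 : (J.erase i hJ').insert i h3 = J := Subtype.ext (Finset.insert_erase hJ')
    rw [exteriorMul_apply, dif_pos hJ', interiorMul_apply, dif_pos h3, h4]
    change _ = wedgeSign i (J.1.erase i) * _ * _
    rw [wedgeSign_erase_self]
    ring

end Algebra

/-! ### Test forms and weak derivatives -/

section TestFormCalculus

variable {n : ℕ} {k : ℤ} {Ω : Set (EuclideanSpace ℝ (Fin n))}

local notation "E" => EuclideanSpace ℝ (Fin n)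

theorem inner_toLp_right (w : L2Form Ω k) {f : E → Alt n k} (hf : MemLp f 2 (volume.restrict Ω)) :
    ⟪w, hf.toLp f⟫_ℝ = ∫ x in Ω, ⟪w x, f x⟫_ℝ := by
  rw [L2.inner_def]
  refine integral_congr_ae ?_
  filter_upwards [hf.coeFn_toLp] with x hx
  rw [hx]

theorem TestForm.continuous (η : TestForm Ω k) : Continuous η.toFun := η.smooth.continuous

theorem TestForm.eq_zero_of_notMem (η : TestForm Ω k) {x : E} (hx : x ∉ Ω) : η.toFun x = 0 :=
  image_eq_zero_of_notMem_tsupport fun h => hx (η.support_subset h)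

/-- A scalar test function times a constant form. -/
def TestForm.ofScalar {g : E → ℝ} (hg : ContDiff ℝ ∞ g) (hc : HasCompactSupport g)
    (hs : tsupport g ⊆ Ω) (c : Alt n k) : TestForm Ω k where
  toFun x := g x • c
  smooth := hg.smul contDiff_const
  compact := hc.smul_right
  support_subset := (tsupport_smul_subset_left g _).trans hs

/-- The fundamental lemma of the calculus of variations: test forms are dense. -/
theorem eq_zero_of_inner_testForm (hΩ : IsOpen Ω) {w : L2Form Ω k}
    (h : ∀ η : TestForm Ω k, ⟪w, η.toL2⟫_ℝ = 0) : w = 0 := by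
  have hloc : LocallyIntegrable w (volume.restrict Ω) :=
    (Lp.memLp w).locallyIntegrable (by norm_num)
  have h0 : ∀ᵐ x ∂(volume.restrict Ω), x ∈ Ω → w x = 0 := by
    refine hΩ.ae_eq_zero_of_integral_contDiff_smul_eq_zero (hloc.locallyIntegrableOn Ω) ?_
    intro g hg hc hs
    refine ext_inner_left ℝ fun c => ?_
    rw [inner_zero_right, ← integral_inner]
    · rw [← h (TestForm.ofScalar hg hc hs c), TestForm.toL2, inner_toLp_right]
      refine integral_congr_ae (Eventually.of_forall fun x => ?_)
      simp only [TestForm.ofScalar, real_inner_smul_right]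
      rw [real_inner_comm]
    · exact hloc.integrable_smul_left_of_hasCompactSupport hg.continuous hc
  rw [Lp.eq_zero_iff_ae_eq_zero]
  filter_upwards [h0, ae_restrict_mem hΩ.measurableSet] with x hx hx'
  exact hx hx'

/-- The codifferential of a test form is a test form. -/
def TestForm.coD (η : TestForm Ω (k + 1)) : TestForm Ω k where
  toFun := HodgeDD.coD η.toFun
  smooth := smooth_coD η.smooth
  compact := HasCompactSupport.intro η.compact fun _ hx => coD_eq_zero hx
  support_subset := by
    refine (closure_minimal ?_ (isClosed_tsupport η.toFun)).trans η.support_subset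
    intro x hx
    by_contra hx'
    exact hx (coD_eq_zero hx')

theorem TestForm.toL2_coD (η : TestForm Ω (k + 1)) : η.coD.toL2 = η.delta := rfl

theorem TestForm.delta_coD (η : TestForm Ω (k + 1 + 1)) : η.coD.delta = 0 := by
  have h : HodgeDD.coD η.coD.toFun = fun _ => 0 := funext fun x => coD_coD η.smooth x
  rw [TestForm.delta, ← MemLp.toLp_zero (MemLp.zero' (ε := Alt n k))]
  exact MemLp.toLp_congr _ _ (Eventually.of_forall fun x => congrFun h x)

/-- `d ∘ d = 0`. -/
theorem isWeakD_d_zero (v : HForm Ω k) : IsWeakD v.d 0 := by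
  intro η
  rw [inner_zero_left, ← η.toL2_coD]
  refine ((v.2 η.coD).trans ?_).symm
  rw [η.delta_coD, inner_zero_right]

/-- The form `dv`, as an element of `HΛ^{k+1}(Ω)` with vanishing exterior derivative. -/
def HForm.exact (v : HForm Ω k) : HForm Ω (k + 1) :=
  ⟨WithLp.toLp 2 (v.d, 0), isWeakD_d_zero v⟩

theorem HForm.exact_form (v : HForm Ω k) : v.exact.form = v.d := rfl

theorem HForm.exact_d (v : HForm Ω k) : v.exact.d = 0 := rfl

/-- Integration by parts for smooth forms, one of which has compact support. -/
theorem integral_inner_extD {ζ : E → Alt n k} {η : E → Alt n (k + 1)} (hζ : ContDiff ℝ ∞ ζ)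
    (hη : ContDiff ℝ ∞ η) (hc : HasCompactSupport ζ) :
    ∫ x, ⟪extD ζ x, η x⟫_ℝ = ∫ x, ⟪ζ x, coD η x⟫_ℝ := by
  have hcp : ∀ i, HasCompactSupport (partialDeriv i ζ) := fun i =>
    HasCompactSupport.intro hc fun _ hx => partialDeriv_eq_zero i hx
  have hint1 : ∀ i, Integrable fun x => ⟪exteriorMul i (partialDeriv i ζ x), η x⟫_ℝ := by
    intro i
    refine Continuous.integrable_of_hasCompactSupport ?_ ?_
    · exact ((exteriorMul i).continuous.comp (continuous_partialDeriv hζ i)).inner hη.continuous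
    · refine (hcp i).mono fun x hx hx' => hx ?_
      simp only
      rw [hx', map_zero, inner_zero_left]
  have hint2 : ∀ i, Integrable fun x => ⟪ζ x, interiorMul i (partialDeriv i η x)⟫_ℝ := by
    intro i
    refine Continuous.integrable_of_hasCompactSupport ?_ ?_
    · exact hζ.continuous.inner ((interiorMul i).continuous.comp (continuous_partialDeriv hη i))
    · refine hc.mono fun x hx hx' => hx ?_
      simp only
      rw [hx', inner_zero_left]
  have hint3 : ∀ i, Integrable fun x => ⟪ζ x, interiorMul i (η x)⟫_ℝ := by
    intro i
    refine Continuous.integrable_of_hasCompactSupport ?_ ?_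
    · exact hζ.continuous.inner ((interiorMul i).continuous.comp hη.continuous)
    · refine hc.mono fun x hx hx' => hx ?_
      simp only
      rw [hx', inner_zero_left]
  simp only [extD_eq_sum, coD_eq_sum, sum_inner, inner_neg_right, inner_sum]
  rw [integral_neg, integral_finsetSum _ fun i _ => hint1 i, integral_finsetSum _ fun i _ => hint2 i,
    ← Finset.sum_neg_distrib]
  refine Finset.sum_congr rfl fun i _ => ?_
  have key := integral_bilinear_fderiv_right_eq_neg_left_of_integrable (μ := (volume : Measure E))
    (f := ζ) (g := fun x => interiorMul i (η x)) (v := EuclideanSpace.single i 1)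
    (B := innerSL ℝ) ?_ ?_ (hint3 i) (fun x _ => hζ.differentiable (by simp) x)
    (fun x _ => ((interiorMul i).contDiff.comp hη).differentiable (by simp) x)
  · have h1 : ∀ x, fderiv ℝ (fun x => interiorMul i (η x)) x (EuclideanSpace.single i 1) =
        interiorMul i (partialDeriv i η x) := fun x =>
      partialDeriv_clm (interiorMul i) (hη.differentiable (by simp) x) i
    simp only [h1] at key
    have key' : ∫ x, ⟪ζ x, interiorMul i (partialDeriv i η x)⟫_ℝ =
      -∫ x, ⟪partialDeriv i ζ x, interiorMul i (η x)⟫_ℝ := key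
    rw [key', neg_neg]
    simp only [inner_exteriorMul]
  · have := hint1 i
    simp only [inner_exteriorMul] at this
    exact this
  · have h1 : ∀ x, fderiv ℝ (fun x => interiorMul i (η x)) x (EuclideanSpace.single i 1) =
        interiorMul i (partialDeriv i η x) := fun x =>
      partialDeriv_clm (interiorMul i) (hη.differentiable (by simp) x) i
    simp only [h1]
    exact hint2 i

/-- Integration by parts for two test forms. -/
theorem TestForm.inner_d (ζ : TestForm Ω k) (η : TestForm Ω (k + 1)) :
    ⟪ζ.d, η.toL2⟫_ℝ = ⟪ζ.toL2, η.delta⟫_ℝ := by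
  have h1 : ⟪ζ.d, η.toL2⟫_ℝ = ∫ x in Ω, ⟪extD ζ.toFun x, η.toFun x⟫_ℝ := by
    rw [TestForm.toL2, inner_toLp_right]
    refine integral_congr_ae ?_
    filter_upwards [ζ.memLp_extD.coeFn_toLp] with x hx
    rw [TestForm.d, hx]
  have h2 : ⟪ζ.toL2, η.delta⟫_ℝ = ∫ x in Ω, ⟪ζ.toFun x, HodgeDD.coD η.toFun x⟫_ℝ := by
    rw [TestForm.delta, inner_toLp_right]
    refine integral_congr_ae ?_
    filter_upwards [ζ.memLp.coeFn_toLp] with x hx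
    rw [TestForm.toL2, hx]
  rw [h1, h2, setIntegral_eq_integral_of_forall_compl_eq_zero,
    setIntegral_eq_integral_of_forall_compl_eq_zero]
  · exact integral_inner_extD ζ.smooth η.smooth ζ.compact
  · intro x hx
    rw [ζ.eq_zero_of_notMem hx, inner_zero_left]
  · intro x hx
    rw [η.eq_zero_of_notMem hx, inner_zero_right]

/-- A test form, as an element of `H*Λ^{k+1}(Ω)`. -/
def TestForm.toHStar (η : TestForm Ω (k + 1)) : HStarForm Ω k :=
  ⟨WithLp.toLp 2 (η.toL2, η.delta), fun τ => by
    change ⟪η.delta, τ.toL2⟫_ℝ = ⟪η.toL2, τ.d⟫_ℝ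
    rw [real_inner_comm, ← τ.inner_d, real_inner_comm]⟩

/-- A test form, as an element of `HΛ^k(Ω)`. -/
def TestForm.toH (ζ : TestForm Ω k) : HForm Ω k :=
  ⟨WithLp.toLp 2 (ζ.toL2, ζ.d), ζ.inner_d⟩

theorem TestForm.toH_mem (ζ : TestForm Ω k) : ζ.toH ∈ HForm₀ Ω k :=
  (testGraphD Ω k).le_topologicalClosure (Submodule.subset_span ⟨ζ, rfl⟩)

end TestFormCalculus

/-! ### Nondegeneracy of the trace pairing -/

section Pairing

variable {n : ℕ} {k : ℤ} {Ω : Set (EuclideanSpace ℝ (Fin n))}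

theorem HForm.ext_of_form (hΩ : IsOpen Ω) {v w : HForm Ω k} (h : v.form = w.form) : v = w := by
  have hd : v.d = w.d := by
    rw [← sub_eq_zero]
    refine eq_zero_of_inner_testForm hΩ fun η => ?_
    have h1 := v.2 η
    have h2 := w.2 η
    change ⟪v.d, η.toL2⟫_ℝ = ⟪v.form, η.delta⟫_ℝ at h1
    change ⟪w.d, η.toL2⟫_ℝ = ⟪w.form, η.delta⟫_ℝ at h2
    rw [inner_sub_left, h1, h2, h, sub_self]
  exact Subtype.ext (WithLp.ofLp_injective 2 (Prod.ext h hd))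

theorem HStarForm.ext_of_form (hΩ : IsOpen Ω) {v w : HStarForm Ω k} (h : v.form = w.form) :
    v = w := by
  have hd : v.delta = w.delta := by
    rw [← sub_eq_zero]
    refine eq_zero_of_inner_testForm hΩ fun η => ?_
    have h1 := v.2 η
    have h2 := w.2 η
    change ⟪v.delta, η.toL2⟫_ℝ = ⟪v.form, η.d⟫_ℝ at h1
    change ⟪w.delta, η.toL2⟫_ℝ = ⟪w.form, η.d⟫_ℝ at h2
    rw [inner_sub_left, h1, h2, h, sub_self]
  exact Subtype.ext (WithLp.ofLp_injective 2 (Prod.ext h hd))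

/-- The closure of the graph of `d` on test forms is the adjoint of the weak codifferential. -/
theorem mem_HForm₀_of_ibpForm {τ : HForm Ω k} (h : ∀ v, ibpForm Ω k τ v = 0) :
    τ ∈ HForm₀ Ω k := by
  change τ.1 ∈ (testGraphD Ω k).topologicalClosure
  rw [← Submodule.orthogonal_orthogonal_eq_closure, Submodule.mem_orthogonal]
  intro y hy
  rw [Submodule.mem_orthogonal] at hy
  have hv : IsWeakDelta y.snd (-y.fst) := by
    intro η
    have := hy _ (Submodule.subset_span ⟨η, rfl⟩)
    rw [WithLp.prod_inner_apply] at this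
    change ⟪η.toL2, y.fst⟫_ℝ + ⟪η.d, y.snd⟫_ℝ = 0 at this
    rw [inner_neg_left, real_inner_comm, real_inner_comm η.d]
    linarith
  have := h ⟨WithLp.toLp 2 (y.snd, -y.fst), hv⟩
  change ⟪τ.d, y.snd⟫_ℝ - ⟪τ.form, -y.fst⟫_ℝ = 0 at this
  rw [WithLp.prod_inner_apply]
  change ⟪y.fst, τ.form⟫_ℝ + ⟪y.snd, τ.d⟫_ℝ = 0
  rw [inner_neg_right] at this
  rw [real_inner_comm, real_inner_comm τ.d]
  linarith

/-- The closure of the graph of `δ` on test forms is the adjoint of the weak exterior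
derivative. -/
theorem mem_HStarForm₀_of_ibpForm {v : HStarForm Ω k} (h : ∀ τ, ibpForm Ω k τ v = 0) :
    v ∈ HStarForm₀ Ω k := by
  change v.1 ∈ (testGraphDelta Ω k).topologicalClosure
  rw [← Submodule.orthogonal_orthogonal_eq_closure, Submodule.mem_orthogonal]
  intro y hy
  rw [Submodule.mem_orthogonal] at hy
  have hτ : IsWeakD y.snd (-y.fst) := by
    intro η
    have := hy _ (Submodule.subset_span ⟨η, rfl⟩)
    rw [WithLp.prod_inner_apply] at this
    change ⟪η.toL2, y.fst⟫_ℝ + ⟪η.delta, y.snd⟫_ℝ = 0 at this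
    rw [inner_neg_left, real_inner_comm, real_inner_comm η.delta]
    linarith
  have := h ⟨WithLp.toLp 2 (y.snd, -y.fst), hτ⟩
  change ⟪-y.fst, v.form⟫_ℝ - ⟪y.snd, v.delta⟫_ℝ = 0 at this
  rw [WithLp.prod_inner_apply]
  change ⟪y.fst, v.form⟫_ℝ + ⟪y.snd, v.delta⟫_ℝ = 0
  rw [inner_neg_left] at this
  linarith

theorem tracePairing_left_nondegenerate {t : TanTrace Ω k}
    (h : ∀ s, tracePairing Ω k t s = 0) : t = 0 := by
  obtain ⟨τ, rfl⟩ := (HForm₀ Ω k).mkQ_surjective t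
  exact (Submodule.Quotient.mk_eq_zero _).2 (mem_HForm₀_of_ibpForm fun v => h v.nor)

theorem tracePairing_right_nondegenerate {s : NorTrace Ω k}
    (h : ∀ t, tracePairing Ω k t s = 0) : s = 0 := by
  obtain ⟨v, rfl⟩ := (HStarForm₀ Ω k).mkQ_surjective s
  exact (Submodule.Quotient.mk_eq_zero _).2 (mem_HStarForm₀_of_ibpForm fun τ => h τ.tan)

theorem tan_eq_zero_iff {τ : HForm Ω k} : τ.tan = 0 ↔ τ ∈ HForm₀ Ω k :=
  Submodule.Quotient.mk_eq_zero _

end Pairing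

/-! ### Restriction and extension by zero -/

section Extension

variable {n : ℕ} {k : ℤ} {Ω K : Set (EuclideanSpace ℝ (Fin n))}

/-- The restriction `L²Λ^k(Ω) → L²Λ^k(K)` as a bounded operator. -/
def restrictCLM (h : K ⊆ Ω) : L2Form Ω k →L[ℝ] L2Form K k :=
  LinearMap.mkContinuous
    { toFun := restrictL2 h
      map_add' := restrictL2_add h
      map_smul' := restrictL2_smul h } 1 (by
    intro v
    rw [one_mul]
    change ‖restrictL2 h v‖ ≤ ‖v‖
    rw [restrictL2, Lp.norm_toLp, Lp.norm_def]
    exact ENNReal.toReal_mono (Lp.eLpNorm_ne_top v)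
      (eLpNorm_mono_measure _ (Measure.restrict_mono h le_rfl)))

theorem norm_restrictL2_le (h : K ⊆ Ω) (v : L2Form Ω k) : ‖restrictL2 h v‖ ≤ ‖v‖ := by
  have := (restrictCLM h).le_of_opNorm_le (LinearMap.mkContinuous_norm_le _ zero_le_one _) v
  rwa [one_mul] at this

theorem restrictL2_sub (h : K ⊆ Ω) (v w : L2Form Ω k) :
    restrictL2 h (v - w) = restrictL2 h v - restrictL2 h w :=
  map_sub (restrictCLM h) v w

theorem restrictH_form (h : K ⊆ Ω) (v : HForm Ω k) :
    HForm.form (restrictH h v) = restrictL2 h v.form := rfl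

theorem restrictH_d (h : K ⊆ Ω) (v : HForm Ω k) :
    HForm.d (restrictH h v) = restrictL2 h v.d := rfl

/-- A test form on `K ⊆ Ω` as a test form on `Ω`. -/
def TestForm.extend (h : K ⊆ Ω) (η : TestForm K k) : TestForm Ω k :=
  ⟨η.toFun, η.smooth, η.compact, η.support_subset.trans h⟩

theorem inner_restrictL2_testForm (h : K ⊆ Ω) (v : L2Form Ω k) (η : TestForm K k) :
    ⟪restrictL2 h v, η.toL2⟫_ℝ = ⟪v, (η.extend h).toL2⟫_ℝ :=
  inner_restrictL2 h v (fun _ hx => η.eq_zero_of_notMem hx) _ (η.extend h).memLp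

theorem inner_restrictL2_d (h : K ⊆ Ω) (v : L2Form Ω (k + 1)) (η : TestForm K k) :
    ⟪restrictL2 h v, η.d⟫_ℝ = ⟪v, (η.extend h).d⟫_ℝ :=
  inner_restrictL2 h v (fun _ hx => extD_eq_zero fun hx' => hx (η.support_subset hx')) _
    (η.extend h).memLp_extD

theorem restrictL2_extend (h : K ⊆ Ω) (η : TestForm K k) :
    restrictL2 h (η.extend h).toL2 = η.toL2 :=
  MemLp.toLp_congr _ _ (ae_mono (Measure.restrict_mono h le_rfl) (η.extend h).memLp.coeFn_toLp)

theorem restrictL2_extend_of_disjoint {K' : Set (EuclideanSpace ℝ (Fin n))} (h : K ⊆ Ω)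
    (h' : K' ⊆ Ω) (hK' : MeasurableSet K') (hd : Disjoint K K') (η : TestForm K k) :
    restrictL2 h' (η.extend h).toL2 = 0 := by
  rw [restrictL2, ← MemLp.toLp_zero (MemLp.zero' (ε := Alt n k))]
  refine MemLp.toLp_congr _ _ ?_
  filter_upwards [ae_mono (Measure.restrict_mono h' le_rfl) (η.extend h).memLp.coeFn_toLp,
    ae_restrict_mem hK'] with x hx hx'
  rw [TestForm.toL2, hx]
  exact η.eq_zero_of_notMem fun hxK => hd.le_bot ⟨hxK, hx'⟩

theorem IsWeakDelta.restrict (h : K ⊆ Ω) {v : L2Form Ω (k + 1)} {w : L2Form Ω k}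
    (hv : IsWeakDelta v w) : IsWeakDelta (restrictL2 h v) (restrictL2 h w) := by
  intro η
  rw [inner_restrictL2_testForm, inner_restrictL2_d]
  exact hv (η.extend h)

/-- Restriction `H*Λ^{k+1}(Ω) → H*Λ^{k+1}(K)`. -/
def restrictHStar (h : K ⊆ Ω) (v : HStarForm Ω k) : HStarForm K k :=
  ⟨WithLp.toLp 2 (restrictL2 h v.form, restrictL2 h v.delta), IsWeakDelta.restrict h v.2⟩

/-- Extension by zero `L²Λ^k(K) → L²Λ^k(Ω)`, the adjoint of the restriction. -/
def zeroExt (h : K ⊆ Ω) : L2Form K k →L[ℝ] L2Form Ω k :=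
  ContinuousLinearMap.adjoint (restrictCLM h)

theorem inner_zeroExt (h : K ⊆ Ω) (w : L2Form K k) (v : L2Form Ω k) :
    ⟪zeroExt h w, v⟫_ℝ = ⟪w, restrictL2 h v⟫_ℝ :=
  ContinuousLinearMap.adjoint_inner_left _ _ _

theorem restrictL2_zeroExt (h : K ⊆ Ω) (hK : IsOpen K) (w : L2Form K k) :
    restrictL2 h (zeroExt h w) = w := by
  rw [← sub_eq_zero]
  refine eq_zero_of_inner_testForm hK fun η => ?_
  rw [inner_sub_left, inner_restrictL2_testForm, inner_zeroExt, restrictL2_extend, sub_self]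

theorem restrictL2_zeroExt_of_disjoint {K' : Set (EuclideanSpace ℝ (Fin n))} (h : K ⊆ Ω)
    (h' : K' ⊆ Ω) (hK : MeasurableSet K) (hK' : IsOpen K') (hd : Disjoint K K')
    (w : L2Form K k) : restrictL2 h' (zeroExt h w) = 0 := by
  refine eq_zero_of_inner_testForm hK' fun η => ?_
  rw [inner_restrictL2_testForm, inner_zeroExt, restrictL2_extend_of_disjoint h' h hK hd.symm,
    inner_zero_right]

/-- Extension by zero maps `H̊Λ^k(K)` to `HΛ^k(Ω)`. -/
def zeroExtH (h : K ⊆ Ω) (z : HForm K k) (hz : z ∈ HForm₀ K k) : HForm Ω k :=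
  ⟨WithLp.toLp 2 (zeroExt h z.form, zeroExt h z.d), fun η => by
    change ⟪zeroExt h z.d, η.toL2⟫_ℝ = ⟪zeroExt h z.form, η.delta⟫_ℝ
    rw [inner_zeroExt, inner_zeroExt]
    exact sub_eq_zero.1 (ibpForm_eq_zero_left hz (restrictHStar h η.toHStar))⟩

theorem restrictH_zeroExtH (h : K ⊆ Ω) (hK : IsOpen K) (z : HForm K k) (hz : z ∈ HForm₀ K k) :
    restrictH h (zeroExtH h z hz) = z :=
  HForm.ext_of_form hK (restrictL2_zeroExt h hK z.form)

theorem restrictH_zeroExtH_of_disjoint {K' : Set (EuclideanSpace ℝ (Fin n))} (h : K ⊆ Ω)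
    (h' : K' ⊆ Ω) (hK : MeasurableSet K) (hK' : IsOpen K') (hd : Disjoint K K') (z : HForm K k)
    (hz : z ∈ HForm₀ K k) : restrictH h' (zeroExtH h z hz) = 0 :=
  HForm.ext_of_form hK' (restrictL2_zeroExt_of_disjoint h h' hK hK' hd z.form)

end Extension

/-! ### Lipschitz boundaries and decompositions -/

section Lipschitz

variable {n : ℕ} {Ω : Set (EuclideanSpace ℝ (Fin n))}

local notation "E" => EuclideanSpace ℝ (Fin n)

/-- The component orthogonal to `ν`, written as in the local graph representation. -/
theorem continuous_orthComponent (ν : E) : Continuous fun y : E => y - ⟪ν, y⟫_ℝ • ν := by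
  fun_prop

/-- The graph of a Lipschitz function is a null set, since its translates in the vertical direction
are disjoint. -/
theorem IsBoundedLipschitzDomain.volume_frontier (hΩ : IsBoundedLipschitzDomain Ω) :
    volume (frontier Ω) = 0 := by
  refine measure_null_of_locally_null _ fun x hx => ?_
  obtain ⟨ν, hν, L, φ, hφ, hev⟩ := hΩ.2.2 x hx
  obtain ⟨r, hr, hball⟩ := Metric.eventually_nhds_iff_ball.1 hev
  refine ⟨frontier Ω ∩ Metric.ball x r,
    inter_mem_nhdsWithin _ (Metric.ball_mem_nhds x hr), ?_⟩
  have hφc : Continuous fun y : E => φ (y - ⟪ν, y⟫_ℝ • ν) :=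
    hφ.continuous.comp (continuous_orthComponent ν)
  have hνc : Continuous fun y : E => ⟪ν, y⟫_ℝ := continuous_const.inner continuous_id
  have hgraph : ∀ y ∈ frontier Ω ∩ Metric.ball x r, φ (y - ⟪ν, y⟫_ℝ • ν) = ⟪ν, y⟫_ℝ := by
    rintro y ⟨hy, hyr⟩
    refine le_antisymm ?_ (not_lt.1 fun hlt => ?_)
    · by_contra! hlt
      have hmem : {y' : E | ⟪ν, y'⟫_ℝ < φ (y' - ⟪ν, y'⟫_ℝ • ν)} ∩ Metric.ball x r ∈ 𝓝 y :=
        inter_mem ((isOpen_lt hνc hφc).mem_nhds hlt) (Metric.isOpen_ball.mem_nhds hyr)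
      obtain ⟨z, ⟨hz1, hz2⟩, hzΩ⟩ := mem_closure_iff_nhds.1 hy.1 _ hmem
      exact lt_asymm hz1 ((hball z hz2).1 hzΩ)
    · have : y ∈ Ω := (hball y hyr).2 hlt
      rw [hΩ.1.frontier_eq] at hy
      exact hy.2 this
  refine Measure.addHaar_eq_zero_of_disjoint_translates volume
    (fun m : ℕ => ((1 : ℝ) / (m + 1)) • ν) ?_ ?_
    (isClosed_frontier.measurableSet.inter Metric.isOpen_ball.measurableSet)
  · refine (Metric.isBounded_closedBall (x := (0 : E)) (r := 1)).subset ?_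
    rintro _ ⟨m, rfl⟩
    rw [mem_closedBall_zero_iff, norm_smul, hν, mul_one, Real.norm_eq_abs,
      abs_of_nonneg (by positivity), div_le_one (by positivity)]
    linarith [(Nat.cast_nonneg m : (0 : ℝ) ≤ m)]
  · intro m m' hmm
    refine Set.disjoint_left.2 ?_
    rintro z hz hz'
    simp only [singleton_add, mem_image] at hz hz'
    obtain ⟨y, hy, rfl⟩ := hz
    obtain ⟨y', hy', heq⟩ := hz'
    have hy'' : y' = y + ((1 : ℝ) / (m + 1) - 1 / (m' + 1)) • ν := by
      rw [sub_smul]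
      rw [eq_sub_of_add_eq' heq]
      abel
    have hν1 : ⟪ν, y'⟫_ℝ = ⟪ν, y⟫_ℝ + ((1 : ℝ) / (m + 1) - 1 / (m' + 1)) := by
      rw [hy'', inner_add_right, real_inner_smul_right, real_inner_self_eq_norm_sq, hν]
      ring
    have hP : y' - ⟪ν, y'⟫_ℝ • ν = y - ⟪ν, y⟫_ℝ • ν := by
      rw [hν1, hy'', add_smul]
      abel
    have h1 := hgraph y hy
    have h2 := hgraph y' hy'
    rw [hP, h1, hν1] at h2
    have h3 : (1 : ℝ) / (m + 1) = 1 / (m' + 1) := by linarith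
    rw [div_eq_div_iff (by positivity) (by positivity)] at h3
    exact hmm (by exact_mod_cast (by linarith : (m : ℝ) = m'))

variable {ι : Type*} {K : ι → Set (EuclideanSpace ℝ (Fin n))} {k : ℤ}

theorem IsDecomposition.isOpen (hT : IsDecomposition Ω K) (i : ι) : IsOpen (K i) :=
  (hT.lipschitz i).1

variable [Fintype ι]

/-- `(v, w)_Ω = (v, w)_{𝒯_h}`, since the skeleton of the decomposition is a null set. -/
theorem IsDecomposition.inner_eq_sum (hT : IsDecomposition Ω K) (v w : L2Form Ω k) :
    ⟪v, w⟫_ℝ = ∑ i, ⟪restrictL2 (hT.subset i) v, restrictL2 (hT.subset i) w⟫_ℝ := by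
  have hae : (Ω : Set E) =ᵐ[volume] (⋃ i, K i : Set E) := by
    refine Filter.EventuallyLE.antisymm ?_ (iUnion_subset hT.subset).eventuallyLE
    rw [ae_le_set]
    refine measure_mono_null (t := ⋃ i, frontier (K i)) ?_
      (measure_iUnion_null fun i => (hT.lipschitz i).volume_frontier)
    rintro x ⟨hx, hx'⟩
    obtain ⟨i, hi⟩ := mem_iUnion.1 (hT.cover hx)
    refine mem_iUnion.2 ⟨i, ?_⟩
    rw [(hT.isOpen i).frontier_eq]
    exact ⟨hi, fun h => hx' (mem_iUnion.2 ⟨i, h⟩)⟩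
  have hint : IntegrableOn (fun x => ⟪v x, w x⟫_ℝ) Ω := L2.integrable_inner v w
  rw [L2.inner_def, setIntegral_congr_set hae, integral_iUnion_fintype
    (fun i => (hT.isOpen i).measurableSet) hT.disjoint fun i => hint.mono_set (hT.subset i)]
  refine Finset.sum_congr rfl fun i _ => ?_
  rw [L2.inner_def]
  refine integral_congr_ae ?_
  filter_upwards [MemLp.coeFn_toLp
    ((Lp.memLp v).mono_measure (Measure.restrict_mono (hT.subset i) le_rfl)),
    MemLp.coeFn_toLp
    ((Lp.memLp w).mono_measure (Measure.restrict_mono (hT.subset i) le_rfl))] with x hx hx'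
  rw [restrictL2, restrictL2, hx, hx']

/-- Gluing: a broken form whose tangential traces are those of an unbroken form is unbroken. -/
theorem IsDecomposition.exists_glue (hT : IsDecomposition Ω K) (s : ∀ i, HForm (K i) k)
    (hs : (fun i => (s i).tan) ∈ singleValuedTan hT.subset k) :
    ∃ v : HForm Ω k, ∀ i, restrictH (hT.subset i) v = s i := by
  obtain ⟨w, hw⟩ := hs
  have hz : ∀ i, s i - restrictH (hT.subset i) w ∈ HForm₀ (K i) k := fun i => by
    rw [← Submodule.Quotient.eq]
    exact (congrFun hw i).symm
  classical
  refine ⟨w + ∑ i, zeroExtH (hT.subset i) _ (hz i), fun i => ?_⟩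
  rw [map_add, map_sum, Finset.sum_eq_single i]
  · rw [restrictH_zeroExtH _ (hT.isOpen i)]
    abel
  · intro i' _ hi'
    exact restrictH_zeroExtH_of_disjoint _ _ (hT.isOpen i').measurableSet (hT.isOpen i)
      (hT.disjoint hi') _ _
  · simp

end Lipschitz

/-! ### A closed range criterion -/

section ClosedRange

/-- An injective bounded operator that is bounded below on the kernel of a finite-rank operator is
bounded below. -/
theorem exists_bound_of_bound_on_ker {X Y F : Type*} [NormedAddCommGroup X] [NormedSpace ℝ X]
    [CompleteSpace X] [NormedAddCommGroup Y] [NormedSpace ℝ Y] [CompleteSpace Y]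
    [NormedAddCommGroup F] [NormedSpace ℝ F] [FiniteDimensional ℝ F] (A : X →L[ℝ] Y)
    (hA : Function.Injective A) (B : X →L[ℝ] F) (C : ℝ)
    (h : ∀ x, B x = 0 → ‖x‖ ≤ C * ‖A x‖) : ∃ C', ∀ x, ‖x‖ ≤ C' * ‖A x‖ := by
  let s : Submodule ℝ X := LinearMap.ker (B : X →ₗ[ℝ] F)
  have hs : IsClosed (s : Set X) := B.isClosed_ker
  have : CompleteSpace s := hs.completeSpace_coe
  let A' : s →L[ℝ] Y := A.comp s.subtypeL
  have hA' : AntilipschitzWith (Real.toNNReal C) A' := by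
    refine ContinuousLinearMap.antilipschitz_of_bound _ fun x => ?_
    exact (h x.1 x.2).trans (mul_le_mul_of_nonneg_right (Real.le_coe_toNNReal C) (norm_nonneg _))
  have hcl : IsClosed (s.map (A : X →ₗ[ℝ] Y) : Set Y) := by
    have h1 := hA'.isClosed_range A'.uniformContinuous
    have h2 : Set.range A' = (s.map (A : X →ₗ[ℝ] Y) : Set Y) := by
      ext y
      constructor
      · rintro ⟨x, rfl⟩
        exact ⟨x.1, x.2, rfl⟩
      · rintro ⟨x, hx, rfl⟩
        exact ⟨⟨x, hx⟩, rfl⟩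
    rwa [h2] at h1
  have hfin : s.CoFG := Submodule.CoFG.ker (B : X →ₗ[ℝ] F)
  have hr : IsClosed (Set.range A) :=
    LinearMap.isClosed_range_of_isClosed_map_of_finiteDimensional_quotient (s := s)
      (f := (A : X →ₗ[ℝ] Y)) hcl
  obtain ⟨K, hK⟩ := A.antilipschitz_of_injective_of_isClosed_range hA hr
  exact ⟨K, fun x => ContinuousLinearMap.bound_of_antilipschitz A hK x⟩

/-- A bounded operator on a Hilbert space that, on the orthogonal complement of its kernel, is
bounded below up to a finite-rank operator, is bounded below there. -/
theorem exists_bound_on_orthogonal_ker {H Y F : Type*} [NormedAddCommGroup H]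
    [InnerProductSpace ℝ H] [CompleteSpace H] [NormedAddCommGroup Y] [NormedSpace ℝ Y]
    [CompleteSpace Y] [NormedAddCommGroup F] [NormedSpace ℝ F] [FiniteDimensional ℝ F]
    (A : H →L[ℝ] Y) (B : H →L[ℝ] F) (C : ℝ)
    (h : ∀ x ∈ (LinearMap.ker A.toLinearMap)ᗮ, B x = 0 → ‖x‖ ≤ C * ‖A x‖) :
    ∃ C', 0 ≤ C' ∧ ∀ x ∈ (LinearMap.ker A.toLinearMap)ᗮ, ‖x‖ ≤ C' * ‖A x‖ := by
  let X := (LinearMap.ker A.toLinearMap)ᗮ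
  have hA : Function.Injective (A.comp X.subtypeL) := by
    rw [injective_iff_map_eq_zero]
    intro x hx
    have h1 : x.1 ∈ LinearMap.ker A.toLinearMap := hx
    exact Subtype.ext (inner_self_eq_zero.1 (Submodule.inner_left_of_mem_orthogonal h1 x.2))
  obtain ⟨C', hC'⟩ := exists_bound_of_bound_on_ker _ hA (B.comp X.subtypeL) C
    fun x hx => h x.1 x.2 hx
  refine ⟨max C' 0, le_max_right _ _, fun v hv => (hC' ⟨v, hv⟩).trans ?_⟩
  exact mul_le_mul_of_nonneg_right (le_max_left _ _) (norm_nonneg _)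

end ClosedRange

/-! ### Cones at the boundary of a Lipschitz domain -/

section Cones

variable {n : ℕ} {Ω : Set (EuclideanSpace ℝ (Fin n))}

local notation "E" => EuclideanSpace ℝ (Fin n)

/-- The uniform cone property at a point of `closure Ω`: nearby points of `Ω` stay in `Ω` when
moved a little in the directions close to some `ν`. -/
theorem IsBoundedLipschitzDomain.exists_cone (hΩ : IsBoundedLipschitzDomain Ω) {x : E}
    (hx : x ∈ closure Ω) : ∃ ν : E, ‖ν‖ ≤ 1 ∧ ∃ r > (0 : ℝ), ∃ ρ > (0 : ℝ), ρ ≤ 1 ∧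
      ∃ t₀ > (0 : ℝ), ∀ y ∈ Ω ∩ Metric.ball x r, ∀ t, 0 ≤ t → t ≤ t₀ → ∀ b, ‖b - ν‖ ≤ ρ →
        y + t • b ∈ Ω := by
  by_cases hxΩ : x ∈ Ω
  · obtain ⟨r, hr, hb⟩ := Metric.isOpen_iff.1 hΩ.1 x hxΩ
    refine ⟨0, by simp, r / 2, by positivity, 1, one_pos, le_rfl, r / 2, by positivity, ?_⟩
    rintro y ⟨_, hy⟩ t ht0 ht b hb1
    refine hb ?_
    rw [Metric.mem_ball, dist_eq_norm] at hy ⊢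
    rw [sub_zero] at hb1
    calc ‖y + t • b - x‖ = ‖(y - x) + t • b‖ := by congr 1; abel
      _ ≤ ‖y - x‖ + ‖t • b‖ := norm_add_le _ _
      _ ≤ ‖y - x‖ + r / 2 * 1 := by
        rw [norm_smul, Real.norm_eq_abs, abs_of_nonneg ht0]
        gcongr
      _ < r := by linarith
  · have hxf : x ∈ frontier Ω := by
      rw [hΩ.1.frontier_eq]; exact ⟨hx, hxΩ⟩
    obtain ⟨ν, hν, L, φ, hφ, hev⟩ := hΩ.2.2 x hxf
    obtain ⟨r, hr, hball⟩ := Metric.eventually_nhds_iff_ball.1 hev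
    have hL : (0 : ℝ) ≤ L := L.2
    -- `2 L ρ + ρ ≤ 1` keeps the direction `b` above the slope of the graph
    refine ⟨ν, hν.le, r / 2, by positivity, 1 / (2 * L + 1), by positivity, ?_, r / 4,
      by positivity, ?_⟩
    · rw [div_le_one (by positivity)]; linarith
    rintro y ⟨hyΩ, hy⟩ t ht0 ht b hb
    have hρ1 : 1 / (2 * (L : ℝ) + 1) ≤ 1 := by
      rw [div_le_one (by positivity)]; linarith
    set ρ : ℝ := 1 / (2 * L + 1) with hρ
    have hρL : 2 * L * ρ + ρ = 1 := by
      rw [hρ]; field_simp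
    have hbn : ‖b‖ ≤ 2 := by
      calc ‖b‖ = ‖(b - ν) + ν‖ := by rw [sub_add_cancel]
        _ ≤ ‖b - ν‖ + ‖ν‖ := norm_add_le _ _
        _ ≤ 2 := by linarith
    have hyr : y ∈ Metric.ball x r := Metric.ball_subset_ball (by linarith) hy
    have hyr' : y + t • b ∈ Metric.ball x r := by
      rw [Metric.mem_ball, dist_eq_norm] at hy ⊢
      calc ‖y + t • b - x‖ = ‖(y - x) + t • b‖ := by congr 1; abel
        _ ≤ ‖y - x‖ + ‖t • b‖ := norm_add_le _ _
        _ ≤ ‖y - x‖ + r / 4 * 2 := by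
          rw [norm_smul, Real.norm_eq_abs, abs_of_nonneg ht0]
          gcongr
        _ < r := by linarith
    rw [hball _ hyr']
    have h0 := (hball _ hyr).1 hyΩ
    have hinner : |⟪ν, b - ν⟫_ℝ| ≤ ρ := by
      refine (abs_real_inner_le_norm _ _).trans ?_
      rw [hν, one_mul]; exact hb
    have hνν : ⟪ν, ν⟫_ℝ = 1 := by rw [real_inner_self_eq_norm_sq, hν]; norm_num
    have hνb : ⟪ν, b⟫_ℝ = 1 + ⟪ν, b - ν⟫_ℝ := by rw [inner_sub_right, hνν]; ring
    have hPd : dist (y + t • b - ⟪ν, y + t • b⟫_ℝ • ν) (y - ⟪ν, y⟫_ℝ • ν) ≤ t * (2 * ρ) := by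
      have : y + t • b - ⟪ν, y + t • b⟫_ℝ • ν - (y - ⟪ν, y⟫_ℝ • ν) =
          t • ((b - ν) - ⟪ν, b - ν⟫_ℝ • ν) := by
        rw [inner_add_right, real_inner_smul_right, hνb]
        module
      rw [dist_eq_norm, this, norm_smul, Real.norm_eq_abs, abs_of_nonneg ht0]
      gcongr
      calc ‖(b - ν) - ⟪ν, b - ν⟫_ℝ • ν‖ ≤ ‖b - ν‖ + ‖⟪ν, b - ν⟫_ℝ • ν‖ := norm_sub_le _ _
        _ ≤ ρ + ρ := by
          rw [norm_smul, hν, mul_one, Real.norm_eq_abs]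
          exact add_le_add hb hinner
        _ = 2 * ρ := by ring
    have hφd := (hφ.dist_le_mul _ _).trans (mul_le_mul_of_nonneg_left hPd hL)
    rw [Real.dist_eq] at hφd
    have hφd' := (abs_le.1 hφd).2
    have hin : ⟪ν, y + t • b⟫_ℝ = ⟪ν, y⟫_ℝ + t * (1 + ⟪ν, b - ν⟫_ℝ) := by
      rw [inner_add_right, real_inner_smul_right, hνb]
    have h1 : t * (2 * L * ρ) ≤ t * (1 + ⟪ν, b - ν⟫_ℝ) :=
      mul_le_mul_of_nonneg_left (by linarith [(abs_le.1 hinner).1]) ht0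
    linarith

/-- A finite smooth partition of unity on `Ω`, each member of which has a cone of directions in
which its support can be translated within `Ω`. -/
theorem IsBoundedLipschitzDomain.exists_partition (hΩ : IsBoundedLipschitzDomain Ω) :
    ∃ (N : ℕ) (χ : Fin N → E → ℝ) (ν : Fin N → E) (ρ : Fin N → ℝ) (t₀ : ℝ), 0 < t₀ ∧
      (∀ i, ContDiff ℝ ∞ (χ i)) ∧ (∀ i, HasCompactSupport (χ i)) ∧ (∀ i x, |χ i x| ≤ 1) ∧
      (∀ x ∈ Ω, ∑ i, χ i x = 1) ∧ (∀ i, ‖ν i‖ ≤ 1) ∧ (∀ i, 0 < ρ i) ∧ (∀ i, ρ i ≤ 1) ∧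
      ∀ i, ∀ x ∈ tsupport (χ i), x ∈ Ω → ∀ t, 0 ≤ t → t ≤ t₀ → ∀ b, ‖b - ν i‖ ≤ ρ i →
        x + t • b ∈ Ω := by
  have hcomp : IsCompact (closure Ω) := hΩ.2.1.isCompact_closure
  choose! ν hν r hr ρ hρ hρ1 t₀ ht₀ hcone using fun x (hx : x ∈ closure Ω) => hΩ.exists_cone hx
  obtain ⟨s, hs, hcov⟩ := hcomp.elim_nhds_subcover (fun x => Metric.ball x (r x))
    fun x hx => Metric.ball_mem_nhds x (hr x hx)
  let e := s.equivFin.symm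
  have hmem : ∀ i, ((e i : s) : E) ∈ closure Ω := fun i => hs _ (e i).2
  have hcov' : closure Ω ⊆ ⋃ i, Metric.ball (e i : E) (r (e i)) := by
    intro x hx
    obtain ⟨y, hy, hxy⟩ := mem_iUnion₂.1 (hcov hx)
    refine mem_iUnion.2 ⟨e.symm ⟨y, hy⟩, ?_⟩
    rw [Equiv.apply_symm_apply]
    exact hxy
  obtain ⟨f, hf⟩ := SmoothPartitionOfUnity.exists_isSubordinate (modelWithCornersSelf ℝ E)
    isClosed_closure (fun i => Metric.ball (e i : E) (r (e i))) (fun i => Metric.isOpen_ball) hcov'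
  obtain ⟨t₁, ht₁, ht₁'⟩ : ∃ t₁ > 0, ∀ i, t₁ ≤ t₀ (e i : E) := by
    have h1 : ∀ᶠ t in 𝓝[>] (0 : ℝ), ∀ i, t ≤ t₀ (e i : E) := by
      rw [eventually_all]
      exact fun i => mem_nhdsWithin_of_mem_nhds (Iic_mem_nhds (ht₀ _ (hmem i)))
    obtain ⟨t, ht, ht'⟩ := (h1.and self_mem_nhdsWithin).exists
    exact ⟨t, ht', ht⟩
  refine ⟨s.card, fun i => f i, fun i => ν (e i), fun i => ρ (e i), t₁, ht₁,
    fun i => (f i).contMDiff.contDiff, fun i => ?_, fun i x => ?_, fun x hx => ?_,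
    fun i => hν _ (hmem i), fun i => hρ _ (hmem i), fun i => hρ1 _ (hmem i), ?_⟩
  · exact Metric.isCompact_of_isClosed_isBounded (isClosed_tsupport _)
      (Metric.isBounded_ball.subset (hf i))
  · rw [abs_of_nonneg (f.nonneg i x)]
    exact f.le_one i x
  · rw [← finsum_eq_sum_of_fintype]
    exact f.sum_eq_one (subset_closure hx)
  · intro i x hx hxΩ t ht0 ht b hb
    exact hcone _ (hmem i) x ⟨hxΩ, hf i hx⟩ t ht0 (ht.trans (ht₁' i)) b hb

end Cones

/-! ### Local averages -/

section Averages

variable {n : ℕ} {k : ℤ} {Ω : Set (EuclideanSpace ℝ (Fin n))}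

local notation "E" => EuclideanSpace ℝ (Fin n)

theorem memLp_kernel {θ : E → ℝ} (hθ : Continuous θ) (hc : HasCompactSupport θ) (x : E)
    (c : Alt n k) : MemLp (fun z => θ (z - x) • c) 2 (volume.restrict Ω) := by
  refine (Continuous.memLp_of_hasCompactSupport (μ := volume) ?_ ?_).restrict Ω
  · fun_prop
  · have : HasCompactSupport fun z => θ (z - x) :=
      hc.comp_homeomorph (Homeomorph.subRight x)
    exact this.smul_right

/-- The form `z ↦ θ(z - x) c`, depending linearly on the constant form `c`. -/
def kernelForm (Ω : Set E) {θ : E → ℝ} (hθ : Continuous θ) (hc : HasCompactSupport θ) (x : E) :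
    Alt n k →ₗ[ℝ] L2Form Ω k where
  toFun c := (memLp_kernel hθ hc x c).toLp _
  map_add' c c' := by
    rw [← MemLp.toLp_add]
    exact MemLp.toLp_congr _ _ (Eventually.of_forall fun z => smul_add _ _ _)
  map_smul' a c := by
    rw [RingHom.id_apply, ← MemLp.toLp_const_smul]
    exact MemLp.toLp_congr _ _ (Eventually.of_forall fun z => smul_comm _ _ _)

theorem inner_kernelForm {θ : E → ℝ} (hθ : Continuous θ) (hc : HasCompactSupport θ) (x : E)
    (v : L2Form Ω k) (c : Alt n k) :
    ⟪v, kernelForm Ω hθ hc x c⟫_ℝ = ∫ z in Ω, θ (z - x) * ⟪v z, c⟫_ℝ := by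
  change ⟪v, (memLp_kernel hθ hc x c).toLp _⟫_ℝ = _
  rw [inner_toLp_right]
  simp only [real_inner_smul_right]

/-- The local averages of `v` with weight `θ(· - x)`, `x ∈ Ω`, are uniformly small if `v` is
orthogonal to a suitable finite-dimensional space: the weights depend continuously on `x` in `L²`,
and it suffices to make the averages vanish at the points of a finite net of `Ω`. -/
theorem exists_finiteDimensional_average_le (hb : Bornology.IsBounded Ω) {θ : E → ℝ}
    (hθ : Continuous θ) (hc : HasCompactSupport θ) {ε : ℝ} (hε : 0 < ε) :
    ∃ F : Submodule ℝ (L2Form Ω k), FiniteDimensional ℝ F ∧ ∀ v ∈ Fᗮ, ∀ x ∈ Ω, ∀ c : Alt n k,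
      |∫ z in Ω, θ (z - x) * ⟪v z, c⟫_ℝ| ≤ ε * ‖v‖ * ‖c‖ := by
  have hfin : IsFiniteMeasure (volume.restrict Ω) := ⟨by simpa using hb.measure_lt_top⟩
  set V : ℝ := (measureUnivNNReal (volume.restrict Ω)) ^ (2 : ENNReal).toReal⁻¹ with hV
  have hV0 : 0 ≤ V := by positivity
  obtain ⟨ρ, hρ, hunif⟩ := Metric.uniformContinuous_iff.1
    (hc.uniformContinuous_of_continuous hθ) (ε / (V + 1)) (by positivity)
  obtain ⟨t, ht, hcov⟩ := Metric.totallyBounded_iff.1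
    (hb.isCompact_closure.totallyBounded.subset subset_closure) ρ hρ
  refine ⟨ht.toFinset.sup fun y => LinearMap.range (kernelForm (k := k) Ω hθ hc y),
    inferInstance, fun v hv x hx c => ?_⟩
  obtain ⟨y, hy, hxy⟩ := mem_iUnion₂.1 (hcov hx)
  have hle : LinearMap.range (kernelForm (k := k) Ω hθ hc y) ≤
      ht.toFinset.sup fun y => LinearMap.range (kernelForm (k := k) Ω hθ hc y) :=
    Finset.le_sup (f := fun y => LinearMap.range (kernelForm (k := k) Ω hθ hc y))
      (ht.mem_toFinset.2 hy)
  have h0 : ⟪v, kernelForm Ω hθ hc y c⟫_ℝ = 0 :=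
    Submodule.inner_left_of_mem_orthogonal (hle ⟨c, rfl⟩) hv
  rw [← inner_kernelForm hθ hc, ← sub_zero ⟪v, kernelForm Ω hθ hc x c⟫_ℝ, ← h0, ← inner_sub_right]
  have hnorm : ‖kernelForm Ω hθ hc x c - kernelForm Ω hθ hc y c‖ ≤ V * (ε / (V + 1) * ‖c‖) := by
    refine Lp.norm_le_of_ae_bound (by positivity) ?_
    filter_upwards [Lp.coeFn_sub (kernelForm Ω hθ hc x c) (kernelForm Ω hθ hc y c),
      (memLp_kernel (Ω := Ω) hθ hc x c).coeFn_toLp,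
      (memLp_kernel (Ω := Ω) hθ hc y c).coeFn_toLp] with z hz hz1 hz2
    change (kernelForm Ω hθ hc x c) z = _ at hz1
    change (kernelForm Ω hθ hc y c) z = _ at hz2
    rw [hz, Pi.sub_apply, hz1, hz2, ← sub_smul, norm_smul]
    refine mul_le_mul_of_nonneg_right (le_of_lt ?_) (norm_nonneg c)
    rw [← dist_eq_norm]
    refine hunif ?_
    rw [dist_sub_left]
    exact hxy
  calc |⟪v, kernelForm Ω hθ hc x c - kernelForm Ω hθ hc y c⟫_ℝ|
      ≤ ‖v‖ * ‖kernelForm Ω hθ hc x c - kernelForm Ω hθ hc y c‖ := abs_real_inner_le_norm _ _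
    _ ≤ ‖v‖ * (V * (ε / (V + 1) * ‖c‖)) := by gcongr
    _ = (V / (V + 1)) * (ε * ‖v‖ * ‖c‖) := by ring
    _ ≤ 1 * (ε * ‖v‖ * ‖c‖) := by
      gcongr
      rw [div_le_one (by positivity)]
      linarith
    _ = ε * ‖v‖ * ‖c‖ := one_mul _

end Averages

/-! ### Operations on test forms -/

section TestFormOperations

variable {n : ℕ} {k : ℤ} {Ω : Set (EuclideanSpace ℝ (Fin n))}

local notation "E" => EuclideanSpace ℝ (Fin n)

/-- The translate `ζ(· - b)` of a test form, if its support stays in `Ω`. -/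
def TestForm.translate (ζ : TestForm Ω k) (b : E) (h : ∀ x ∈ tsupport ζ.toFun, x + b ∈ Ω) :
    TestForm Ω k where
  toFun z := ζ.toFun (z - b)
  smooth := ζ.smooth.comp (contDiff_id.sub contDiff_const)
  compact := ζ.compact.comp_homeomorph (Homeomorph.subRight b)
  support_subset := by
    intro z hz
    have := tsupport_comp_subset_preimage ζ.toFun (f := fun z => z - b) (by fun_prop) hz
    simpa using h _ this

/-- A constant linear map applied to a test form. -/
def TestForm.map {k' : ℤ} (A : Alt n k →L[ℝ] Alt n k') (ζ : TestForm Ω k) : TestForm Ω k' where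
  toFun z := A (ζ.toFun z)
  smooth := A.contDiff.comp ζ.smooth
  compact := ζ.compact.comp_left (map_zero A)
  support_subset := (tsupport_comp_subset (map_zero A) _).trans ζ.support_subset

/-- The product of a smooth function and a test form. -/
def TestForm.smul {χ : E → ℝ} (hχ : ContDiff ℝ ∞ χ) (ζ : TestForm Ω k) : TestForm Ω k where
  toFun z := χ z • ζ.toFun z
  smooth := hχ.smul ζ.smooth
  compact := HasCompactSupport.intro ζ.compact fun x hx => by
    rw [image_eq_zero_of_notMem_tsupport hx, smul_zero]
  support_subset := (tsupport_smul_subset_right χ ζ.toFun).trans ζ.support_subset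

/-- The contraction `∇χ ⌟ ξ` of a test form with the gradient of a smooth function. -/
def TestForm.gradInterior {χ : E → ℝ} (hχ : ContDiff ℝ ∞ χ) (ξ : TestForm Ω (k + 1)) :
    TestForm Ω k where
  toFun z := ∑ i, fderiv ℝ χ z (EuclideanSpace.single i 1) • interiorMul i (ξ.toFun z)
  smooth := ContDiff.sum fun i _ =>
    ((hχ.fderiv_right (m := ∞) (by norm_cast)).clm_apply contDiff_const).smul
      ((interiorMul i).contDiff.comp ξ.smooth)
  compact := HasCompactSupport.intro ξ.compact fun x hx => by
    simp [image_eq_zero_of_notMem_tsupport hx]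
  support_subset := by
    refine (closure_minimal ?_ (isClosed_tsupport ξ.toFun)).trans ξ.support_subset
    intro x hx
    by_contra hx'
    exact hx (by simp [image_eq_zero_of_notMem_tsupport hx'])

theorem tsupport_gradInterior_subset {χ : E → ℝ} (hχ : ContDiff ℝ ∞ χ) (ξ : TestForm Ω (k + 1)) :
    tsupport (ξ.gradInterior hχ).toFun ⊆ tsupport χ := by
  refine closure_minimal ?_ (isClosed_tsupport χ)
  intro x hx
  by_contra hx'
  have h : fderiv ℝ χ x = 0 := by
    by_contra hne
    exact hx' (support_fderiv_subset ℝ hne)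
  exact hx (by simp [TestForm.gradInterior, h])

/-- A pointwise bound, up to a translation, gives a bound of `L²` norms. -/
theorem TestForm.norm_toL2_le {k' : ℤ} {ψ : TestForm Ω k'} {ξ : TestForm Ω k} {C : ℝ} (hC : 0 ≤ C)
    (b : E) (h : ∀ z, ‖ψ.toFun z‖ ≤ C * ‖ξ.toFun (z - b)‖) : ‖ψ.toL2‖ ≤ C * ‖ξ.toL2‖ := by
  have hξ : eLpNorm ξ.toFun 2 (volume.restrict Ω) = eLpNorm ξ.toFun 2 volume := by
    refine eLpNorm_restrict_eq_of_support_subset fun x hx => ?_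
    by_contra hx'
    exact hx (ξ.eq_zero_of_notMem hx')
  have h1 : eLpNorm ψ.toFun 2 (volume.restrict Ω) ≤
      ENNReal.ofReal C * eLpNorm ξ.toFun 2 (volume.restrict Ω) := by
    calc eLpNorm ψ.toFun 2 (volume.restrict Ω) ≤ eLpNorm ψ.toFun 2 volume :=
          eLpNorm_mono_measure _ Measure.restrict_le_self
      _ ≤ ENNReal.ofReal C * eLpNorm (fun z => ξ.toFun (z - b)) 2 volume :=
          eLpNorm_le_mul_eLpNorm_of_ae_le_mul (Eventually.of_forall h) 2
      _ = ENNReal.ofReal C * eLpNorm ξ.toFun 2 (volume.restrict Ω) := by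
          rw [hξ, ← eLpNorm_comp_measurePreserving ξ.continuous.aestronglyMeasurable
            (measurePreserving_sub_right volume b)]
          rfl
  rw [TestForm.toL2, TestForm.toL2, Lp.norm_toLp, Lp.norm_toLp, ← ENNReal.toReal_ofReal hC,
    ← ENNReal.toReal_mul]
  exact ENNReal.toReal_mono (ENNReal.mul_ne_top ENNReal.ofReal_ne_top ξ.memLp.eLpNorm_ne_top) h1

theorem coD_comp_sub (β : E → Alt n (k + 1)) (b z : E) :
    coD (fun y => β (y - b)) z = coD β (z - b) := by
  rw [coD_eq_sum, coD_eq_sum]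
  simp only [partialDeriv, fderiv_comp_sub]

variable (n k) in
/-- A bound for the norm of `a ∧ ·` in terms of the Euclidean norm of `a`. -/
def wedgeBound : ℝ := ∑ l : Fin n, ‖(exteriorMul l : Alt n k →L[ℝ] Alt n (k + 1))‖

variable (n k) in
/-- A bound for the contraction with a covector, in terms of its largest coordinate. -/
def interiorBound : ℝ := ∑ l : Fin n, ‖(interiorMul l : Alt n (k + 1) →L[ℝ] Alt n k)‖

theorem wedgeBound_nonneg : 0 ≤ wedgeBound n k := Finset.sum_nonneg fun _ _ => norm_nonneg _

theorem interiorBound_nonneg : 0 ≤ interiorBound n k := Finset.sum_nonneg fun _ _ => norm_nonneg _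

theorem norm_wedge_le (a : E) (α : Alt n k) : ‖wedge a α‖ ≤ wedgeBound n k * ‖a‖ * ‖α‖ := by
  rw [wedge_apply, wedgeBound, Finset.sum_mul, Finset.sum_mul]
  refine (norm_sum_le _ _).trans (Finset.sum_le_sum fun l _ => ?_)
  rw [norm_smul]
  calc ‖a l‖ * ‖exteriorMul l α‖ ≤ ‖a‖ * (‖(exteriorMul l : Alt n k →L[ℝ] _)‖ * ‖α‖) := by
        gcongr
        · exact PiLp.norm_apply_le a l
        · exact (exteriorMul l).le_opNorm α
    _ = _ := by ring

theorem norm_gradInterior_le {χ : E → ℝ} (hχ : ContDiff ℝ ∞ χ) {M : ℝ}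
    (hM : ∀ x, ‖fderiv ℝ χ x‖ ≤ M) (ξ : TestForm Ω (k + 1)) (z : E) :
    ‖(ξ.gradInterior hχ).toFun z‖ ≤ interiorBound n k * M * ‖ξ.toFun z‖ := by
  change ‖∑ i, fderiv ℝ χ z (EuclideanSpace.single i 1) • interiorMul i (ξ.toFun z)‖ ≤ _
  rw [interiorBound, Finset.sum_mul, Finset.sum_mul]
  refine (norm_sum_le _ _).trans (Finset.sum_le_sum fun l _ => ?_)
  rw [norm_smul]
  have hM0 : 0 ≤ M := (norm_nonneg _).trans (hM 0)
  calc _ ≤ M * (‖(interiorMul l : Alt n (k + 1) →L[ℝ] _)‖ * ‖ξ.toFun z‖) := by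
        gcongr
        · refine ((fderiv ℝ χ z).le_opNorm _).trans ?_
          simpa using hM z
        · exact (interiorMul l).le_opNorm _
    _ = _ := by ring

end TestFormOperations

/-! ### The homotopy formula for translations -/

section Translation

variable {n : ℕ} {k : ℤ} {Ω : Set (EuclideanSpace ℝ (Fin n))}

local notation "E" => EuclideanSpace ℝ (Fin n)

theorem integrable_norm (hb : Bornology.IsBounded Ω) (v : L2Form Ω k) :
    Integrable (fun z => ‖v z‖) (volume.restrict Ω) := by
  have hfin : IsFiniteMeasure (volume.restrict Ω) := ⟨by simpa using hb.measure_lt_top⟩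
  exact ((Lp.memLp v).integrable (by norm_num)).norm

/-- The derivative of `t ↦ (v, ζ(· - t a))_Ω`. -/
theorem hasDerivAt_inner_translate (hb : Bornology.IsBounded Ω) (v : L2Form Ω k)
    {ζ : E → Alt n k} (hζ : ContDiff ℝ ∞ ζ) (hc : HasCompactSupport ζ) (a : E) (t : ℝ) :
    HasDerivAt (fun t : ℝ => ∫ z in Ω, ⟪v z, ζ (z - t • a)⟫_ℝ)
      (∫ z in Ω, ⟪v z, -fderiv ℝ ζ (z - t • a) a⟫_ℝ) t := by
  have hdc : Continuous fun z => fderiv ℝ ζ z a :=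
    (hζ.continuous_fderiv (by simp)).clm_apply continuous_const
  have hdcs : HasCompactSupport fun z => fderiv ℝ ζ z a :=
    (hc.fderiv (𝕜 := ℝ)).comp_left (g := fun A : E →L[ℝ] Alt n k => A a) rfl
  obtain ⟨B, hB⟩ := hdcs.exists_bound_of_continuous hdc
  obtain ⟨B', hB'⟩ := hc.exists_bound_of_continuous hζ.continuous
  have hvm : AEStronglyMeasurable v (volume.restrict Ω) := Lp.aestronglyMeasurable v
  have hm : ∀ s : ℝ, AEStronglyMeasurable (fun z => ⟪v z, ζ (z - s • a)⟫_ℝ)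
      (volume.restrict Ω) := fun s =>
    hvm.inner (hζ.continuous.comp (continuous_id.sub continuous_const)).aestronglyMeasurable
  refine (hasDerivAt_integral_of_dominated_loc_of_deriv_le (s := univ)
    (F' := fun s z => ⟪v z, -fderiv ℝ ζ (z - s • a) a⟫_ℝ)
    (bound := fun z => ‖v z‖ * B) univ_mem (Eventually.of_forall hm) ?_ ?_ ?_ ?_ ?_).2
  · refine ((integrable_norm hb v).mul_const B').mono' (hm t) (Eventually.of_forall fun z => ?_)
    exact (norm_inner_le_norm _ _).trans (mul_le_mul_of_nonneg_left (hB' _) (norm_nonneg _))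
  · exact hvm.inner (hdc.comp (continuous_id.sub continuous_const)).neg.aestronglyMeasurable
  · refine Eventually.of_forall fun z s _ => ?_
    refine (norm_inner_le_norm _ _).trans (mul_le_mul_of_nonneg_left ?_ (norm_nonneg _))
    rw [norm_neg]
    exact hB _
  · exact (integrable_norm hb v).mul_const B
  · refine Eventually.of_forall fun z s _ => ?_
    have h1 : HasDerivAt (fun s : ℝ => z - s • a) (-a) s := by
      simpa using ((hasDerivAt_id s).smul_const a).const_sub z
    have h2 := ((hζ.differentiable (by simp) (z - s • a)).hasFDerivAt.comp_hasDerivAt s h1)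
    have h3 : HasDerivAt (fun s : ℝ => ⟪v z, ζ (z - s • a)⟫_ℝ)
        ⟪v z, fderiv ℝ ζ (z - s • a) (-a)⟫_ℝ s :=
      (innerSL ℝ (v z)).hasFDerivAt.comp_hasDerivAt s h2
    rwa [map_neg] at h3

/-- For a co-exact test form `ξ = δη`, a form `v ∈ HΛ(Ω)` hardly distinguishes `χ ξ` from its
translate by a short vector `a`. Indeed, along `ζₜ = (χ ξ)(· - t a)` one has
`d/dt (v, ζₜ) = (v, δ(a ∧ ζₜ) + a ∧ δζₜ)`, in which the first term is `(dv, a ∧ ζₜ)` and the second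
one is of order zero because `δ(χ ξ) = -∇χ ⌟ ξ`. -/
theorem abs_inner_translate_sub_le (hb : Bornology.IsBounded Ω) {χ : E → ℝ}
    (hχ : ContDiff ℝ ∞ χ) (hχ1 : ∀ x, |χ x| ≤ 1) {M : ℝ} (hM : ∀ x, ‖fderiv ℝ χ x‖ ≤ M) (a : E)
    (ha : ∀ x ∈ tsupport χ, x ∈ Ω → ∀ t : ℝ, 0 ≤ t → t ≤ 1 → x + t • a ∈ Ω)
    (v : HForm Ω (k + 1)) (η : TestForm Ω (k + 1 + 1)) :
    |(∫ z in Ω, ⟪v.form z, χ (z - a) • η.coD.toFun (z - a)⟫_ℝ) -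
        ∫ z in Ω, ⟪v.form z, χ z • η.coD.toFun z⟫_ℝ| ≤
      ‖a‖ * (wedgeBound n (k + 1) * ‖v.d‖ +
        wedgeBound n k * interiorBound n k * M * ‖v.form‖) * ‖η.delta‖ := by
  set ξ := η.coD with hξ
  have hM0 : 0 ≤ M := (norm_nonneg _).trans (hM 0)
  let ζ : TestForm Ω (k + 1) := ξ.smul hχ
  let g : TestForm Ω k := ξ.gradInterior hχ
  have hζs : ∀ t : ℝ, 0 ≤ t → t ≤ 1 → ∀ x ∈ tsupport ζ.toFun, x + t • a ∈ Ω := fun t h0 h1 x hx =>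
    ha x (tsupport_smul_subset_left χ _ hx) (ζ.support_subset hx) t h0 h1
  have hgs : ∀ t : ℝ, 0 ≤ t → t ≤ 1 → ∀ x ∈ tsupport g.toFun, x + t • a ∈ Ω := fun t h0 h1 x hx =>
    ha x (tsupport_gradInterior_subset hχ ξ hx) (g.support_subset hx) t h0 h1
  have hcoD : ∀ x, HodgeDD.coD ζ.toFun x = -g.toFun x := by
    intro x
    have h1 := coD_smul (hχ.differentiable (by simp) x) (ξ.smooth.differentiable (by simp) x)
    have h2 : HodgeDD.coD ξ.toFun x = 0 := coD_coD η.smooth x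
    rw [h2, smul_zero, zero_sub] at h1
    exact h1
  let F : ℝ → ℝ := fun t => ∫ z in Ω, ⟪v.form z, ζ.toFun (z - t • a)⟫_ℝ
  have hF : ∀ t, HasDerivAt F (∫ z in Ω, ⟪v.form z, -fderiv ℝ ζ.toFun (z - t • a) a⟫_ℝ) t :=
    hasDerivAt_inner_translate hb v.form ζ.smooth ζ.compact a
  have hF' : ∀ t : ℝ, 0 ≤ t → t ≤ 1 →
      ‖∫ z in Ω, ⟪v.form z, -fderiv ℝ ζ.toFun (z - t • a) a⟫_ℝ‖ ≤
      ‖a‖ * (wedgeBound n (k + 1) * ‖v.d‖ +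
        wedgeBound n k * interiorBound n k * M * ‖v.form‖) * ‖η.delta‖ := by
    intro t h0 h1
    let ψ : TestForm Ω (k + 1 + 1) := (ζ.translate (t • a) (hζs t h0 h1)).map (wedge a)
    let γ : TestForm Ω (k + 1) := (g.translate (t • a) (hgs t h0 h1)).map (wedge a)
    have heq : ∫ z in Ω, ⟪v.form z, -fderiv ℝ ζ.toFun (z - t • a) a⟫_ℝ =
        ⟪v.d, ψ.toL2⟫_ℝ - ⟪v.form, γ.toL2⟫_ℝ := by
      have hw : ⟪v.d, ψ.toL2⟫_ℝ = ⟪v.form, ψ.delta⟫_ℝ := v.2 ψ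
      rw [hw, ← inner_sub_right, TestForm.delta, TestForm.toL2, ← MemLp.toLp_sub,
        inner_toLp_right]
      refine integral_congr_ae (Eventually.of_forall fun z => ?_)
      have h2 : HodgeDD.coD ψ.toFun z =
          HodgeDD.coD (fun y => wedge a (ζ.toFun y)) (z - t • a) :=
        coD_comp_sub (fun y => wedge a (ζ.toFun y)) (t • a) z
      have h3 := coD_wedge (ζ.smooth.differentiable (by simp) (z - t • a)) a
      have h4 : γ.toFun z = wedge a (g.toFun (z - t • a)) := rfl
      simp only [Pi.sub_apply]
      rw [h2, h3, hcoD, h4, map_neg]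
      congr 1
      abel
    have hψ : ‖ψ.toL2‖ ≤ (wedgeBound n (k + 1) * ‖a‖) * ‖ξ.toL2‖ := by
      refine TestForm.norm_toL2_le (mul_nonneg wedgeBound_nonneg (norm_nonneg _)) (t • a)
        fun z => ?_
      refine (norm_wedge_le a _).trans ?_
      refine mul_le_mul_of_nonneg_left ?_ (mul_nonneg wedgeBound_nonneg (norm_nonneg _))
      change ‖χ _ • ξ.toFun (z - t • a)‖ ≤ _
      rw [norm_smul]
      exact mul_le_of_le_one_left (norm_nonneg _) (hχ1 _)
    have hγ : ‖γ.toL2‖ ≤ (wedgeBound n k * ‖a‖ * (interiorBound n k * M)) * ‖ξ.toL2‖ := by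
      refine TestForm.norm_toL2_le (mul_nonneg (mul_nonneg wedgeBound_nonneg (norm_nonneg _))
        (mul_nonneg interiorBound_nonneg hM0)) (t • a) fun z => ?_
      refine (norm_wedge_le a _).trans ?_
      rw [mul_assoc (wedgeBound n k * ‖a‖)]
      exact mul_le_mul_of_nonneg_left (norm_gradInterior_le hχ hM ξ _)
        (mul_nonneg wedgeBound_nonneg (norm_nonneg _))
    rw [heq, Real.norm_eq_abs]
    calc |⟪v.d, ψ.toL2⟫_ℝ - ⟪v.form, γ.toL2⟫_ℝ|
        ≤ |⟪v.d, ψ.toL2⟫_ℝ| + |⟪v.form, γ.toL2⟫_ℝ| := abs_sub _ _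
      _ ≤ ‖v.d‖ * ‖ψ.toL2‖ + ‖v.form‖ * ‖γ.toL2‖ :=
        add_le_add (abs_real_inner_le_norm _ _) (abs_real_inner_le_norm _ _)
      _ ≤ ‖v.d‖ * ((wedgeBound n (k + 1) * ‖a‖) * ‖ξ.toL2‖) +
          ‖v.form‖ * ((wedgeBound n k * ‖a‖ * (interiorBound n k * M)) * ‖ξ.toL2‖) := by
        gcongr
      _ = _ := by
        rw [hξ, TestForm.toL2_coD]; ring
  have key := norm_image_sub_le_of_norm_deriv_le_segment_01' (f := F)
    (fun t _ => (hF t).hasDerivWithinAt) fun t ht => hF' t ht.1 ht.2.le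
  simpa [F, ζ, TestForm.smul] using key

end Translation

/-! ### Averaging over translations -/

section Averaging

variable {n : ℕ} {k : ℤ} {Ω : Set (EuclideanSpace ℝ (Fin n))}

local notation "E" => EuclideanSpace ℝ (Fin n)

/-- Fubini's theorem for `∫ θ(a) (v, ζ(· - a))_Ω da`. -/
theorem integral_mul_inner_translate (hb : Bornology.IsBounded Ω) (v : L2Form Ω k)
    {θ : E → ℝ} (hθ : Continuous θ) (hθc : HasCompactSupport θ) {ζ : E → Alt n k}
    (hζ : Continuous ζ) (hζc : HasCompactSupport ζ) :
    Integrable (fun a => θ a * ∫ z in Ω, ⟪v z, ζ (z - a)⟫_ℝ) ∧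
    ∫ a, θ a * ∫ z in Ω, ⟪v z, ζ (z - a)⟫_ℝ = ∫ x, ∫ z in Ω, θ (z - x) * ⟪v z, ζ x⟫_ℝ := by
  obtain ⟨B, hB⟩ := hζc.exists_bound_of_continuous hζ
  obtain ⟨B', hB'⟩ := hθc.exists_bound_of_continuous hθ
  have hv : StronglyMeasurable fun p : E × E => v p.1 :=
    (Lp.stronglyMeasurable v).comp_measurable measurable_fst
  have hG : Integrable (Function.uncurry fun z a => θ a * ⟪v z, ζ (z - a)⟫_ℝ)
      ((volume.restrict Ω).prod volume) := by
    have hbd : Integrable (fun p : E × E => (‖v p.1‖ * B) * ‖θ p.2‖)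
        ((volume.restrict Ω).prod volume) :=
      ((integrable_norm hb v).mul_const B).mul_prod
        (hθ.integrable_of_hasCompactSupport hθc).norm
    refine hbd.mono' (StronglyMeasurable.aestronglyMeasurable ?_) (Eventually.of_forall ?_)
    · exact (hθ.comp continuous_snd).stronglyMeasurable.mul
        (hv.inner (hζ.comp (continuous_fst.sub continuous_snd)).stronglyMeasurable)
    · rintro ⟨z, a⟩
      simp only [Function.uncurry, norm_mul]
      rw [mul_comm]
      refine mul_le_mul_of_nonneg_right ?_ (norm_nonneg _)
      exact (norm_inner_le_norm _ _).trans (mul_le_mul_of_nonneg_left (hB _) (norm_nonneg _))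
  have hH : Integrable (Function.uncurry fun z x => θ (z - x) * ⟪v z, ζ x⟫_ℝ)
      ((volume.restrict Ω).prod volume) := by
    have hbd : Integrable (fun p : E × E => (‖v p.1‖ * B') * ‖ζ p.2‖)
        ((volume.restrict Ω).prod volume) :=
      ((integrable_norm hb v).mul_const B').mul_prod
        (hζ.integrable_of_hasCompactSupport hζc).norm
    refine hbd.mono' (StronglyMeasurable.aestronglyMeasurable ?_) (Eventually.of_forall ?_)
    · exact (hθ.comp (continuous_fst.sub continuous_snd)).stronglyMeasurable.mul
        (hv.inner (hζ.comp continuous_snd).stronglyMeasurable)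
    · rintro ⟨z, x⟩
      simp only [Function.uncurry, norm_mul]
      calc ‖θ (z - x)‖ * ‖⟪v z, ζ x⟫_ℝ‖ ≤ B' * (‖v z‖ * ‖ζ x‖) :=
            mul_le_mul (hB' _) (norm_inner_le_norm _ _) (norm_nonneg _)
              ((norm_nonneg _).trans (hB' 0))
        _ = ‖v z‖ * B' * ‖ζ x‖ := by ring
  simp only [← integral_const_mul]
  refine ⟨hG.integral_prod_right, ?_⟩
  rw [← integral_integral_swap hG, ← integral_integral_swap hH]
  refine integral_congr_ae (Eventually.of_forall fun z => ?_)
  have := integral_sub_left_eq_self (fun a => θ a * ⟪v z, ζ (z - a)⟫_ℝ) volume z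
  simp only [sub_sub_cancel] at this
  exact this.symm

/-- If `v` has small local averages, and hardly distinguishes `ζ` from its translates by the vectors
in the support of `θ`, then `(v, ζ)` is small. -/
theorem abs_inner_le_of_average (hb : Bornology.IsBounded Ω) (v : L2Form Ω k)
    {θ : E → ℝ} (hθ : Continuous θ) (hθc : HasCompactSupport θ) (hθ0 : ∀ a, 0 ≤ θ a)
    (hθ1 : ∫ a, θ a = 1) (ζ : TestForm Ω k) {D ε : ℝ}
    (hD : ∀ a, θ a ≠ 0 → |(∫ z in Ω, ⟪v z, ζ.toFun (z - a)⟫_ℝ) -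
      ∫ z in Ω, ⟪v z, ζ.toFun z⟫_ℝ| ≤ D)
    (hε : ∀ x ∈ Ω, ∀ c : Alt n k, |∫ z in Ω, θ (z - x) * ⟪v z, c⟫_ℝ| ≤ ε * ‖v‖ * ‖c‖) :
    |∫ z in Ω, ⟪v z, ζ.toFun z⟫_ℝ| ≤ D + ε * ‖v‖ * ∫ x in Ω, ‖ζ.toFun x‖ := by
  obtain ⟨hint, heq⟩ := integral_mul_inner_translate hb v hθ hθc ζ.continuous ζ.compact
  have hθi : Integrable θ := hθ.integrable_of_hasCompactSupport hθc
  have hζi : Integrable fun x => ‖ζ.toFun x‖ :=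
    (ζ.continuous.integrable_of_hasCompactSupport ζ.compact).norm
  set F₀ := ∫ z in Ω, ⟪v z, ζ.toFun z⟫_ℝ with hF₀
  have h1 : |∫ a, θ a * ∫ z in Ω, ⟪v z, ζ.toFun (z - a)⟫_ℝ| ≤
      ε * ‖v‖ * ∫ x in Ω, ‖ζ.toFun x‖ := by
    rw [heq, ← Real.norm_eq_abs, setIntegral_eq_integral_of_forall_compl_eq_zero (s := Ω)
      (fun x hx => by rw [ζ.eq_zero_of_notMem hx, norm_zero]), ← integral_const_mul]
    refine norm_integral_le_of_norm_le (hζi.const_mul _) (Eventually.of_forall fun x => ?_)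
    by_cases hx : x ∈ Ω
    · exact hε x hx _
    · simp [ζ.eq_zero_of_notMem hx]
  have h2 : |(∫ a, θ a * ∫ z in Ω, ⟪v z, ζ.toFun (z - a)⟫_ℝ) - F₀| ≤ D := by
    have h3 : F₀ = ∫ a, θ a * F₀ := by
      rw [integral_mul_const, hθ1, one_mul]
    have h4 : D = ∫ a, θ a * D := by
      rw [integral_mul_const, hθ1, one_mul]
    rw [h3, ← integral_sub hint (hθi.mul_const _), h4, ← Real.norm_eq_abs]
    refine norm_integral_le_of_norm_le (hθi.mul_const D) (Eventually.of_forall fun a => ?_)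
    rw [← mul_sub, norm_mul, Real.norm_of_nonneg (hθ0 a)]
    by_cases ha : θ a = 0
    · simp [ha]
    · exact mul_le_mul_of_nonneg_left (hD a ha) (hθ0 a)
  rw [abs_le] at *
  constructor <;> linarith [h1.1, h1.2, h2.1, h2.2]

/-- On a bounded set, `L²` norms control `L¹` norms. -/
theorem exists_integral_norm_le (hb : Bornology.IsBounded Ω) :
    ∃ V : ℝ, 0 ≤ V ∧ ∀ ξ : TestForm Ω k, ∫ x in Ω, ‖ξ.toFun x‖ ≤ V * ‖ξ.toL2‖ := by
  have hfin : IsFiniteMeasure (volume.restrict Ω) := ⟨by simpa using hb.measure_lt_top⟩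
  have hne : (volume.restrict Ω) univ ^ (1 / (1 : ENNReal).toReal - 1 / (2 : ENNReal).toReal) ≠
      ⊤ := ENNReal.rpow_ne_top_of_nonneg (by norm_num) (measure_ne_top _ _)
  refine ⟨((volume.restrict Ω) univ ^
    (1 / (1 : ENNReal).toReal - 1 / (2 : ENNReal).toReal)).toReal, ENNReal.toReal_nonneg,
    fun ξ => ?_⟩
  have hm : AEStronglyMeasurable ξ.toFun (volume.restrict Ω) :=
    ξ.continuous.aestronglyMeasurable
  have h := eLpNorm_le_eLpNorm_mul_rpow_measure_univ (p := 1) (q := 2) (by norm_num) hm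
  rw [integral_norm_eq_lintegral_enorm hm, ← eLpNorm_one_eq_lintegral_enorm, TestForm.toL2,
    Lp.norm_toLp, mul_comm, ← ENNReal.toReal_mul]
  exact ENNReal.toReal_mono (ENNReal.mul_ne_top ξ.memLp.eLpNorm_ne_top hne) h

end Averaging

/-! ### The Poincaré inequality -/

section Poincare

variable {n : ℕ} {Ω : Set (EuclideanSpace ℝ (Fin n))} {k : ℤ}

local notation "E" => EuclideanSpace ℝ (Fin n)

/-- The sum of two test forms. -/
def TestForm.add (ζ η : TestForm Ω k) : TestForm Ω k where
  toFun z := ζ.toFun z + η.toFun z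
  smooth := ζ.smooth.add η.smooth
  compact := ζ.compact.add η.compact
  support_subset := (tsupport_add _ _).trans (union_subset ζ.support_subset η.support_subset)

theorem TestForm.delta_add (ζ η : TestForm Ω (k + 1)) : (ζ.add η).delta = ζ.delta + η.delta := by
  rw [TestForm.delta, TestForm.delta, TestForm.delta, ← MemLp.toLp_add]
  refine MemLp.toLp_congr _ _ (Eventually.of_forall fun z => ?_)
  have h : ∀ i, partialDeriv i (ζ.add η).toFun z =
      partialDeriv i ζ.toFun z + partialDeriv i η.toFun z := by
    intro i
    have := (ζ.smooth.differentiable (by simp) z).hasFDerivAt.fun_add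
      (η.smooth.differentiable (by simp) z).hasFDerivAt
    rw [partialDeriv, show (ζ.add η).toFun = fun z => ζ.toFun z + η.toFun z from rfl, this.fderiv]
    rfl
  simp only [Pi.add_apply, coD_eq_sum, h, map_add, Finset.sum_add_distrib, neg_add]

theorem TestForm.delta_smul (c : ℝ) (η : TestForm Ω (k + 1)) :
    (η.map (c • ContinuousLinearMap.id ℝ _)).delta = c • η.delta := by
  rw [TestForm.delta, TestForm.delta, ← MemLp.toLp_const_smul]
  refine MemLp.toLp_congr _ _ (Eventually.of_forall fun z => ?_)
  have h : ∀ i, partialDeriv i (η.map (c • ContinuousLinearMap.id ℝ _)).toFun z =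
      c • partialDeriv i η.toFun z := fun i =>
    partialDeriv_clm (c • ContinuousLinearMap.id ℝ _) (η.smooth.differentiable (by simp) z) i
  simp only [Pi.smul_apply, coD_eq_sum, h, map_smul, ← Finset.smul_sum, smul_neg]

variable (Ω k) in
/-- The forms `δη`, for test forms `η`. -/
def coexactTestForms : Submodule ℝ (L2Form Ω k) where
  carrier := range fun η : TestForm Ω (k + 1) => η.delta
  add_mem' := by
    rintro _ _ ⟨ζ, rfl⟩ ⟨η, rfl⟩
    exact ⟨ζ.add η, ζ.delta_add η⟩
  zero_mem' := by
    refine ⟨⟨fun _ => 0, contDiff_const, HasCompactSupport.zero, by simp [tsupport]⟩, ?_⟩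
    have h := TestForm.delta_smul (Ω := Ω) (k := k) 0
      ⟨fun _ => 0, contDiff_const, HasCompactSupport.zero, by simp [tsupport]⟩
    rw [zero_smul] at h
    rw [← h]
    congr 1
    simp [TestForm.map]
  smul_mem' := by
    rintro c _ ⟨η, rfl⟩
    exact ⟨_, η.delta_smul c⟩

/-- The orthogonal complement of the closed forms is the closure of the co-exact test forms. -/
theorem mem_closure_coexactTestForms {v : L2Form Ω k}
    (hv : ∀ w : HForm Ω k, w.d = 0 → ⟪v, w.form⟫_ℝ = 0) :
    v ∈ (coexactTestForms Ω k).topologicalClosure := by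
  rw [← Submodule.orthogonal_orthogonal_eq_closure, Submodule.mem_orthogonal]
  intro w hw
  rw [Submodule.mem_orthogonal] at hw
  have hwd : IsWeakD w 0 := fun η => by
    rw [inner_zero_left, real_inner_comm]
    exact (hw _ ⟨η, rfl⟩).symm
  rw [real_inner_comm]
  exact hv ⟨WithLp.toLp 2 (w, 0), hwd⟩ rfl

/-- The Poincaré inequality on the forms orthogonal to the closed ones and to a suitable
finite-dimensional space. -/
theorem IsBoundedLipschitzDomain.exists_finiteDimensional_poincare
    (hΩ : IsBoundedLipschitzDomain Ω) (k : ℤ) :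
    ∃ (F : Submodule ℝ (L2Form Ω (k + 1))) (C : ℝ), FiniteDimensional ℝ F ∧ 0 ≤ C ∧
      ∀ v : HForm Ω (k + 1), (∀ w : HForm Ω (k + 1), w.d = 0 → ⟪v.form, w.form⟫_ℝ = 0) →
        v.form ∈ Fᗮ → ‖v.form‖ ≤ C * ‖v.d‖ := by
  have hb := hΩ.2.1
  obtain ⟨N, χ, ν, ρ, t₀, ht₀, hχ, hχc, hχ1, hχs, hν, hρ, hρ1, hcone⟩ := hΩ.exists_partition
  obtain ⟨V, hV0, hV⟩ := exists_integral_norm_le (k := k + 1) hb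
  have hM : ∀ i, ∃ M : ℝ, ∀ x, ‖fderiv ℝ (χ i) x‖ ≤ M := fun i =>
    ((hχc i).fderiv (𝕜 := ℝ)).exists_bound_of_continuous ((hχ i).continuous_fderiv (by simp))
  choose M hM using hM
  have hM0 : ∀ i, 0 ≤ M i := fun i => (norm_nonneg _).trans (hM i 0)
  set P : Fin N → ℝ := fun i => 2 * (wedgeBound n (k + 1) +
    wedgeBound n k * interiorBound n k * M i) with hP
  have hw1 : 0 ≤ wedgeBound n (k + 1) := wedgeBound_nonneg
  have hw0 : 0 ≤ wedgeBound n k * interiorBound n k :=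
    mul_nonneg wedgeBound_nonneg interiorBound_nonneg
  have hP0 : ∀ i, 0 ≤ P i := fun i => by
    have := mul_nonneg hw0 (hM0 i)
    positivity
  have hPs : 0 ≤ ∑ i, P i := Finset.sum_nonneg fun i _ => hP0 i
  -- the length of the translations, and the size of the local averages
  set t : ℝ := min t₀ (1 / (4 * (∑ i, P i + 1))) with ht
  have ht0 : 0 < t := lt_min ht₀ (by positivity)
  have htt₀ : t ≤ t₀ := min_le_left _ _
  have htP : t * ∑ i, P i ≤ 1 / 4 := by
    calc t * ∑ i, P i ≤ 1 / (4 * (∑ i, P i + 1)) * (∑ i, P i + 1) := by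
          gcongr
          · exact min_le_right _ _
          · linarith
      _ = 1 / 4 := by field_simp
  set ε : ℝ := 1 / (4 * (N * V + 1)) with hε
  have hε0 : 0 < ε := by positivity
  have hεN : N * (ε * V) ≤ 1 / 4 := by
    calc N * (ε * V) = ε * (N * V) := by ring
      _ ≤ 1 / (4 * (N * V + 1)) * (N * V + 1) := by
          rw [← hε]
          gcongr
          linarith
      _ = 1 / 4 := by field_simp
  -- the averages are taken over vectors in the cones
  let B : ∀ i, ContDiffBump (t • ν i) := fun i =>
    ⟨t * ρ i / 2, t * ρ i, by have := hρ i; positivity, by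
      have := mul_pos ht0 (hρ i); linarith⟩
  let θ : Fin N → E → ℝ := fun i => (B i).normed volume
  have hθ : ∀ i, Continuous (θ i) := fun i => (B i).continuous_normed
  have hθc : ∀ i, HasCompactSupport (θ i) := fun i => (B i).hasCompactSupport_normed
  have hθ0 : ∀ i a, 0 ≤ θ i a := fun i a => (B i).nonneg_normed a
  have hθ1 : ∀ i, ∫ a, θ i a = 1 := fun i => (B i).integral_normed
  have hθs : ∀ i a, θ i a ≠ 0 → ∃ b, a = t • b ∧ ‖b - ν i‖ ≤ ρ i := by
    intro i a ha
    have ha' : a ∈ Function.support ((B i).normed volume) := ha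
    rw [(B i).support_normed_eq, Metric.mem_ball, dist_eq_norm] at ha'
    refine ⟨t⁻¹ • a, by rw [smul_inv_smul₀ ht0.ne'], ?_⟩
    have h1 : t⁻¹ • a - ν i = t⁻¹ • (a - t • ν i) := by
      rw [smul_sub, inv_smul_smul₀ ht0.ne']
    rw [h1, norm_smul, norm_inv, Real.norm_of_nonneg ht0.le, inv_mul_le_iff₀ ht0]
    exact ha'.le
  choose F hF hFε using fun i =>
    exists_finiteDimensional_average_le (k := k + 1) hb (hθ i) (hθc i) hε0
  refine ⟨⨆ i, F i, 2 * (t * ∑ i, P i), inferInstance, by positivity, fun v hv hvF => ?_⟩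
  set D : ℝ := t * (∑ i, P i) * (‖v.d‖ + ‖v.form‖) + N * (ε * V) * ‖v.form‖ with hD
  -- by density this bound extends to `ξ = v`, where the terms with `‖v‖` can be absorbed
  have key : ∀ ξ ∈ coexactTestForms Ω (k + 1), |⟪v.form, ξ⟫_ℝ| ≤ D * ‖ξ‖ := by
    rintro _ ⟨η, rfl⟩
    have hloc : ∀ i, |∫ z in Ω, ⟪v.form z, χ i z • η.coD.toFun z⟫_ℝ| ≤
        (t * P i * (‖v.d‖ + ‖v.form‖) + ε * V * ‖v.form‖) * ‖η.delta‖ := by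
      intro i
      have hvi : v.form ∈ (F i)ᗮ := Submodule.orthogonal_le (le_iSup F i) hvF
      have h1 := abs_inner_le_of_average hb v.form (hθ i) (hθc i) (hθ0 i) (hθ1 i)
        (η.coD.smul (hχ i)) (D := t * P i * (‖v.d‖ + ‖v.form‖) * ‖η.delta‖) (ε := ε) ?_
        (hFε i _ hvi)
      · refine h1.trans ?_
        have h2 : ∫ x in Ω, ‖(η.coD.smul (hχ i)).toFun x‖ ≤ V * ‖η.delta‖ := by
          refine (hV _).trans (mul_le_mul_of_nonneg_left ?_ hV0)
          rw [← η.toL2_coD, ← one_mul ‖η.coD.toL2‖]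
          refine TestForm.norm_toL2_le zero_le_one 0 fun z => ?_
          rw [sub_zero]
          refine (norm_smul_le _ _).trans ?_
          exact mul_le_mul_of_nonneg_right (hχ1 i z) (norm_nonneg _)
        have h3 := mul_le_mul_of_nonneg_left h2 (mul_nonneg hε0.le (norm_nonneg v.form))
        linarith
      · intro a ha
        obtain ⟨b, rfl, hbν⟩ := hθs i a ha
        have hb2 : ‖b‖ ≤ 2 := by
          calc ‖b‖ = ‖(b - ν i) + ν i‖ := by rw [sub_add_cancel]
            _ ≤ ‖b - ν i‖ + ‖ν i‖ := norm_add_le _ _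
            _ ≤ 2 := by linarith [hρ1 i, hν i]
        have h2 := abs_inner_translate_sub_le hb (hχ i) (hχ1 i) (hM i) (t • b) (by
          intro x hx hxΩ s hs0 hs1
          rw [smul_smul]
          exact hcone i x hx hxΩ _ (mul_nonneg hs0 ht0.le)
            ((mul_le_of_le_one_left ht0.le hs1).trans htt₀) b hbν) v η
        refine h2.trans (mul_le_mul_of_nonneg_right ?_ (norm_nonneg _))
        have hn1 : ‖t • b‖ ≤ t * 2 := by
          rw [norm_smul, Real.norm_of_nonneg ht0.le]
          gcongr
        have hX : 0 ≤ wedgeBound n k * interiorBound n k * M i := mul_nonneg hw0 (hM0 i)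
        calc ‖t • b‖ * (wedgeBound n (k + 1) * ‖v.d‖ +
              wedgeBound n k * interiorBound n k * M i * ‖v.form‖)
            ≤ (t * 2) * (wedgeBound n (k + 1) * ‖v.d‖ +
              wedgeBound n k * interiorBound n k * M i * ‖v.form‖) := by
              gcongr
          _ ≤ (t * 2) * ((wedgeBound n (k + 1) + wedgeBound n k * interiorBound n k * M i) *
              (‖v.d‖ + ‖v.form‖)) := by
              gcongr
              have e1 := mul_nonneg hw1 (norm_nonneg v.form)
              have e2 := mul_nonneg hX (norm_nonneg v.d)
              linarith
          _ = t * P i * (‖v.d‖ + ‖v.form‖) := by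
              rw [hP]; ring
    have hsum : ⟪v.form, η.delta⟫_ℝ = ∑ i, ∫ z in Ω, ⟪v.form z, χ i z • η.coD.toFun z⟫_ℝ := by
      rw [← η.toL2_coD, TestForm.toL2, inner_toLp_right, ← integral_finsetSum]
      · refine setIntegral_congr_fun hΩ.1.measurableSet fun z hz => ?_
        rw [← inner_sum, ← Finset.sum_smul, hχs z hz, one_smul]
      · intro i _
        obtain ⟨B, hB⟩ := (η.coD.smul (hχ i)).compact.exists_bound_of_continuous
          (η.coD.smul (hχ i)).continuous
        refine ((integrable_norm hb v.form).mul_const B).mono'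
          ((Lp.aestronglyMeasurable v.form).inner
            (η.coD.smul (hχ i)).continuous.aestronglyMeasurable)
          (Eventually.of_forall fun z => ?_)
        exact (norm_inner_le_norm _ _).trans
          (mul_le_mul_of_nonneg_left (hB z) (norm_nonneg _))
    calc |⟪v.form, η.delta⟫_ℝ|
        ≤ ∑ i, |∫ z in Ω, ⟪v.form z, χ i z • η.coD.toFun z⟫_ℝ| := by
          rw [hsum]; exact Finset.abs_sum_le_sum_abs _ _
      _ ≤ ∑ i, (t * P i * (‖v.d‖ + ‖v.form‖) + ε * V * ‖v.form‖) * ‖η.delta‖ :=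
          Finset.sum_le_sum fun i _ => hloc i
      _ = D * ‖η.delta‖ := by
          rw [← Finset.sum_mul, Finset.sum_add_distrib, ← Finset.sum_mul, ← Finset.mul_sum]
          rw [Finset.sum_const, Finset.card_univ, Fintype.card_fin, nsmul_eq_mul, hD]
          ring
  have hcl : IsClosed {ξ : L2Form Ω (k + 1) | |⟪v.form, ξ⟫_ℝ| ≤ D * ‖ξ‖} :=
    isClosed_le (continuous_const.inner continuous_id).abs (continuous_const.mul continuous_norm)
  have hself : |⟪v.form, v.form⟫_ℝ| ≤ D * ‖v.form‖ :=
    closure_minimal (fun ξ hξ => key ξ hξ) hcl (mem_closure_coexactTestForms hv)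
  rw [real_inner_self_eq_norm_sq, abs_of_nonneg (sq_nonneg _), sq] at hself
  rcases (norm_nonneg v.form).eq_or_lt with h0 | h0
  · rw [← h0]
    positivity
  · have h1 := le_of_mul_le_mul_right hself h0
    have h2 : t * (∑ i, P i) * ‖v.form‖ ≤ 1 / 4 * ‖v.form‖ := by gcongr
    have h3 : N * (ε * V) * ‖v.form‖ ≤ 1 / 4 * ‖v.form‖ := by gcongr
    rw [hD, mul_add] at h1
    linarith

/-! ### Hilbert space structure of `HΛ^k(Ω)` -/

/-- The weak exterior derivative is a closed operator. -/
theorem isClosed_graphD :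
    IsClosed (graphD Ω k : Set (WithLp 2 (L2Form Ω k × L2Form Ω (k + 1)))) := by
  have h : (graphD Ω k : Set (WithLp 2 (L2Form Ω k × L2Form Ω (k + 1)))) =
      ⋂ η : TestForm Ω (k + 1), {x | ⟪x.snd, η.toL2⟫_ℝ = ⟪x.fst, η.delta⟫_ℝ} := by
    ext x
    simp only [mem_iInter]
    rfl
  rw [h]
  exact isClosed_iInter fun η =>
    isClosed_eq ((WithLp.continuous_snd 2 _ _).inner continuous_const)
      ((WithLp.continuous_fst 2 _ _).inner continuous_const)

instance : CompleteSpace (HForm Ω k) := isClosed_graphD.completeSpace_coe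

theorem HForm.norm_sq (v : HForm Ω k) : ‖v‖ ^ 2 = ‖v.form‖ ^ 2 + ‖v.d‖ ^ 2 :=
  WithLp.prod_norm_sq_eq_of_L2 v.1

theorem HForm.inner_eq (v w : HForm Ω k) :
    ⟪v, w⟫_ℝ = ⟪v.form, w.form⟫_ℝ + ⟪v.d, w.d⟫_ℝ :=
  WithLp.prod_inner_apply v.1 w.1

theorem HForm.norm_form_le (v : HForm Ω k) : ‖v.form‖ ≤ ‖v‖ := by
  refine le_of_sq_le_sq ?_ (norm_nonneg v)
  rw [v.norm_sq]
  exact le_add_of_nonneg_right (sq_nonneg _)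

theorem HForm.norm_d_le (v : HForm Ω k) : ‖v.d‖ ≤ ‖v‖ := by
  refine le_of_sq_le_sq ?_ (norm_nonneg v)
  rw [v.norm_sq]
  exact le_add_of_nonneg_left (sq_nonneg _)

theorem HForm.norm_le (v : HForm Ω k) : ‖v‖ ≤ ‖v.form‖ + ‖v.d‖ := by
  refine le_of_sq_le_sq ?_ (by positivity)
  rw [v.norm_sq]
  nlinarith [norm_nonneg v.form, norm_nonneg v.d]

variable (Ω k) in
/-- The inclusion `HΛ^k(Ω) → L²Λ^k(Ω)`. -/
def formCLM : HForm Ω k →L[ℝ] L2Form Ω k :=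
  LinearMap.mkContinuous ⟨⟨HForm.form, fun _ _ => rfl⟩, fun _ _ => rfl⟩ 1 fun v => by
    rw [one_mul]; exact v.norm_form_le

variable (Ω k) in
/-- The exterior derivative `HΛ^k(Ω) → L²Λ^{k+1}(Ω)`. -/
def dCLM : HForm Ω k →L[ℝ] L2Form Ω (k + 1) :=
  LinearMap.mkContinuous ⟨⟨HForm.d, fun _ _ => rfl⟩, fun _ _ => rfl⟩ 1 fun v => by
    rw [one_mul]; exact v.norm_d_le

variable (Ω k) in
/-- The closed forms in `HΛ^k(Ω)`. -/
def closedForms : Submodule ℝ (HForm Ω k) := LinearMap.ker (dCLM Ω k).toLinearMap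

theorem mem_closedForms {v : HForm Ω k} : v ∈ closedForms Ω k ↔ v.d = 0 := Iff.rfl

theorem inner_form_of_mem_closedForms {v w : HForm Ω k} (hw : w ∈ closedForms Ω k) :
    ⟪v.form, w.form⟫_ℝ = ⟪v, w⟫_ℝ := by
  rw [HForm.inner_eq, mem_closedForms.1 hw, inner_zero_right, add_zero]

/-- The Poincaré inequality: the exterior derivative has closed range. -/
theorem IsBoundedLipschitzDomain.poincare (hΩ : IsBoundedLipschitzDomain Ω) (k : ℤ) :
    ∃ C, 0 ≤ C ∧ ∀ v ∈ (closedForms Ω k)ᗮ, ‖v‖ ≤ C * ‖HForm.d v‖ := by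
  obtain ⟨k, rfl⟩ : ∃ m, k = m + 1 := ⟨k - 1, by ring⟩
  obtain ⟨F, C, hF, hC, hpoin⟩ := hΩ.exists_finiteDimensional_poincare k
  refine exists_bound_on_orthogonal_ker (dCLM Ω (k + 1))
    (F.orthogonalProjectionOnto.comp (formCLM Ω (k + 1))) (C + 1) fun x hx hxF => ?_
  have h1 : HForm.form x ∈ Fᗮ := Submodule.orthogonalProjectionOnto_eq_zero_iff.1 hxF
  have h2 := hpoin x (fun w hw => by
    rw [inner_form_of_mem_closedForms (mem_closedForms.2 hw)]
    exact Submodule.inner_left_of_mem_orthogonal (mem_closedForms.2 hw) hx) h1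
  have h3 := HForm.norm_le x
  change ‖x‖ ≤ (C + 1) * ‖HForm.d x‖
  linarith

end Poincare

/-! ### Well-posedness of the mixed Hodge–Laplace problem -/

section HodgeLaplace

/-- For a bounded operator `A` between Hilbert spaces that is bounded below on the orthogonal
complement of its kernel, the equation `A* A u = g` is solvable if `g` vanishes on the kernel. -/
theorem exists_inner_map_eq {H Y : Type*} [NormedAddCommGroup H] [InnerProductSpace ℝ H]
    [CompleteSpace H] [NormedAddCommGroup Y] [InnerProductSpace ℝ Y] (A : H →L[ℝ] Y) {C : ℝ}
    (h : ∀ x ∈ (LinearMap.ker A.toLinearMap)ᗮ, ‖x‖ ≤ C * ‖A x‖) (g : H →L[ℝ] ℝ)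
    (hg : ∀ x, A x = 0 → g x = 0) {G : ℝ} (hG0 : 0 ≤ G)
    (hG : ∀ x, g x ≤ G * ‖x‖) :
    ∃ u ∈ (LinearMap.ker A.toLinearMap)ᗮ, (∀ v, ⟪A u, A v⟫_ℝ = g v) ∧ ‖u‖ ≤ C ^ 2 * G := by
  set N := LinearMap.ker A.toLinearMap with hN
  have hNc : IsClosed (N : Set H) := A.isClosed_ker
  have : CompleteSpace N := hNc.completeSpace_coe
  let B : Nᗮ →L[ℝ] Nᗮ →L[ℝ] ℝ := LinearMap.mkContinuous₂
    (LinearMap.mk₂ ℝ (fun u v : Nᗮ => ⟪A u, A v⟫_ℝ)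
      (fun _ _ _ => by simp [inner_add_left]) (fun _ _ _ => by simp [real_inner_smul_left])
      (fun _ _ _ => by simp [inner_add_right]) (fun _ _ _ => by simp [real_inner_smul_right]))
    (‖A‖ * ‖A‖) (fun u v => by
      refine (norm_inner_le_norm _ _).trans ?_
      calc ‖A u‖ * ‖A v‖ ≤ (‖A‖ * ‖(u : H)‖) * (‖A‖ * ‖(v : H)‖) := by
            gcongr <;> exact A.le_opNorm _
        _ = ‖A‖ * ‖A‖ * ‖u‖ * ‖v‖ := by rw [Submodule.coe_norm, Submodule.coe_norm]; ring)
  have hB : ∀ u v : Nᗮ, B u v = ⟪A u, A v⟫_ℝ := fun _ _ => rfl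
  have hsq : ∀ u ∈ Nᗮ, ‖u‖ ^ 2 ≤ C ^ 2 * ⟪A u, A u⟫_ℝ := fun u hu => by
    rw [real_inner_self_eq_norm_sq, ← mul_pow]
    exact pow_le_pow_left₀ (norm_nonneg _) (h u hu) 2
  have hco : IsCoercive B := by
    refine ⟨1 / (C ^ 2 + 1), by positivity, fun u => ?_⟩
    rw [hB, div_mul_eq_mul_div, div_mul_eq_mul_div, one_mul, div_le_iff₀ (by positivity), ← sq]
    have h1 := hsq u u.2
    have h2 : 0 ≤ ⟪A u, A u⟫_ℝ := real_inner_self_nonneg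
    rw [Submodule.coe_norm]
    linarith
  let w : Nᗮ := (InnerProductSpace.toDual ℝ Nᗮ).symm (g.comp Nᗮ.subtypeL)
  let u : Nᗮ := hco.continuousLinearEquivOfBilin.symm w
  have hu : ∀ v : Nᗮ, ⟪A u, A v⟫_ℝ = g v := fun v => by
    rw [← hB, ← hco.continuousLinearEquivOfBilin_apply, ContinuousLinearEquiv.apply_symm_apply,
      InnerProductSpace.toDual_symm_apply]
    rfl
  refine ⟨u, u.2, fun v => ?_, ?_⟩
  · obtain ⟨y, hy, z, hz, rfl⟩ := N.exists_add_mem_mem_orthogonal v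
    have hy0 : A y = 0 := hy
    rw [map_add, map_add, hy0, zero_add, hg y hy0, zero_add]
    exact hu ⟨z, hz⟩
  · have h1 := hsq u u.2
    rw [hu u] at h1
    have h2 := h1.trans (mul_le_mul_of_nonneg_left (hG u) (sq_nonneg C))
    rcases (norm_nonneg (u : H)).eq_or_lt with h0 | h0
    · rw [← h0]
      positivity
    · rw [sq, ← mul_assoc] at h2
      exact le_of_mul_le_mul_right h2 h0

variable {n : ℕ} {Ω : Set (EuclideanSpace ℝ (Fin n))} {j : ℤ}

/-- A form is harmonic if and only if `(p, 0)` lies in the graph of `d` and `p` is orthogonal to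
the exact forms; both conditions are closed. -/
theorem isClosed_harmonic : IsClosed (harmonic Ω j : Set (L2Form Ω (j + 1))) := by
  have hcont : Continuous fun p : L2Form Ω (j + 1) =>
      (WithLp.toLp 2 (p, 0) : WithLp 2 (L2Form Ω (j + 1) × L2Form Ω (j + 1 + 1))) :=
    (WithLp.prod_continuous_toLp 2 _ _).comp (continuous_id.prodMk continuous_const)
  have heq : (harmonic Ω j : Set (L2Form Ω (j + 1))) =
      (fun p : L2Form Ω (j + 1) => (WithLp.toLp 2 (p, 0) :
          WithLp 2 (L2Form Ω (j + 1) × L2Form Ω (j + 1 + 1)))) ⁻¹' (graphD Ω (j + 1) : Set _) ∩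
        ⋂ τ : HForm Ω j, {p | ⟪p, τ.d⟫_ℝ = 0} := by
    ext p
    simp only [mem_inter_iff, mem_iInter]
    constructor
    · rintro ⟨⟨⟨⟨⟨a, b⟩⟩, hv⟩, hp, hd⟩, h⟩
      change a = p at hp
      change b = 0 at hd
      subst hp hd
      exact ⟨hv, h⟩
    · rintro ⟨hv, h⟩
      exact ⟨⟨⟨_, hv⟩, rfl, rfl⟩, h⟩
  rw [heq]
  exact (isClosed_graphD.preimage hcont).inter (isClosed_iInter fun τ =>
    isClosed_eq (continuous_id.inner continuous_const) continuous_const)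

instance : CompleteSpace (harmonic Ω j) := isClosed_harmonic.completeSpace_coe

theorem HForm.exact_mem_closedForms (τ : HForm Ω j) : τ.exact ∈ closedForms Ω (j + 1) :=
  τ.exact_d

/-- The form part of an element of `(ker d)ᗮ` is orthogonal to all closed forms. -/
theorem inner_form_eq_zero {v w : HForm Ω j} (hv : v ∈ (closedForms Ω j)ᗮ)
    (hw : w ∈ closedForms Ω j) : ⟪v.form, w.form⟫_ℝ = 0 := by
  rw [inner_form_of_mem_closedForms hw]
  exact Submodule.inner_left_of_mem_orthogonal hw hv

/-- Solvability of `(du, dv) = g(v)` on a bounded Lipschitz domain. -/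
theorem IsBoundedLipschitzDomain.exists_inner_d_eq (hΩ : IsBoundedLipschitzDomain Ω) (k : ℤ) :
    ∃ C, 0 ≤ C ∧ ∀ (g : HForm Ω k →L[ℝ] ℝ) (G : ℝ), (∀ v ∈ closedForms Ω k, g v = 0) → 0 ≤ G →
      (∀ v, g v ≤ G * ‖v‖) → ∃ u ∈ (closedForms Ω k)ᗮ,
        (∀ v : HForm Ω k, ⟪HForm.d u, v.d⟫_ℝ = g v) ∧ ‖u‖ ≤ C * G := by
  obtain ⟨C, hC, h⟩ := hΩ.poincare k
  exact ⟨C ^ 2, sq_nonneg C, fun g G hg hG0 hG => exists_inner_map_eq (dCLM Ω k) h g hg hG0 hG⟩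

/-- The components of the solution: `σ` with `dσ` the exact part of `f`, the harmonic part `p` of
`f`, and `u = u' + ds`, where `u'` is orthogonal to the closed forms and `ds` is exact. -/
theorem IsBoundedLipschitzDomain.exists_isMixedSolution (hΩ : IsBoundedLipschitzDomain Ω)
    (j : ℤ) : ∃ C, 0 ≤ C ∧ ∀ f : L2Form Ω (j + 1), ∃ (σ : HForm Ω j) (u : HForm Ω (j + 1))
      (p : harmonic Ω j), IsMixedSolution f σ u p ∧ ‖σ‖ ≤ C * ‖f‖ ∧ ‖u‖ ≤ C * ‖f‖ ∧
        ‖p‖ ≤ C * ‖f‖ := by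
  obtain ⟨C₁, hC₁, h₁⟩ := hΩ.exists_inner_d_eq j
  obtain ⟨C₂, hC₂, h₂⟩ := hΩ.exists_inner_d_eq (j + 1)
  refine ⟨C₁ + C₁ * C₁ + C₂ * (2 + C₁) + 1, by positivity, fun f => ?_⟩
  have hf0 := norm_nonneg f
  -- the exact part of `f`
  obtain ⟨σ, hσ, hσd, hσn⟩ := h₁ ((innerSL ℝ f).comp (dCLM Ω j)) ‖f‖
    (fun v hv => by
      change ⟪f, v.d⟫_ℝ = 0
      rw [mem_closedForms.1 hv, inner_zero_right]) hf0
    (fun v => (real_inner_le_norm f v.d).trans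
      (mul_le_mul_of_nonneg_left v.norm_d_le hf0))
  replace hσd : ∀ τ : HForm Ω j, ⟪σ.d, τ.d⟫_ℝ = ⟪f, τ.d⟫_ℝ := hσd
  -- the exact part of `u`
  obtain ⟨s, hs, hsd, hsn⟩ := h₁ ((innerSL ℝ σ.form).comp (formCLM Ω j)) ‖σ‖
    (fun v hv => inner_form_eq_zero hσ hv) (norm_nonneg σ)
    (fun v => (real_inner_le_norm σ.form v.form).trans
      (mul_le_mul σ.norm_form_le v.norm_form_le (norm_nonneg _) (norm_nonneg _)))
  replace hsd : ∀ τ : HForm Ω j, ⟪s.d, τ.d⟫_ℝ = ⟪σ.form, τ.form⟫_ℝ := hsd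
  -- the harmonic part of `f`
  let p : harmonic Ω j := (harmonic Ω j).orthogonalProjectionOnto f
  have hpn : ‖p‖ ≤ ‖f‖ := (harmonic Ω j).norm_orthogonalProjectionOnto_apply_le f
  have hp : ∀ q ∈ harmonic Ω j, ⟪f - (p : L2Form Ω (j + 1)), q⟫_ℝ = 0 := fun q hq => by
    have : f - (p : L2Form Ω (j + 1)) ∈ (harmonic Ω j)ᗮ :=
      (harmonic Ω j).sub_starProjection_mem_orthogonal f
    exact Submodule.inner_left_of_mem_orthogonal hq this
  have hpd : ∀ τ : HForm Ω j, ⟪(p : L2Form Ω (j + 1)), τ.d⟫_ℝ = 0 := p.2.2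
  -- the remaining part of `f` is orthogonal to the closed forms, by the Hodge decomposition
  have hortho : ∀ v ∈ closedForms Ω (j + 1),
      ⟪f - σ.d - (p : L2Form Ω (j + 1)), HForm.form v⟫_ℝ = 0 := by
    intro v hv
    obtain ⟨r, -, hrd, -⟩ := h₁ ((innerSL ℝ (HForm.form v)).comp (dCLM Ω j)) ‖HForm.form v‖
      (fun w hw => by
        change ⟪HForm.form v, w.d⟫_ℝ = 0
        rw [mem_closedForms.1 hw, inner_zero_right]) (norm_nonneg _)
      (fun w => (real_inner_le_norm _ w.d).trans
        (mul_le_mul_of_nonneg_left w.norm_d_le (norm_nonneg _)))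
    replace hrd : ∀ τ : HForm Ω j, ⟪r.d, τ.d⟫_ℝ = ⟪HForm.form v, τ.d⟫_ℝ := hrd
    have hq : HForm.form v - r.d ∈ harmonic Ω j := by
      refine ⟨⟨v - r.exact, rfl, ?_⟩, fun τ => ?_⟩
      · exact mem_closedForms.1 (sub_mem hv r.exact_mem_closedForms)
      · rw [inner_sub_left, hrd, sub_self]
    have e1 := hp _ hq
    have e2 : ⟪σ.d, HForm.form v - r.d⟫_ℝ = 0 := by
      rw [real_inner_comm]; exact hq.2 σ
    have e3 := hσd r
    have e4 := hpd r
    simp only [inner_sub_left, inner_sub_right] at e1 e2 ⊢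
    linarith
  have hgn : ‖f - σ.d - (p : L2Form Ω (j + 1))‖ ≤ (2 + C₁) * ‖f‖ := by
    calc ‖f - σ.d - (p : L2Form Ω (j + 1))‖ ≤ ‖f‖ + ‖σ.d‖ + ‖p‖ :=
          (norm_sub_le _ _).trans (add_le_add_left (norm_sub_le _ _) _)
      _ ≤ ‖f‖ + C₁ * ‖f‖ + ‖f‖ := by
          gcongr
          exact σ.norm_d_le.trans hσn
      _ = (2 + C₁) * ‖f‖ := by ring
  obtain ⟨u', hu', hud, hun⟩ := h₂
    ((innerSL ℝ (f - σ.d - (p : L2Form Ω (j + 1)))).comp (formCLM Ω (j + 1))) ((2 + C₁) * ‖f‖)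
    hortho (by positivity)
    (fun v => (real_inner_le_norm _ v.form).trans
      (mul_le_mul hgn v.norm_form_le (norm_nonneg _) (by positivity)))
  replace hud : ∀ v : HForm Ω (j + 1), ⟪HForm.d u', v.d⟫_ℝ =
    ⟪f - σ.d - (p : L2Form Ω (j + 1)), v.form⟫_ℝ := hud
  have hform : HForm.form (u' + s.exact) = HForm.form u' + s.d := rfl
  have hd : HForm.d (u' + s.exact) = HForm.d u' := add_zero _
  refine ⟨σ, u' + s.exact, p, ⟨fun τ => ?_, fun v => ?_, fun q => ?_⟩, ?_, ?_, ?_⟩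
  · rw [hform, inner_add_left, hsd, ← τ.exact_form,
      inner_form_eq_zero hu' τ.exact_mem_closedForms]
    ring
  · rw [hd, hud, inner_sub_left, inner_sub_left]
    ring
  · obtain ⟨⟨w, hw, hwd⟩, hqd⟩ := q.2
    rw [hform, inner_add_left, real_inner_comm _ s.d, hqd s, add_zero, ← hw]
    exact inner_form_eq_zero hu' (mem_closedForms.2 hwd)
  · refine hσn.trans (mul_le_mul_of_nonneg_right ?_ hf0)
    have := mul_nonneg hC₁ hC₁
    have := mul_nonneg hC₂ (by positivity : 0 ≤ 2 + C₁)
    linarith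
  · have hse : ‖s.exact‖ ≤ C₁ * (C₁ * ‖f‖) := by
      have h1 : ‖s.exact‖ ≤ ‖s.d‖ := by
        have := s.exact.norm_le
        rwa [s.exact_d, s.exact_form, norm_zero, add_zero] at this
      exact (h1.trans s.norm_d_le).trans (hsn.trans (mul_le_mul_of_nonneg_left hσn hC₁))
    have h2 := norm_add_le u' s.exact
    have h3 : 0 ≤ (C₁ + 1) * ‖f‖ := by positivity
    linarith
  · refine hpn.trans (le_mul_of_one_le_left hf0 ?_)
    have := mul_nonneg hC₁ hC₁
    have := mul_nonneg hC₂ (by positivity : 0 ≤ 2 + C₁)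
    linarith

theorem IsMixedSolution.sub {f f' : L2Form Ω (j + 1)} {σ σ' : HForm Ω j} {u u' : HForm Ω (j + 1)}
    {p p' : harmonic Ω j} (h : IsMixedSolution f σ u p) (h' : IsMixedSolution f' σ' u' p') :
    IsMixedSolution (f - f') (σ - σ') (u - u') (p - p') where
  eq_τ τ := by
    have e1 := h.eq_τ τ
    have e2 := h'.eq_τ τ
    change ⟪σ.form - σ'.form, τ.form⟫_ℝ - ⟪u.form - u'.form, τ.d⟫_ℝ = 0
    rw [inner_sub_left, inner_sub_left]
    linarith
  eq_v v := by
    have e1 := h.eq_v v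
    have e2 := h'.eq_v v
    change ⟪σ.d - σ'.d, v.form⟫_ℝ + ⟪u.d - u'.d, v.d⟫_ℝ +
      ⟪(p : L2Form Ω (j + 1)) - p', v.form⟫_ℝ = _
    simp only [inner_sub_left]
    linarith
  eq_q q := by
    have e1 := h.eq_q q
    have e2 := h'.eq_q q
    change ⟪u.form - u'.form, _⟫_ℝ = 0
    rw [inner_sub_left]
    linarith

/-- Uniqueness for the homogeneous problem, by testing with `dσ`, `σ`, `p` and `u`. -/
theorem IsMixedSolution.eq_zero (hΩ : IsOpen Ω) {σ : HForm Ω j} {u : HForm Ω (j + 1)}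
    {p : harmonic Ω j} (h : IsMixedSolution 0 σ u p) : σ = 0 ∧ u = 0 ∧ p = 0 := by
  have hσd : σ.d = 0 := by
    have e1 := h.eq_v σ.exact
    rw [σ.exact_d, σ.exact_form, inner_zero_right, inner_zero_left, p.2.2 σ] at e1
    rw [← inner_self_eq_zero (𝕜 := ℝ)]
    linarith
  have hσ : σ.form = 0 := by
    have e1 := h.eq_τ σ
    rw [hσd, inner_zero_right, sub_zero] at e1
    exact inner_self_eq_zero.1 e1
  have hp : p = 0 := by
    obtain ⟨⟨w, hw, hwd⟩, -⟩ := p.2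
    have e1 := h.eq_v w
    simp only [hσd, hwd, hw, inner_zero_left, inner_zero_right, zero_add] at e1
    exact Subtype.ext (inner_self_eq_zero.1 e1)
  have hud : u.d = 0 := by
    have e1 := h.eq_v u
    simp only [hσd, hp, Submodule.coe_zero, inner_zero_left, zero_add, add_zero] at e1
    exact inner_self_eq_zero.1 e1
  have hu : u.form = 0 := by
    have hmem : u.form ∈ harmonic Ω j := by
      refine ⟨⟨u, rfl, hud⟩, fun τ => ?_⟩
      have e1 := h.eq_τ τ
      rw [hσ, inner_zero_left] at e1
      linarith
    exact inner_self_eq_zero.1 (h.eq_q ⟨u.form, hmem⟩)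
  exact ⟨HForm.ext_of_form hΩ hσ, HForm.ext_of_form hΩ hu, hp⟩

/-- Uniqueness for the mixed Hodge–Laplace problem. -/
theorem IsMixedSolution.unique (hΩ : IsOpen Ω) {f : L2Form Ω (j + 1)} {σ σ' : HForm Ω j}
    {u u' : HForm Ω (j + 1)} {p p' : harmonic Ω j} (h : IsMixedSolution f σ u p)
    (h' : IsMixedSolution f σ' u' p') : σ = σ' ∧ u = u' ∧ p = p' := by
  have h0 := h.sub h'
  rw [sub_self] at h0
  obtain ⟨h1, h2, h3⟩ := h0.eq_zero hΩ
  exact ⟨sub_eq_zero.1 h1, sub_eq_zero.1 h2, sub_eq_zero.1 h3⟩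

/-- The first equation of the problem is the strong equation `δu = σ`. -/
theorem IsMixedSolution.isWeakDelta_form {f : L2Form Ω (j + 1)} {σ : HForm Ω j}
    {u : HForm Ω (j + 1)} {p : harmonic Ω j} (h : IsMixedSolution f σ u p) :
    IsWeakDelta u.form σ.form :=
  fun τ => sub_eq_zero.1 (h.eq_τ τ.toH)

/-- The second equation of the problem is the strong equation `δdu = f - p - dσ`. -/
theorem IsMixedSolution.isWeakDelta_d {f : L2Form Ω (j + 1)} {σ : HForm Ω j}
    {u : HForm Ω (j + 1)} {p : harmonic Ω j} (h : IsMixedSolution f σ u p) :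
    IsWeakDelta u.d (f - p - σ.d) := by
  intro v
  have e1 : ⟪σ.d, v.toL2⟫_ℝ + ⟪u.d, v.d⟫_ℝ + ⟪(p : L2Form Ω (j + 1)), v.toL2⟫_ℝ =
    ⟪f, v.toL2⟫_ℝ := h.eq_v v.toH
  rw [inner_sub_left, inner_sub_left]
  linarith

end HodgeLaplace

/-! ### Local form of the decomposed problem -/

section LocalEquations

variable {n : ℕ} {k : ℤ}

/-- A variational identity with a boundary term says that `δw = g` and that the boundary unknown is
the normal trace of `w`. -/
theorem hasNorTrace_of_pairing {D : Set (EuclideanSpace ℝ (Fin n))} {w : L2Form D (k + 1)}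
    {g : L2Form D k} {t : NorTrace D k}
    (h : ∀ τ : HForm D k, ⟪g, τ.form⟫_ℝ - ⟪w, τ.d⟫_ℝ + tracePairing D k τ.tan t = 0) :
    HasNorTrace w t := by
  have hδ : IsWeakDelta w g := fun τ => by
    have h1 := h τ.toH
    rw [tan_eq_zero_iff.2 τ.toH_mem, map_zero, LinearMap.zero_apply, add_zero] at h1
    exact sub_eq_zero.1 h1
  refine ⟨⟨WithLp.toLp 2 (w, g), hδ⟩, rfl, ?_⟩
  rw [← sub_eq_zero]
  refine tracePairing_right_nondegenerate fun s => ?_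
  obtain ⟨τ, rfl⟩ := (HForm₀ D k).mkQ_surjective s
  have h1 := h τ
  have h2 : tracePairing D k τ.tan (HStarForm.nor ⟨WithLp.toLp 2 (w, g), hδ⟩) =
    ⟪τ.d, w⟫_ℝ - ⟪τ.form, g⟫_ℝ := tracePairing_tan_nor _ _
  rw [map_sub, sub_eq_zero]
  refine h2.trans ?_
  rw [real_inner_comm, real_inner_comm g]
  change _ = tracePairing D k τ.tan t
  linarith

/-- The value of the trace pairing with a normal trace, by integration by parts. -/
theorem HasNorTrace.tracePairing_eq {D : Set (EuclideanSpace ℝ (Fin n))} (hD : IsOpen D)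
    {w : L2Form D (k + 1)} {g : L2Form D k} {t : NorTrace D k} (h : HasNorTrace w t)
    (hδ : IsWeakDelta w g) (τ : HForm D k) :
    tracePairing D k τ.tan t = ⟪w, τ.d⟫_ℝ - ⟪g, τ.form⟫_ℝ := by
  obtain ⟨W, rfl, rfl⟩ := h
  have : W = ⟨WithLp.toLp 2 (W.form, g), hδ⟩ := HStarForm.ext_of_form hD rfl
  have hg : W.delta = g := congrArg HStarForm.delta this
  rw [tracePairing_tan_nor, hg, real_inner_comm, real_inner_comm g]

/-- The normal trace of a form is unique, because `δ` is determined by the form. -/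
theorem HasNorTrace.unique {D : Set (EuclideanSpace ℝ (Fin n))} (hD : IsOpen D)
    {w : L2Form D (k + 1)} {t t' : NorTrace D k} (h : HasNorTrace w t) (h' : HasNorTrace w t') :
    t = t' := by
  obtain ⟨W, hW, rfl⟩ := h
  obtain ⟨W', hW', rfl⟩ := h'
  rw [HStarForm.ext_of_form hD (hW.trans hW'.symm)]

variable {ι : Type*} {Ω : Set (EuclideanSpace ℝ (Fin n))}
  {K : ι → Set (EuclideanSpace ℝ (Fin n))} {j : ℤ} [Fintype ι]

/-- Testing an identity between sums over the subdomains on a single subdomain. -/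
theorem eq_zero_of_sum_eq_zero {X : ι → Type*} [∀ i, Zero (X i)] (φ : ∀ i, X i → ℝ)
    (h0 : ∀ i, φ i 0 = 0) (h : ∀ x : ∀ i, X i, ∑ i, φ i (x i) = 0) (i : ι) (x : X i) :
    φ i x = 0 := by
  classical
  have h1 := h (Pi.single i x)
  rw [Finset.sum_eq_single i] at h1
  · rwa [Pi.single_eq_same] at h1
  · intro i' _ hi'
    rw [Pi.single_eq_of_ne hi', h0]
  · simp

variable {hK : ∀ i, K i ⊆ Ω} {f : L2Form Ω (j + 1)} {x : DDTuple hK j}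

/-- The first equation of the decomposed problem on a single subdomain. -/
theorem IsDDSolution.local_τ (h : IsDDSolution f x) (i : ι) (τ : HForm (K i) j) :
    ⟪HForm.form (x.σ i), τ.form⟫_ℝ - ⟪HForm.form (x.u i), τ.d⟫_ℝ +
      tracePairing (K i) j τ.tan (x.uNor i) = 0 := by
  refine eq_zero_of_sum_eq_zero (X := fun i => HForm (K i) j)
    (fun i τ => ⟪HForm.form (x.σ i), HForm.form τ⟫_ℝ - ⟪HForm.form (x.u i), HForm.d τ⟫_ℝ +
      tracePairing (K i) j (HForm.tan τ) (x.uNor i)) (fun i => ?_) (fun τ => ?_) i τ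
  · have h1 : HForm.form (0 : HForm (K i) j) = 0 := rfl
    have h2 : HForm.d (0 : HForm (K i) j) = 0 := rfl
    have h3 : HForm.tan (0 : HForm (K i) j) = 0 := rfl
    simp [h1, h2, h3]
  · rw [Finset.sum_add_distrib, Finset.sum_sub_distrib]
    exact h.eq_τ τ

/-- The second equation of the decomposed problem on a single subdomain, as an equation for
`δ(du)`. -/
theorem IsDDSolution.local_v (h : IsDDSolution f x) (i : ι) (v : HForm (K i) (j + 1)) :
    ⟪restrictL2 (hK i) f - ((x.pBar i).1 + restrictL2 (hK i) x.p.1) - HForm.d (x.σ i),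
      v.form⟫_ℝ - ⟪HForm.d (x.u i), v.d⟫_ℝ +
      tracePairing (K i) (j + 1) v.tan (x.ρNor i) = 0 := by
  refine eq_zero_of_sum_eq_zero (X := fun i => HForm (K i) (j + 1))
    (fun i v => ⟪restrictL2 (hK i) f - ((x.pBar i).1 + restrictL2 (hK i) x.p.1) -
      HForm.d (x.σ i), HForm.form v⟫_ℝ - ⟪HForm.d (x.u i), HForm.d v⟫_ℝ +
      tracePairing (K i) (j + 1) (HForm.tan v) (x.ρNor i)) (fun i => ?_) (fun v => ?_) i v
  · have h1 : HForm.form (0 : HForm (K i) (j + 1)) = 0 := rfl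
    have h2 : HForm.d (0 : HForm (K i) (j + 1)) = 0 := rfl
    have h3 : HForm.tan (0 : HForm (K i) (j + 1)) = 0 := rfl
    simp [h1, h2, h3]
  · have h1 := h.eq_v v
    simp only [brokenInner, brokenPairing] at h1
    simp only [inner_sub_left, Finset.sum_add_distrib, Finset.sum_sub_distrib]
    linarith

theorem IsDDSolution.σTan_eq (h : IsDDSolution f x) (i : ι) :
    x.σTan.1 i = HForm.tan (x.σ i) := by
  rw [← sub_eq_zero]
  exact tracePairing_left_nondegenerate fun s =>
    eq_zero_of_sum_eq_zero (X := fun i => NorTrace (K i) j)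
      (fun i s => tracePairing (K i) j (x.σTan.1 i - HForm.tan (x.σ i)) s) (fun _ => map_zero _)
      h.eq_vNor i s

theorem IsDDSolution.uTan_eq (h : IsDDSolution f x) (i : ι) :
    x.uTan.1 i = HForm.tan (x.u i) := by
  rw [← sub_eq_zero]
  exact tracePairing_left_nondegenerate fun s =>
    eq_zero_of_sum_eq_zero (X := fun i => NorTrace (K i) (j + 1))
      (fun i s => tracePairing (K i) (j + 1) (x.uTan.1 i - HForm.tan (x.u i)) s)
      (fun _ => map_zero _) h.eq_ηNor i s

theorem IsDDSolution.pBar_eq (h : IsDDSolution f x) (i : ι) : x.pBar i = 0 := by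
  have h1 := eq_zero_of_sum_eq_zero (X := fun i => harmonic₀ (K i) j)
    (fun i v => ⟪(x.pBar i).1, v.1⟫_ℝ) (fun _ => inner_zero_right _) h.eq_vBar i (x.pBar i)
  exact Subtype.ext (inner_self_eq_zero.1 h1)

theorem eq_orthogonalProjectionOnto_iff {H : Type*} [NormedAddCommGroup H] [InnerProductSpace ℝ H]
    {U : Submodule ℝ H} [U.HasOrthogonalProjection] {u : H} {w : U} :
    w = U.orthogonalProjectionOnto u ↔ ∀ q : U, ⟪(w : H) - u, (q : H)⟫_ℝ = 0 := by
  constructor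
  · rintro rfl q
    rw [← neg_sub, inner_neg_left, neg_eq_zero]
    exact Submodule.inner_left_of_mem_orthogonal q.2 (U.sub_starProjection_mem_orthogonal u)
  · intro h
    refine Subtype.ext (Submodule.eq_starProjection_of_mem_of_inner_eq_zero w.2 fun q hq => ?_).symm
    rw [← neg_sub, inner_neg_left, h ⟨q, hq⟩, neg_zero]

theorem IsDDSolution.uBar_eq (h : IsDDSolution f x) (i : ι) :
    x.uBar i = (harmonic₀ (K i) j).orthogonalProjectionOnto (HForm.form (x.u i)) :=
  eq_orthogonalProjectionOnto_iff.2 fun q =>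
    eq_zero_of_sum_eq_zero (X := fun i => harmonic₀ (K i) j)
      (fun i q => ⟪(x.uBar i).1 - HForm.form (x.u i), q.1⟫_ℝ) (fun _ => inner_zero_right _)
      h.eq_qBar i q

end LocalEquations

/-! ### Equivalence of the two problems -/

section Equivalence

variable {n : ℕ} {ι : Type*} {Ω : Set (EuclideanSpace ℝ (Fin n))}
  {K : ι → Set (EuclideanSpace ℝ (Fin n))} {j : ℤ} [Fintype ι]

/-- A solution of the decomposed problem is single-valued and solves the mixed Hodge–Laplace
problem. -/
theorem IsDDSolution.isDecomposedMixedSolution (hT : IsDecomposition Ω K)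
    {f : L2Form Ω (j + 1)} {x : DDTuple hT.subset j} (h : IsDDSolution f x) :
    IsDecomposedMixedSolution f x where
  mixed := by
    have hσt : (fun i => HForm.tan (x.σ i)) ∈ singleValuedTan hT.subset j := by
      rw [← funext h.σTan_eq]; exact x.σTan.2
    have hut : (fun i => HForm.tan (x.u i)) ∈ singleValuedTan hT.subset (j + 1) := by
      rw [← funext h.uTan_eq]; exact x.uTan.2
    obtain ⟨σ, hσ⟩ := hT.exists_glue x.σ hσt
    obtain ⟨u, hu⟩ := hT.exists_glue x.u hut
    refine ⟨σ, u, hσ, hu, ⟨fun τ => ?_, fun v => ?_, fun q => ?_⟩⟩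
    · -- on unbroken test forms the boundary terms cancel
      have h1 := h.eq_τ fun i => restrictH (hT.subset i) τ
      have h2 := h.eq_τTan ⟨_, ⟨τ, rfl⟩⟩
      have h3 : brokenPairing (fun i => HForm.tan (restrictH (hT.subset i) τ)) x.uNor = 0 := h2
      rw [h3, add_zero] at h1
      rw [hT.inner_eq_sum σ.form, hT.inner_eq_sum u.form]
      simp only [← hσ, ← hu] at h1
      exact h1
    · have h1 := h.eq_v fun i => restrictH (hT.subset i) v
      have h2 := h.eq_vTan ⟨_, ⟨v, rfl⟩⟩
      have h3 : brokenPairing (fun i => HForm.tan (restrictH (hT.subset i) v)) x.ρNor = 0 := h2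
      rw [h3, sub_zero] at h1
      rw [hT.inner_eq_sum σ.d, hT.inner_eq_sum u.d, hT.inner_eq_sum f,
        hT.inner_eq_sum (x.p : L2Form Ω (j + 1))]
      simp only [← hσ, ← hu, h.pBar_eq, Submodule.coe_zero, zero_add] at h1
      exact h1
    · have h1 := h.eq_q q
      rw [hT.inner_eq_sum u.form]
      simp only [← hu] at h1
      exact h1
  pBar := h.pBar_eq
  uNor i := hasNorTrace_of_pairing (h.local_τ i)
  ρNor i := hasNorTrace_of_pairing (h.local_v i)
  uBar := h.uBar_eq
  σTan := h.σTan_eq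
  uTan := h.uTan_eq

theorem IsDecomposedMixedSolution.isDDSolution (hT : IsDecomposition Ω K)
    {f : L2Form Ω (j + 1)} {x : DDTuple hT.subset j} (h : IsDecomposedMixedSolution f x) :
    IsDDSolution f x := by
  obtain ⟨σ, u, hσ, hu, hm⟩ := h.mixed
  have hformσ : ∀ i, HForm.form (x.σ i) = restrictL2 (hT.subset i) σ.form := fun i => by
    rw [← hσ]; rfl
  have hdσ : ∀ i, HForm.d (x.σ i) = restrictL2 (hT.subset i) σ.d := fun i => by
    rw [← hσ]; rfl
  have hformu : ∀ i, HForm.form (x.u i) = restrictL2 (hT.subset i) u.form := fun i => by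
    rw [← hu]; rfl
  have hdu : ∀ i, HForm.d (x.u i) = restrictL2 (hT.subset i) u.d := fun i => by
    rw [← hu]; rfl
  -- on each subdomain `δu = σ` and `δdu = f - p - dσ`, which evaluates the boundary terms
  have hpu : ∀ i (τ : HForm (K i) j), tracePairing (K i) j τ.tan (x.uNor i) =
      ⟪restrictL2 (hT.subset i) u.form, τ.d⟫_ℝ -
        ⟪restrictL2 (hT.subset i) σ.form, τ.form⟫_ℝ := fun i τ => by
    have h1 := h.uNor i
    rw [hformu] at h1
    exact h1.tracePairing_eq (hT.isOpen i) (hm.isWeakDelta_form.restrict (hT.subset i)) τ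
  have hpρ : ∀ i (v : HForm (K i) (j + 1)), tracePairing (K i) (j + 1) v.tan (x.ρNor i) =
      ⟪restrictL2 (hT.subset i) u.d, v.d⟫_ℝ -
        ⟪restrictL2 (hT.subset i) (f - (x.p : L2Form Ω (j + 1)) - σ.d), v.form⟫_ℝ := fun i v => by
    have h1 := h.ρNor i
    rw [hdu] at h1
    exact h1.tracePairing_eq (hT.isOpen i) (hm.isWeakDelta_d.restrict (hT.subset i)) v
  exact {
    eq_τ := fun τ => by
      simp only [brokenInner, brokenPairing, hformσ, hformu, hpu, ← Finset.sum_sub_distrib,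
        ← Finset.sum_add_distrib]
      exact Finset.sum_eq_zero fun i _ => by ring
    eq_v := fun v => by
      simp only [brokenInner, brokenPairing, hdσ, hdu, hpρ, h.pBar, Submodule.coe_zero, zero_add,
        ← Finset.sum_sub_distrib, ← Finset.sum_add_distrib]
      refine Finset.sum_congr rfl fun i _ => ?_
      rw [restrictL2_sub, restrictL2_sub, inner_sub_left, inner_sub_left]
      ring
    eq_qBar := fun q => Finset.sum_eq_zero fun i _ =>
      eq_orthogonalProjectionOnto_iff.1 (h.uBar i) (q i)
    eq_vNor := fun v => Finset.sum_eq_zero fun i _ => by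
      rw [Pi.sub_apply, h.σTan, sub_self, map_zero, LinearMap.zero_apply]
    eq_ηNor := fun v => Finset.sum_eq_zero fun i _ => by
      rw [Pi.sub_apply, h.uTan, sub_self, map_zero, LinearMap.zero_apply]
    eq_q := fun q => by
      simp only [brokenInner, hformu]
      rw [← hT.inner_eq_sum]
      exact hm.eq_q q
    eq_vBar := fun v => Finset.sum_eq_zero fun i _ => by
      change ⟪(x.pBar i).1, (v i).1⟫_ℝ = 0
      rw [h.pBar]
      exact inner_zero_left _
    eq_τTan := by
      rintro ⟨_, τ, rfl⟩
      have h1 : ∀ i, tracePairing (K i) j (unbrokenTan hT.subset j τ i) (x.uNor i) =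
        ⟪restrictL2 (hT.subset i) u.form, restrictL2 (hT.subset i) τ.d⟫_ℝ -
        ⟪restrictL2 (hT.subset i) σ.form, restrictL2 (hT.subset i) τ.form⟫_ℝ := fun i =>
          hpu i (restrictH (hT.subset i) τ)
      simp only [brokenPairing, h1, Finset.sum_sub_distrib]
      rw [← hT.inner_eq_sum, ← hT.inner_eq_sum]
      linarith [hm.eq_τ τ]
    eq_vTan := by
      rintro ⟨_, v, rfl⟩
      have h1 : ∀ i, tracePairing (K i) (j + 1) (unbrokenTan hT.subset (j + 1) v i) (x.ρNor i) =
        ⟪restrictL2 (hT.subset i) u.d, restrictL2 (hT.subset i) v.d⟫_ℝ -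
        ⟪restrictL2 (hT.subset i) (f - (x.p : L2Form Ω (j + 1)) - σ.d), restrictL2 (hT.subset i) v.form⟫_ℝ :=
          fun i => hpρ i (restrictH (hT.subset i) v)
      simp only [brokenPairing, h1, Finset.sum_sub_distrib]
      rw [← hT.inner_eq_sum, ← hT.inner_eq_sum, inner_sub_left, inner_sub_left]
      linarith [hm.eq_v v] }

theorem isDDSolution_iff (hT : IsDecomposition Ω K) {f : L2Form Ω (j + 1)}
    {x : DDTuple hT.subset j} : IsDDSolution f x ↔ IsDecomposedMixedSolution f x :=
  ⟨fun h => h.isDecomposedMixedSolution hT, fun h => h.isDDSolution hT⟩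

end Equivalence

/-! ### Well-posedness of the decomposed problem -/

section WellPosed

variable {n : ℕ} {ι : Type*} {Ω : Set (EuclideanSpace ℝ (Fin n))}
  {K : ι → Set (EuclideanSpace ℝ (Fin n))} {j : ℤ}

/-- All unknowns of the decomposed problem are functions of `σ`, `u` and `p`. -/
theorem IsDecomposedMixedSolution.unique (hΩ : IsOpen Ω) (hT : IsDecomposition Ω K)
    {f : L2Form Ω (j + 1)} {x y : DDTuple hT.subset j} (hx : IsDecomposedMixedSolution f x)
    (hy : IsDecomposedMixedSolution f y) : y = x := by
  obtain ⟨σ, u, hσ, hu, hm⟩ := hx.mixed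
  obtain ⟨σ', u', hσ', hu', hm'⟩ := hy.mixed
  obtain ⟨rfl, rfl, hp⟩ := hm'.unique hΩ hm
  have eσ : y.σ = x.σ := funext fun i => (hσ' i).symm.trans (hσ i)
  have eu : y.u = x.u := funext fun i => (hu' i).symm.trans (hu i)
  refine DDTuple.ext eσ eu (funext fun i => (hy.pBar i).trans (hx.pBar i).symm)
    (funext fun i => ?_) (funext fun i => ?_) hp (funext fun i => ?_)
    (Subtype.ext (funext fun i => ?_)) (Subtype.ext (funext fun i => ?_))
  · have h1 := hy.uNor i
    rw [eu] at h1
    exact h1.unique (hT.isOpen i) (hx.uNor i)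
  · have h1 := hy.ρNor i
    rw [eu] at h1
    exact h1.unique (hT.isOpen i) (hx.ρNor i)
  · rw [hy.uBar, hx.uBar, eu]
  · rw [hy.σTan, hx.σTan, eσ]
  · rw [hy.uTan, hx.uTan, eu]

/-- The nine-tuple that belongs to a solution of the mixed Hodge–Laplace problem. -/
def IsMixedSolution.toDDTuple {f : L2Form Ω (j + 1)} {σ : HForm Ω j} {u : HForm Ω (j + 1)}
    {p : harmonic Ω j} (h : IsMixedSolution f σ u p) (hK : ∀ i, K i ⊆ Ω) : DDTuple hK j where
  σ i := restrictH (hK i) σ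
  u i := restrictH (hK i) u
  pBar _ := 0
  uNor i := (restrictHStar (hK i) ⟨WithLp.toLp 2 (u.form, σ.form), h.isWeakDelta_form⟩).nor
  ρNor i := (restrictHStar (hK i)
    ⟨WithLp.toLp 2 (u.d, f - (p : L2Form Ω (j + 1)) - σ.d), h.isWeakDelta_d⟩).nor
  p := p
  uBar i := (harmonic₀ (K i) j).orthogonalProjectionOnto (HForm.form (restrictH (hK i) u))
  σTan := ⟨unbrokenTan hK j σ, ⟨σ, rfl⟩⟩
  uTan := ⟨unbrokenTan hK (j + 1) u, ⟨u, rfl⟩⟩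

theorem IsMixedSolution.isDecomposedMixedSolution {f : L2Form Ω (j + 1)} {σ : HForm Ω j}
    {u : HForm Ω (j + 1)} {p : harmonic Ω j} (h : IsMixedSolution f σ u p) (hK : ∀ i, K i ⊆ Ω) :
    IsDecomposedMixedSolution f (h.toDDTuple hK) where
  mixed := ⟨σ, u, fun _ => rfl, fun _ => rfl, h⟩
  pBar _ := rfl
  uNor _ := ⟨_, rfl, rfl⟩
  ρNor _ := ⟨_, rfl, rfl⟩
  uBar _ := rfl
  σTan _ := rfl
  uTan _ := rfl

theorem norm_restrictH_le {D : Set (EuclideanSpace ℝ (Fin n))} (h : D ⊆ Ω) {k : ℤ}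
    (v : HForm Ω k) : ‖restrictH h v‖ ≤ ‖v‖ := by
  refine le_of_sq_le_sq ?_ (norm_nonneg v)
  rw [HForm.norm_sq, HForm.norm_sq, restrictH_form, restrictH_d]
  gcongr <;> exact norm_restrictL2_le h _

theorem norm_tan_le {D : Set (EuclideanSpace ℝ (Fin n))} {k : ℤ} (v : HForm D k) :
    ‖v.tan‖ ≤ ‖v‖ :=
  Submodule.Quotient.norm_mk_le _ v

theorem norm_nor_le {D : Set (EuclideanSpace ℝ (Fin n))} {k : ℤ} (v : HStarForm D k) :
    ‖v.nor‖ ≤ ‖v.form‖ + ‖v.delta‖ := by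
  refine (Submodule.Quotient.norm_mk_le _ v).trans ?_
  refine le_of_sq_le_sq ?_ (by positivity)
  have h : ‖v‖ ^ 2 = ‖v.form‖ ^ 2 + ‖v.delta‖ ^ 2 := WithLp.prod_norm_sq_eq_of_L2 v.1
  rw [h]
  nlinarith [norm_nonneg v.form, norm_nonneg v.delta]

variable [Fintype ι]

/-- A common bound for the components of a nine-tuple bounds its norm. -/
theorem DDTuple.size_le {hK : ∀ i, K i ⊆ Ω} {x : DDTuple hK j} {A : ℝ} (hA : 0 ≤ A)
    (h : ∀ i, ‖x.σ i‖ ≤ A ∧ ‖x.u i‖ ≤ A ∧ ‖x.pBar i‖ ≤ A ∧ ‖x.uNor i‖ ≤ A ∧ ‖x.ρNor i‖ ≤ A ∧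
      ‖x.uBar i‖ ≤ A ∧ ‖x.σTan.1 i‖ ≤ A ∧ ‖x.uTan.1 i‖ ≤ A) (hp : ‖x.p‖ ≤ A) :
    x.size ≤ √(Fintype.card ι * 8 + 1) * A := by
  have h0 : √(Fintype.card ι * 8 + 1) * A = √((Fintype.card ι * 8 + 1) * A ^ 2) := by
    rw [Real.sqrt_mul (by positivity), Real.sqrt_sq hA]
  rw [h0]
  refine Real.sqrt_le_sqrt ?_
  have h1 : ∀ i ∈ (Finset.univ : Finset ι), ‖x.σ i‖ ^ 2 + ‖x.u i‖ ^ 2 + ‖x.pBar i‖ ^ 2 +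
      ‖x.uNor i‖ ^ 2 + ‖x.ρNor i‖ ^ 2 + ‖x.uBar i‖ ^ 2 + ‖x.σTan.1 i‖ ^ 2 +
      ‖x.uTan.1 i‖ ^ 2 ≤ 8 * A ^ 2 := by
    intro i _
    obtain ⟨a1, a2, a3, a4, a5, a6, a7, a8⟩ := h i
    calc _ ≤ A ^ 2 + A ^ 2 + A ^ 2 + A ^ 2 + A ^ 2 + A ^ 2 + A ^ 2 + A ^ 2 := by gcongr
      _ = 8 * A ^ 2 := by ring
  have h2 := Finset.sum_le_card_nsmul _ _ _ h1
  rw [nsmul_eq_mul, Finset.card_univ] at h2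
  have h3 : ‖x.p‖ ^ 2 ≤ A ^ 2 := by gcongr
  linarith

/-- The normal traces of `u` and `du` are bounded through `δu = σ` and `δdu = f - p - dσ`; the latter
is the largest of the nine bounds. -/
theorem IsMixedSolution.size_toDDTuple_le {f : L2Form Ω (j + 1)} {σ : HForm Ω j}
    {u : HForm Ω (j + 1)} {p : harmonic Ω j} (h : IsMixedSolution f σ u p) (hK : ∀ i, K i ⊆ Ω)
    {C : ℝ} (hC : 0 ≤ C) (hσ : ‖σ‖ ≤ C * ‖f‖) (hu : ‖u‖ ≤ C * ‖f‖) (hp : ‖p‖ ≤ C * ‖f‖) :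
    (h.toDDTuple hK).size ≤ √(Fintype.card ι * 8 + 1) * ((3 * C + 1) * ‖f‖) := by
  have hf := norm_nonneg f
  have hCf : 0 ≤ C * ‖f‖ := mul_nonneg hC hf
  have hle : C * ‖f‖ ≤ (3 * C + 1) * ‖f‖ := by linarith
  refine DDTuple.size_le (by positivity) (fun i => ⟨?_, ?_, ?_, ?_, ?_, ?_, ?_, ?_⟩) (hp.trans hle)
  · exact (norm_restrictH_le (hK i) σ).trans (hσ.trans hle)
  · exact (norm_restrictH_le (hK i) u).trans (hu.trans hle)
  · change ‖(0 : harmonic₀ (K i) j)‖ ≤ _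
    rw [norm_zero]
    positivity
  · refine (norm_nor_le _).trans ?_
    change ‖restrictL2 (hK i) u.form‖ + ‖restrictL2 (hK i) σ.form‖ ≤ _
    linarith [norm_restrictL2_le (hK i) u.form, norm_restrictL2_le (hK i) σ.form,
      u.norm_form_le, σ.norm_form_le]
  · refine (norm_nor_le _).trans ?_
    change ‖restrictL2 (hK i) u.d‖ + ‖restrictL2 (hK i) (f - (p : L2Form Ω (j + 1)) - σ.d)‖ ≤ _
    have h1 : ‖f - (p : L2Form Ω (j + 1)) - σ.d‖ ≤ ‖f‖ + ‖p‖ + ‖σ.d‖ :=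
      (norm_sub_le _ _).trans (add_le_add_left (norm_sub_le _ _) _)
    linarith [norm_restrictL2_le (hK i) u.d, norm_restrictL2_le (hK i) (f - (p : L2Form Ω (j + 1)) - σ.d),
      u.norm_d_le, σ.norm_d_le]
  · refine (Submodule.norm_orthogonalProjectionOnto_apply_le _ _).trans ?_
    exact ((HForm.norm_form_le _).trans (norm_restrictH_le (hK i) u)).trans (hu.trans hle)
  · exact (norm_tan_le _).trans ((norm_restrictH_le (hK i) σ).trans (hσ.trans hle))
  · exact (norm_tan_le _).trans ((norm_restrictH_le (hK i) u).trans (hu.trans hle))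

end WellPosed

end

end HodgeDD

theorem mainTheorem2 {n : ℕ} {Ω : Set (EuclideanSpace ℝ (Fin n))}
    (hΩ : IsBoundedLipschitzDomain Ω) {ι : Type*} [Fintype ι]
    {K : ι → Set (EuclideanSpace ℝ (Fin n))} (hT : IsDecomposition Ω K) (j : ℤ) :
    (∀ (f : L2Form Ω (j + 1)) (x : DDTuple hT.subset j),
      IsDDSolution f x ↔ IsDecomposedMixedSolution f x) ∧
    (∃ C : ℝ, ∀ f : L2Form Ω (j + 1), ∃ x : DDTuple hT.subset j,
      IsDDSolution f x ∧ (∀ y : DDTuple hT.subset j, IsDDSolution f y → y = x) ∧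
        x.size ≤ C * ‖f‖) := by
  refine ⟨fun f x => isDDSolution_iff hT, ?_⟩
  obtain ⟨C, hC, h⟩ := hΩ.exists_isMixedSolution j
  refine ⟨√(Fintype.card ι * 8 + 1) * (3 * C + 1), fun f => ?_⟩
  obtain ⟨σ, u, p, hm, hσ, hu, hp⟩ := h f
  have hx := hm.isDecomposedMixedSolution hT.subset
  refine ⟨hm.toDDTuple hT.subset, (isDDSolution_iff hT).2 hx, fun y hy => ?_, ?_⟩
  · exact hx.unique hΩ.1 hT ((isDDSolution_iff hT).1 hy)
  · rw [mul_assoc]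
    exact hm.size_toDDTuple_le hT.subset hC hσ hu hp
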